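/- A polytope is the convex hull of a finite nonempty set of points in some $\mathbb{R}^n$; a $d$-polytope is a polytope of affine dimension $d$. The extension complexity $\mathrm{xc}(P)$ of a polytope $P$ is the minimal number of facets of a polytope $Q$ (of any dimension) for which there is a linear map $\pi$ with $\pi(Q)=P$. Two polytopes have the same (unlabeled) combinatorial type if their face lattices are isomorphic, and a realization of a combinatorial type is any polytope of that type. For $d\in\mathbb{N}$ let $N(d)$ be the number of combinatorial types of $d$-polytopes with $d+4$ vertices that have a realization $P$ with $\mathrm{xc}(P)=d+3$. Then $N(d)$ is finite for every $d$, and $N(d)=\Theta(d^2)$ as $d\to\infty$; that is, there are constants $0<c\le C$ and $d_0$ such that $c\,d^2\le N(d)\le C\,d^2$ for all $d\ge d_0$. -/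

import Mathlib

open Filter Asymptotics

/-- A (convex) polytope: the convex hull of a finite nonempty set of points of some `ℝⁿ`.
It need not be full-dimensional in its ambient space. -/
structure Polytope where
  /-- dimension of the ambient space -/
  n : ℕ
  /-- the underlying point set -/
  carrier : Set (Fin n → ℝ)
  exists_hull : ∃ s : Finset (Fin n → ℝ), s.Nonempty ∧ convexHull ℝ (s : Set (Fin n → ℝ)) = carrier

open Classical in
/-- The affine dimension of a subset of `ℝⁿ`, with the convention that the empty set has
dimension `-1`. -/
noncomputable def affDim {n : ℕ} (S : Set (Fin n → ℝ)) : ℤ :=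
  if S.Nonempty then (Module.finrank ℝ (vectorSpan ℝ S) : ℤ) else -1

namespace Polytope

/-- The dimension of a polytope; a `d`-polytope is a polytope `P` with `P.dim = d`. -/
noncomputable def dim (P : Polytope) : ℤ := affDim P.carrier

/-- The vertices of a polytope. -/
def vertices (P : Polytope) : Set (Fin P.n → ℝ) := P.carrier.extremePoints ℝ

/-- The faces of a polytope: the empty set and the subsets on which some linear functional attains
its maximum over the polytope (the polytope itself included). They are ordered by inclusion, so
that this type is the face lattice. -/
abbrev Face (P : Polytope) : Type := {F : Set (Fin P.n → ℝ) // IsExposed ℝ P.carrier F}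

/-- The facets of a polytope: its faces of codimension one. -/
def facets (P : Polytope) : Set (Set (Fin P.n → ℝ)) :=
  {F | IsExposed ℝ P.carrier F ∧ affDim F + 1 = P.dim}

/-- The extension complexity: the minimal number of facets of a polytope (of any dimension, in any
ambient space) that can be linearly projected onto `P`. -/
noncomputable def xc (P : Polytope) : ℕ :=
  sInf {N : ℕ | ∃ (Q : Polytope) (L : (Fin Q.n → ℝ) →ₗ[ℝ] (Fin P.n → ℝ)),
    L '' Q.carrier = P.carrier ∧ Q.facets.ncard = N}

/-- Combinatorial equivalence: isomorphism of face lattices. -/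
instance combSetoid : Setoid Polytope where
  r P Q := Nonempty (P.Face ≃o Q.Face)
  iseqv :=
    { refl := fun _ => ⟨OrderIso.refl _⟩
      symm := fun ⟨e⟩ => ⟨e.symm⟩
      trans := fun ⟨e⟩ ⟨f⟩ => ⟨e.trans f⟩ }

/-- The (unlabeled) combinatorial types of polytopes. -/
def CombType : Type := Quotient combSetoid

/-- The combinatorial type of a polytope. -/
def combType (P : Polytope) : CombType := Quotient.mk combSetoid P

/-- The combinatorial types of `d`-polytopes with `d + 4` vertices that have a realization of
extension complexity `d + 3`. -/
def typesWithXc (d : ℕ) : Set CombType :=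
  {c | ∃ P : Polytope, P.combType = c ∧ P.dim = (d : ℤ) ∧ P.vertices.ncard = d + 4 ∧
    P.xc = d + 3}

end Polytope

/-!
Homogenizing a lift `Q` of `P` and recording the slacks of its `N` facets identifies `Q` with the
section at height `h = 1` of the cone of nonnegative vectors of a subspace `W` of `ℝᴺ`
(`exists_isOrthantLift`). A face of such a section is determined by the support of a vector in its
relative interior. If the projection onto `P` collapses exactly the line spanned by `v`, the faces
of `P` correspond to the supports `σ` of nonnegative vectors of `W` off which `v` is balanced, that
is, vanishes or takes both signs (`face_orderIso_faceSupports`); `v = 0` covers the case `Q = P`.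
The vertices of `P` are the atoms of its face lattice, hence the minimal supports of this kind.

*Upper bound.* Let `P` be a `d`-polytope with `N + 1` vertices and extension complexity `N = d + 3`.
Comparing dimensions, `W` has codimension at most two. If `W` is everything, `Q` is a simplex and
`P` has at most `N` vertices. If `W` is a hyperplane with normal vector `α`, then `Q` is an iterated
pyramid over a product of two simplices and `P` is its projection along a line; few vertices can be
lost, which forces `α` or the direction `v` of the line to have few nonzero coordinates
(`few_coordinates_of_ncard_eq`). If `W` has codimension two, then `Q` is `P` up to an affine
isomorphism, and having only `N + 1` minimal supports forces all but boundedly many coordinates to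
be minimal supports by themselves, that is, to be apices of pyramids
(`card_not_isCircuit_singleton_le`). In each case the family of supports is tame: outside a set of
bounded size, membership depends only on which of three colours of coordinates occur in the support
and in its complement. A tame family is determined up to isomorphism by a bounded amount of data and
the sizes of the colour classes, two of which may be chosen freely; this gives `O(d²)` types
(`exists_bound_tame_types`).

*Lower bound.* Let `P` be the join of a triangular prism, a direct sum of a `(p-1)`-simplex and a
`(q-1)`-simplex, and a simplex. It is a projection along a line of an iterated pyramid over the
prism with `d + 3` facets, and it has `d + 4` vertices. It has at least `d + 3` facets, while a
polytope with `d + 4` vertices and a lift with at most `d + 2` facets is itself affinely isomorphic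
to that lift (`le_xc_of_coatoms`); so `xc P = d + 3`. A vertex of the direct sum lies outside
exactly `q` or `p` facets and every other vertex lies outside at most two, so the face lattice
determines the unordered pair `{p, q}` when `p, q ≥ 3` (`missCounts_faceSupports`).
Quadratically many pairs are available.
-/

/-! ### Homogenization and exposed faces -/

namespace Polytope

/-- The linear span of `S` placed at height one in `ℝⁿ × ℝ`. -/
def homSpan {n : ℕ} (S : Set (Fin n → ℝ)) : Submodule ℝ ((Fin n → ℝ) × ℝ) :=
  Submodule.span ℝ ((fun x => (x, (1 : ℝ))) '' S)

lemma mem_homSpan {n : ℕ} {S : Set (Fin n → ℝ)} {x : Fin n → ℝ} (hx : x ∈ S) :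
    (x, (1 : ℝ)) ∈ homSpan S :=
  Submodule.subset_span ⟨x, hx, rfl⟩

lemma homSpan_mono {n : ℕ} {S S' : Set (Fin n → ℝ)} (h : S ⊆ S') : homSpan S ≤ homSpan S' :=
  Submodule.span_mono (Set.image_mono h)

lemma homSpan_convexHull {n : ℕ} (S : Set (Fin n → ℝ)) :
    homSpan (convexHull ℝ S) = homSpan S := by
  refine le_antisymm (Submodule.span_le.2 ?_) (homSpan_mono (subset_convexHull ℝ S))
  rintro _ ⟨x, hx, rfl⟩
  have hc : Convex ℝ {x : Fin n → ℝ | (x, (1 : ℝ)) ∈ homSpan S} := by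
    intro x hx y hy a b ha hb hab
    have := (homSpan S).add_mem ((homSpan S).smul_mem a hx) ((homSpan S).smul_mem b hy)
    simpa [hab] using this
  exact convexHull_min (fun y hy => mem_homSpan hy) hc hx

lemma sub_smul_mem_vectorSpan {n : ℕ} {S : Set (Fin n → ℝ)} {p : Fin n → ℝ} (hp : p ∈ S)
    {z : (Fin n → ℝ) × ℝ} (hz : z ∈ homSpan S) : z.1 - z.2 • p ∈ vectorSpan ℝ S := by
  induction hz using Submodule.span_induction with
  | mem z hz =>
    obtain ⟨x, hx, rfl⟩ := hz
    simpa using vsub_mem_vectorSpan ℝ hx hp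
  | zero => simp
  | add z w _ _ hz hw =>
    convert add_mem hz hw using 1
    simp only [Prod.fst_add, Prod.snd_add, add_smul]; abel
  | smul a z _ hz =>
    convert (vectorSpan ℝ S).smul_mem a hz using 1
    simp [smul_sub, smul_smul]

lemma finrank_homSpan {n : ℕ} (S : Set (Fin n → ℝ)) :
    (Module.finrank ℝ (homSpan S) : ℤ) = affDim S + 1 := by
  classical
  rcases S.eq_empty_or_nonempty with rfl | ⟨p, hp⟩
  · rw [homSpan, Set.image_empty, Submodule.span_empty]
    simp [affDim]
  have hne : S.Nonempty := ⟨p, hp⟩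
  let f : homSpan S →ₗ[ℝ] ℝ := (LinearMap.snd ℝ (Fin n → ℝ) ℝ).domRestrict (homSpan S)
  have hr : Module.finrank ℝ (LinearMap.range f) = 1 := by
    have : LinearMap.range f = ⊤ := by
      refine LinearMap.range_eq_top.2 fun t => ⟨t • ⟨(p, 1), mem_homSpan hp⟩, ?_⟩
      simp [f]
    rw [this]; simp
  have hk : Module.finrank ℝ (LinearMap.ker f) = Module.finrank ℝ (vectorSpan ℝ S) := by
    have h1 : (LinearMap.ker f).map (homSpan S).subtype =
        (vectorSpan ℝ S).map (LinearMap.inl ℝ (Fin n → ℝ) ℝ) := by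
      apply le_antisymm
      · rintro _ ⟨⟨z, hz⟩, hk, rfl⟩
        have hk : z.2 = 0 := hk
        refine ⟨z.1, ?_, ?_⟩
        · simpa [hk] using sub_smul_mem_vectorSpan hp hz
        · ext <;> simp [hk]
      · rw [Submodule.map_le_iff_le_comap, vectorSpan_def, Submodule.span_le]
        rintro _ ⟨x, hx, y, hy, rfl⟩
        refine ⟨⟨(x, 1) - (y, 1), sub_mem (mem_homSpan hx) (mem_homSpan hy)⟩, ?_, ?_⟩
        · simp [f]
        · simp
    have e1 := (Submodule.equivMapOfInjective _ (homSpan S).injective_subtype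
      (LinearMap.ker f)).finrank_eq
    have e2 := (Submodule.equivMapOfInjective _
      (LinearMap.inl_injective (R := ℝ) (M := Fin n → ℝ) (M₂ := ℝ)) (vectorSpan ℝ S)).finrank_eq
    rw [e1, e2, h1]
  have := LinearMap.finrank_range_add_finrank_ker f
  simp only [affDim, if_pos hne]
  omega

lemma isCompact_carrier (P : Polytope) : IsCompact P.carrier := by
  obtain ⟨s, -, hs⟩ := P.exists_hull
  rw [← hs]
  exact Set.Finite.isCompact_convexHull ℝ s.finite_toSet

lemma convex_carrier (P : Polytope) : Convex ℝ P.carrier := by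
  obtain ⟨s, -, hs⟩ := P.exists_hull
  rw [← hs]
  exact convex_convexHull ℝ _

lemma nonempty_carrier (P : Polytope) : P.carrier.Nonempty := by
  obtain ⟨s, hne, hs⟩ := P.exists_hull
  rw [← hs]
  exact convexHull_nonempty_iff.2 hne

/-- An exposed face of a polytope is spanned by the generators it contains (Krein–Milman). -/
lemma isExposed_eq_convexHull {n : ℕ} {s : Finset (Fin n → ℝ)} {F : Set (Fin n → ℝ)}
    (hF : IsExposed ℝ (convexHull ℝ (s : Set (Fin n → ℝ))) F) :
    F = convexHull ℝ ((s : Set (Fin n → ℝ)) ∩ F) := by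
  have hconv : Convex ℝ F := hF.convex (convex_convexHull ℝ _)
  refine Set.Subset.antisymm ?_ (convexHull_min Set.inter_subset_right hconv)
  have hc : IsCompact F := hF.isCompact (Set.Finite.isCompact_convexHull ℝ s.finite_toSet)
  have hext : F.extremePoints ℝ ⊆ (s : Set (Fin n → ℝ)) ∩ F := fun x hx =>
    ⟨extremePoints_convexHull_subset
      (hF.isExtreme.extremePoints_subset_extremePoints hx), hx.1⟩
  have hcl : IsClosed (convexHull ℝ ((s : Set (Fin n → ℝ)) ∩ F)) :=
    Set.Finite.isClosed_convexHull ℝ (s.finite_toSet.inter_of_left F)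
  calc F = closure (convexHull ℝ (F.extremePoints ℝ)) :=
        (closure_convexHull_extremePoints hc hconv).symm
    _ ⊆ closure (convexHull ℝ ((s : Set (Fin n → ℝ)) ∩ F)) :=
        closure_mono (convexHull_mono hext)
    _ = _ := hcl.closure_eq

lemma finite_facets (P : Polytope) : P.facets.Finite := by
  obtain ⟨s, -, hs⟩ := P.exists_hull
  refine Set.Finite.subset ((s.finite_toSet.finite_subsets).image (convexHull ℝ)) ?_
  rintro F ⟨hF, -⟩
  rw [← hs] at hF
  exact ⟨_, Set.inter_subset_left, (isExposed_eq_convexHull hF).symm⟩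

/-- A nonempty exposed face is the zero set of a linear form that is nonnegative on the
homogenized set. -/
lemma exists_form_of_isExposed {n : ℕ} {C F : Set (Fin n → ℝ)} (hF : IsExposed ℝ C F)
    (hne : F.Nonempty) : ∃ φ : (Fin n → ℝ) × ℝ →ₗ[ℝ] ℝ,
      (∀ x ∈ C, 0 ≤ φ (x, 1)) ∧ F = {x ∈ C | φ (x, 1) = 0} := by
  obtain ⟨l, hl⟩ := hF hne
  obtain ⟨p, hp⟩ := hne
  have hp' := hl ▸ hp
  refine ⟨(l p) • LinearMap.snd ℝ _ ℝ - l.toLinearMap ∘ₗ LinearMap.fst ℝ _ ℝ, ?_, ?_⟩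
  · intro x hx
    simpa using hp'.2 x hx
  · ext x
    rw [hl]
    simp only [Set.mem_ofPred_eq, LinearMap.sub_apply, LinearMap.smul_apply, LinearMap.snd_apply,
      LinearMap.comp_apply, LinearMap.fst_apply, smul_eq_mul, mul_one]
    refine and_congr_right fun hx => ⟨fun h => ?_, fun h y hy => ?_⟩
    · have := h p hp'.1
      have := hp'.2 x hx
      simp only [ContinuousLinearMap.coe_coe]
      linarith
    · have := hp'.2 y hy
      simp only [ContinuousLinearMap.coe_coe] at h
      linarith

lemma isExposed_of_form {n : ℕ} {C : Set (Fin n → ℝ)} (φ : (Fin n → ℝ) × ℝ →ₗ[ℝ] ℝ)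
    (hφ : ∀ x ∈ C, 0 ≤ φ (x, 1)) : IsExposed ℝ C {x ∈ C | φ (x, 1) = 0} := by
  rintro ⟨p, hpC, hp⟩
  have key : ∀ x : Fin n → ℝ, φ (x, 1) = φ (x, 0) + φ (0, 1) := by
    intro x
    rw [← map_add]
    simp
  refine ⟨LinearMap.toContinuousLinearMap (-(φ ∘ₗ LinearMap.inl ℝ (Fin n → ℝ) ℝ)), ?_⟩
  ext x
  simp only [Set.mem_ofPred_eq, LinearMap.coe_toContinuousLinearMap', LinearMap.neg_apply,
    LinearMap.comp_apply, LinearMap.inl_apply]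
  refine and_congr_right fun hx => ⟨fun h y hy => ?_, fun h => ?_⟩
  · have h1 := hφ y hy
    rw [key] at h h1
    linarith
  · have h1 := hφ x hx
    have h2 := h p hpC
    rw [key] at h1 hp ⊢
    linarith

/-- Among the forms that are nonnegative on a finite set `G` and negative at `x`, one with the most
zeros on `G` vanishes on a hyperplane of the span of `G`. -/
lemma exists_form_codim_one {E : Type*} [AddCommGroup E] [Module ℝ E] [FiniteDimensional ℝ E]
    (G : Finset E) (x : E) (hx : x ∈ Submodule.span ℝ (G : Set E)) (φ₀ : E →ₗ[ℝ] ℝ)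
    (h0 : ∀ g ∈ G, 0 ≤ φ₀ g) (hx0 : φ₀ x < 0) :
    ∃ φ : E →ₗ[ℝ] ℝ, (∀ g ∈ G, 0 ≤ φ g) ∧ φ x < 0 ∧
      Module.finrank ℝ (Submodule.span ℝ {g : E | g ∈ G ∧ φ g = 0}) + 1 =
        Module.finrank ℝ (Submodule.span ℝ (G : Set E)) := by
  classical
  have hex : ∃ k, ∃ φ : E →ₗ[ℝ] ℝ, (∀ g ∈ G, 0 ≤ φ g) ∧ φ x < 0 ∧
      (G.filter fun g => φ g ≠ 0).card = k := ⟨_, φ₀, h0, hx0, rfl⟩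
  obtain ⟨φ, hφ, hφx, hk⟩ := Nat.find_spec hex
  have hmin : ∀ ψ : E →ₗ[ℝ] ℝ, (∀ g ∈ G, 0 ≤ ψ g) → ψ x < 0 →
      (G.filter fun g => φ g ≠ 0).card ≤ (G.filter fun g => ψ g ≠ 0).card := fun ψ h1 h2 => by
    rw [hk]
    exact Nat.find_min' hex ⟨ψ, h1, h2, rfl⟩
  refine ⟨φ, hφ, hφx, ?_⟩
  set Z := Submodule.span ℝ {g : E | g ∈ G ∧ φ g = 0} with hZ
  set V := Submodule.span ℝ (G : Set E) with hV
  have hZφ : ∀ z ∈ Z, φ z = 0 := fun z hz => by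
    have : Z ≤ LinearMap.ker φ := Submodule.span_le.2 fun g hg => hg.2
    exact this hz
  have hxZ : x ∉ Z := fun h => hφx.ne (hZφ x h)
  have hZV : Z ≤ V := Submodule.span_mono fun g hg => hg.1
  have hsup : Z ⊔ Submodule.span ℝ {x} ≤ V :=
    sup_le hZV ((Submodule.span_singleton_le_iff_mem _ _).2 hx)
  have hrank : Module.finrank ℝ (Z ⊔ Submodule.span ℝ {x} : Submodule ℝ E) =
      Module.finrank ℝ Z + 1 := by
    have h1 := Submodule.finrank_sup_add_finrank_inf_eq Z (Submodule.span ℝ {x})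
    have hx' : x ≠ 0 := fun h => hxZ (h ▸ Z.zero_mem)
    have h2 : Z ⊓ Submodule.span ℝ {x} = ⊥ :=
      disjoint_iff.1 ((Submodule.disjoint_span_singleton' hx').2 hxZ)
    rw [h2, finrank_bot, finrank_span_singleton hx'] at h1
    omega
  rw [← hrank]
  suffices h : Z ⊔ Submodule.span ℝ {x} = V by rw [h]
  by_contra hne
  have hlt : ∃ g ∈ G, g ∉ Z ⊔ Submodule.span ℝ {x} := by
    by_contra! hcon
    exact hne (le_antisymm hsup (Submodule.span_le.2 fun g hg => hcon g hg))
  obtain ⟨g, hg, hgn⟩ := hlt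
  obtain ⟨ψ₀, hψg, hψ⟩ := Submodule.exists_le_ker_of_notMem hgn
  -- up to sign, a form vanishing at `x` and on the zeros of `φ`, negative somewhere on `G`
  obtain ⟨ψ, hψg, hψZ, hψx⟩ : ∃ ψ : E →ₗ[ℝ] ℝ, ψ g < 0 ∧ (∀ z ∈ Z, ψ z = 0) ∧ ψ x = 0 := by
    have hz : ∀ z ∈ Z, ψ₀ z = 0 := fun z hz => hψ (Submodule.mem_sup_left hz)
    have hx2 : ψ₀ x = 0 := hψ (Submodule.mem_sup_right (Submodule.mem_span_singleton_self x))
    rcases lt_or_gt_of_ne hψg with h | h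
    · exact ⟨ψ₀, h, hz, hx2⟩
    · exact ⟨-ψ₀, by simpa using h, fun z h => by simp [hz z h], by simp [hx2]⟩
  obtain ⟨g₁, hg₁, hgmin⟩ := (G.filter fun g => ψ g < 0).exists_min_image
    (fun g => φ g / -ψ g) ⟨g, Finset.mem_filter.2 ⟨hg, hψg⟩⟩
  rw [Finset.mem_filter] at hg₁
  set t := φ g₁ / -ψ g₁ with ht
  have ht0 : 0 ≤ t := div_nonneg (hφ _ hg₁.1) (by linarith [hg₁.2])
  have hnn : ∀ g ∈ G, 0 ≤ (φ + t • ψ) g := by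
    intro g hg
    simp only [LinearMap.add_apply, LinearMap.smul_apply, smul_eq_mul]
    rcases lt_or_ge (ψ g) 0 with h | h
    · have := hgmin g (Finset.mem_filter.2 ⟨hg, h⟩)
      rw [le_div_iff₀ (by linarith)] at this
      linarith
    · have := hφ g hg
      positivity
  have hcard := hmin (φ + t • ψ) hnn (by simpa [hψx] using hφx)
  refine absurd hcard (not_le.2 (Finset.card_lt_card ?_))
  rw [Finset.ssubset_iff_of_subset]
  · refine ⟨g₁, Finset.mem_filter.2 ⟨hg₁.1, fun h => ?_⟩, fun h => (Finset.mem_filter.1 h).2 ?_⟩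
    · have := hψZ g₁ (Submodule.subset_span ⟨hg₁.1, h⟩)
      linarith [hg₁.2]
    · simp only [LinearMap.add_apply, LinearMap.smul_apply, smul_eq_mul, ht]
      field_simp [hg₁.2.ne]
      ring
  · intro g hg
    rw [Finset.mem_filter] at hg ⊢
    refine ⟨hg.1, fun h => hg.2 ?_⟩
    simp [h, hψZ g (Submodule.subset_span ⟨hg.1, h⟩)]

end Polytope

/-! ### Facet inequalities and lifts to sections of the orthant -/

namespace Polytope

lemma one_le_dim {P : Polytope} (hP : P.carrier.Nontrivial) : 1 ≤ P.dim := by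
  obtain ⟨x, hx, y, hy, hxy⟩ := hP
  have hne : P.carrier.Nonempty := ⟨x, hx⟩
  rw [dim, affDim, if_pos hne]
  have : 0 < Module.finrank ℝ (vectorSpan ℝ P.carrier) := by
    have h1 : x - y ∈ vectorSpan ℝ P.carrier := vsub_mem_vectorSpan ℝ hx hy
    have : Nontrivial (vectorSpan ℝ P.carrier) :=
      ⟨⟨x - y, h1⟩, 0, fun h => hxy (sub_eq_zero.1 (congrArg Subtype.val h))⟩
    exact Module.finrank_pos
  omega

lemma nonempty_of_mem_facets {P : Polytope} (hP : P.carrier.Nontrivial)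
    {F : Set (Fin P.n → ℝ)} (hF : F ∈ P.facets) : F.Nonempty := by
  by_contra hne
  have h1 := hF.2
  have h2 := one_le_dim hP
  rw [affDim, if_neg hne] at h1
  omega

lemma finrank_homSpan_facet {P : Polytope} {F : Set (Fin P.n → ℝ)} (hF : F ∈ P.facets) :
    Module.finrank ℝ (homSpan F) + 1 = Module.finrank ℝ (homSpan P.carrier) := by
  have h1 := finrank_homSpan F
  have h2 := finrank_homSpan P.carrier
  have h3 := hF.2
  rw [dim] at h3
  omega

/-- A point of the affine hull that satisfies all facet inequalities lies in the polytope: any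
point outside violates a facet inequality strictly. -/
lemma exists_violated_facet {P : Polytope} {x : Fin P.n → ℝ}
    (hxV : (x, (1 : ℝ)) ∈ homSpan P.carrier) (hx : x ∉ P.carrier) :
    ∃ F ∈ P.facets, ∀ ψ : (Fin P.n → ℝ) × ℝ →ₗ[ℝ] ℝ, (∀ y ∈ P.carrier, 0 ≤ ψ (y, 1)) →
      F = {y ∈ P.carrier | ψ (y, 1) = 0} → ψ (x, 1) < 0 := by
  classical
  obtain ⟨s, hsne, hs⟩ := P.exists_hull
  obtain ⟨f, u, hfx, hfu⟩ := geometric_hahn_banach_point_closed P.convex_carrier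
    P.isCompact_carrier.isClosed hx
  set G : Finset ((Fin P.n → ℝ) × ℝ) := s.image fun y => (y, (1 : ℝ)) with hG
  have hspan : Submodule.span ℝ (G : Set ((Fin P.n → ℝ) × ℝ)) = homSpan P.carrier := by
    rw [← hs, homSpan_convexHull, homSpan, hG, Finset.coe_image]
  have hsub : ∀ y ∈ s, y ∈ P.carrier := fun y hy => hs ▸ subset_convexHull ℝ _ hy
  obtain ⟨φ, hφ, hφx, hrank⟩ := exists_form_codim_one G (x, 1) (hspan ▸ hxV)
    (f.toLinearMap ∘ₗ LinearMap.fst ℝ _ ℝ - u • LinearMap.snd ℝ _ ℝ)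
    (by
      intro g hg
      obtain ⟨y, hy, rfl⟩ := Finset.mem_image.1 hg
      have := hfu y (hsub y hy)
      simp only [LinearMap.sub_apply, LinearMap.comp_apply, LinearMap.fst_apply,
        LinearMap.smul_apply, LinearMap.snd_apply, smul_eq_mul, mul_one,
        ContinuousLinearMap.coe_coe]
      linarith)
    (by
      simp only [LinearMap.sub_apply, LinearMap.comp_apply, LinearMap.fst_apply,
        LinearMap.smul_apply, LinearMap.snd_apply, smul_eq_mul, mul_one,
        ContinuousLinearMap.coe_coe]
      linarith)
  have hφP : ∀ y ∈ P.carrier, 0 ≤ φ (y, 1) := by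
    intro y hy
    rw [← hs] at hy
    have hc : Convex ℝ {y : Fin P.n → ℝ | 0 ≤ φ (y, 1)} := by
      intro y hy z hz a b ha hb hab
      have h1 : ((a • y + b • z, (1 : ℝ)) : (Fin P.n → ℝ) × ℝ) = a • (y, 1) + b • (z, 1) := by
        ext <;> simp [hab]
      have hy' : 0 ≤ φ (y, 1) := hy
      have hz' : 0 ≤ φ (z, 1) := hz
      change 0 ≤ φ _
      rw [h1, map_add, map_smul, map_smul, smul_eq_mul, smul_eq_mul]
      positivity
    exact convexHull_min (fun y hy => hφ _ (Finset.mem_image_of_mem _ hy)) hc hy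
  set F := {y ∈ P.carrier | φ (y, 1) = 0} with hFdef
  have hFexp : IsExposed ℝ P.carrier F := isExposed_of_form φ hφP
  have hFspan : homSpan F = Submodule.span ℝ {g | g ∈ G ∧ φ g = 0} := by
    have h1 : F = convexHull ℝ ((s : Set (Fin P.n → ℝ)) ∩ F) :=
      isExposed_eq_convexHull (by rw [hs]; exact hFexp)
    rw [h1, homSpan_convexHull, homSpan]
    congr 1
    ext g
    constructor
    · rintro ⟨y, hy, rfl⟩
      exact ⟨Finset.mem_image_of_mem _ hy.1, hy.2.2⟩
    · rintro ⟨hg, h0⟩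
      obtain ⟨y, hy, rfl⟩ := Finset.mem_image.1 hg
      exact ⟨y, ⟨hy, hsub y hy, h0⟩, rfl⟩
  rw [hspan, ← hFspan] at hrank
  have hFfacet : F ∈ P.facets := by
    refine ⟨hFexp, ?_⟩
    have h1 := finrank_homSpan F
    have h2 := finrank_homSpan P.carrier
    rw [dim]
    omega
  refine ⟨F, hFfacet, fun ψ hψ hFψ => ?_⟩
  have hker : ∀ z ∈ homSpan F, φ z = 0 ∧ ψ z = 0 := by
    have : homSpan F ≤ LinearMap.ker φ ⊓ LinearMap.ker ψ := by
      refine Submodule.span_le.2 ?_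
      rintro _ ⟨y, hy, rfl⟩
      exact ⟨hy.2, (hFψ ▸ hy : y ∈ {y ∈ P.carrier | ψ (y, 1) = 0}).2⟩
    exact fun z hz => this hz
  have hxF : (x, (1 : ℝ)) ∉ homSpan F := fun h => hφx.ne (hker _ h).1
  have hFV : homSpan F ≤ homSpan P.carrier := homSpan_mono fun y hy => hy.1
  have hsup : homSpan F ⊔ Submodule.span ℝ {(x, (1 : ℝ))} = homSpan P.carrier := by
    refine Submodule.eq_of_le_of_finrank_le
      (sup_le hFV ((Submodule.span_singleton_le_iff_mem _ _).2 hxV)) ?_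
    have h1 : Module.finrank ℝ (homSpan F) <
        Module.finrank ℝ (homSpan F ⊔ Submodule.span ℝ {(x, (1 : ℝ))} : Submodule ℝ _) := by
      apply Submodule.finrank_lt_finrank_of_lt
      exact lt_of_le_of_ne le_sup_left fun h => hxF
        (h ▸ Submodule.mem_sup_right (Submodule.mem_span_singleton_self _))
    omega
  have hdec : ∀ y ∈ P.carrier, ∃ a : ℝ,
      φ (y, 1) = a * φ (x, 1) ∧ ψ (y, 1) = a * ψ (x, 1) := by
    intro y hy
    have h1 : (y, (1 : ℝ)) ∈ homSpan P.carrier := mem_homSpan hy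
    rw [← hsup, Submodule.mem_sup] at h1
    obtain ⟨z, hz, w, hw, hzw⟩ := h1
    obtain ⟨a, rfl⟩ := Submodule.mem_span_singleton.1 hw
    refine ⟨a, ?_, ?_⟩ <;> rw [← hzw, map_add, map_smul, smul_eq_mul]
    · rw [(hker z hz).1, zero_add]
    · rw [(hker z hz).2, zero_add]
  obtain ⟨g, hg, hgφ⟩ : ∃ g ∈ P.carrier, 0 < φ (g, 1) := by
    by_contra! hcon
    have : homSpan P.carrier ≤ LinearMap.ker φ := by
      refine Submodule.span_le.2 ?_
      rintro _ ⟨y, hy, rfl⟩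
      exact le_antisymm (hcon y hy) (hφP y hy)
    exact hφx.ne (this hxV)
  obtain ⟨a, ha1, ha2⟩ := hdec g hg
  have ha : a < 0 := by
    by_contra! h
    nlinarith
  have h1 := hψ g hg
  have h2 : ψ (g, 1) ≠ 0 := fun h => by
    have : g ∈ F := by rw [hFψ]; exact ⟨hg, h⟩
    exact hgφ.ne' this.2
  by_contra! h3
  have : ψ (g, 1) ≤ 0 := by rw [ha2]; nlinarith
  exact h2 (le_antisymm this h1)

end Polytope

/-- A presentation of `C` as a linear image of a section of the nonnegative orthant: the cone of
nonnegative vectors of the subspace `W` is pointed by the form `h`, and `T` maps its section at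
height one onto `C`. -/
structure IsOrthantLift {ι : Type*} {m : ℕ} (C : Set (Fin m → ℝ))
    (W : Submodule ℝ (ι → ℝ)) (h : (ι → ℝ) →ₗ[ℝ] ℝ) (T : (ι → ℝ) →ₗ[ℝ] (Fin m → ℝ)) : Prop where
  pos : ∀ y ∈ W, 0 ≤ y → y ≠ 0 → 0 < h y
  image_eq : T '' {y | y ∈ W ∧ 0 ≤ y ∧ h y = 1} = C

/-- None of the coordinate inequalities is redundant on the nonnegative part of `W`: each
coordinate alone can vanish. -/
def Irredundant {ι : Type*} (W : Submodule ℝ (ι → ℝ)) : Prop :=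
  ∀ i, ∃ y ∈ W, 0 ≤ y ∧ ∀ j, y j = 0 ↔ j = i

namespace Polytope

/-- Every lift `Q` of `P` yields an orthant lift, with one coordinate for the slack of each facet
of `Q`. -/
theorem exists_isOrthantLift {P Q : Polytope} (hP : P.carrier.Nontrivial)
    (L : (Fin Q.n → ℝ) →ₗ[ℝ] (Fin P.n → ℝ)) (hL : L '' Q.carrier = P.carrier) :
    ∃ (W : Submodule ℝ (Fin Q.facets.ncard → ℝ)) (h : (Fin Q.facets.ncard → ℝ) →ₗ[ℝ] ℝ)
      (T : (Fin Q.facets.ncard → ℝ) →ₗ[ℝ] (Fin P.n → ℝ)),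
      IsOrthantLift P.carrier W h T ∧ Irredundant W := by
  classical
  have hQ : Q.carrier.Nontrivial := by
    rw [← hL] at hP
    obtain ⟨_, ⟨x, hx, rfl⟩, _, ⟨y, hy, rfl⟩, hxy⟩ := hP
    exact ⟨x, hx, y, hy, fun h => hxy (by rw [h])⟩
  set N := Q.facets.ncard with hN
  have hfin : Finite Q.facets := Q.finite_facets
  let e : Q.facets ≃ Fin N := Finite.equivFinOfCardEq rfl
  have hform : ∀ i : Fin N, ∃ φ : (Fin Q.n → ℝ) × ℝ →ₗ[ℝ] ℝ,
      (∀ x ∈ Q.carrier, 0 ≤ φ (x, 1)) ∧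
        ((e.symm i : Set (Fin Q.n → ℝ)) = {x ∈ Q.carrier | φ (x, 1) = 0}) := fun i =>
    exists_form_of_isExposed (e.symm i).2.1 (nonempty_of_mem_facets hQ (e.symm i).2)
  choose φ hφ hφF using hform
  let S : (Fin Q.n → ℝ) × ℝ →ₗ[ℝ] (Fin N → ℝ) := LinearMap.pi φ
  set V := homSpan Q.carrier with hV
  have hmem : ∀ x, (x, (1 : ℝ)) ∈ V → 0 ≤ S (x, 1) → x ∈ Q.carrier := by
    intro x hx h0
    by_contra hxQ
    obtain ⟨F, hF, hFx⟩ := exists_violated_facet hx hxQ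
    have h1 := hφF (e ⟨F, hF⟩)
    rw [Equiv.symm_apply_apply] at h1
    exact absurd (h0 (e ⟨F, hF⟩)) (not_le.2 (hFx _ (hφ _) h1))
  have hSQ : ∀ x ∈ Q.carrier, 0 ≤ S (x, 1) := fun x hx i => hφ i x hx
  -- recession directions vanish because `Q` is bounded
  have hrec : ∀ x, (x, (0 : ℝ)) ∈ V → 0 ≤ S (x, 0) → x = 0 := by
    intro x hx h0
    obtain ⟨q, hq⟩ := Q.nonempty_carrier
    obtain ⟨R, hR⟩ := Q.isCompact_carrier.isBounded.exists_norm_le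
    by_contra hx0
    have hxn : 0 < ‖x‖ := norm_pos_iff.2 hx0
    have hray : ∀ t : ℝ, 0 ≤ t → q + t • x ∈ Q.carrier := by
      intro t ht
      have h1 : ((q + t • x, (1 : ℝ)) : (Fin Q.n → ℝ) × ℝ) = (q, 1) + t • (x, 0) := by
        ext <;> simp
      apply hmem
      · rw [h1]; exact V.add_mem (mem_homSpan hq) (V.smul_mem _ hx)
      · rw [h1, map_add, map_smul]
        exact add_nonneg (hSQ q hq) (smul_nonneg ht h0)
    have hR0 : 0 ≤ R := (norm_nonneg q).trans (hR q hq)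
    have h2 := hR _ (hray ((2 * R + 1) / ‖x‖) (by positivity))
    have h3 : ‖((2 * R + 1) / ‖x‖) • x‖ = 2 * R + 1 := by
      rw [norm_smul, Real.norm_of_nonneg (by positivity)]
      field_simp
    have h4 : ‖((2 * R + 1) / ‖x‖) • x‖ ≤ ‖q + ((2 * R + 1) / ‖x‖) • x‖ + ‖q‖ := by
      have := norm_sub_le (q + ((2 * R + 1) / ‖x‖) • x) q
      rwa [add_sub_cancel_left] at this
    have := hR q hq
    linarith
  have hpos : ∀ z ∈ V, 0 ≤ S z → z ≠ 0 → 0 < z.2 := by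
    rintro ⟨x, t⟩ hz h0 hne
    rcases lt_trichotomy t 0 with ht | rfl | ht
    · exfalso
      obtain ⟨q, hq, q', hq', hqq⟩ := hQ
      have key : ∀ q ∈ Q.carrier, q = t⁻¹ • x := by
        intro q hq
        have h1 : ((q - t⁻¹ • x, (0 : ℝ)) : (Fin Q.n → ℝ) × ℝ) = (q, 1) + (-t⁻¹) • (x, t) := by
          ext
          · simp [sub_eq_add_neg]
          · simp [ht.ne]
        have h2 := hrec (q - t⁻¹ • x)
          (by rw [h1]; exact V.add_mem (mem_homSpan hq) (V.smul_mem _ hz))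
          (by
            rw [h1, map_add, map_smul]
            exact add_nonneg (hSQ q hq)
              (smul_nonneg (neg_nonneg.2 (inv_nonpos.2 ht.le)) h0))
        exact sub_eq_zero.1 h2
      exact hqq ((key q hq).trans (key q' hq').symm)
    · exact absurd (by rw [hrec x hz h0]; rfl) hne
    · exact ht
  have hinj : ∀ z ∈ V, S z = 0 → z = 0 := by
    intro z hz h0
    by_contra hne
    have h1 := hpos z hz h0.ge hne
    have h2 := hpos (-z) (V.neg_mem hz) (by rw [map_neg, h0, neg_zero]) (neg_ne_zero.2 hne)
    simp only [Prod.snd_neg] at h2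
    linarith
  obtain ⟨g₀, hg₀⟩ := LinearMap.exists_leftInverse_of_injective (S.domRestrict V) (by
    rw [LinearMap.ker_eq_bot']
    rintro ⟨z, hz⟩ h
    exact Subtype.ext (hinj z hz h))
  let g : (Fin N → ℝ) →ₗ[ℝ] (Fin Q.n → ℝ) × ℝ := V.subtype ∘ₗ g₀
  have hg : ∀ z ∈ V, g (S z) = z := fun z hz =>
    congrArg Subtype.val (LinearMap.congr_fun hg₀ ⟨z, hz⟩)
  refine ⟨V.map S, LinearMap.snd ℝ _ ℝ ∘ₗ g, L ∘ₗ LinearMap.fst ℝ _ ℝ ∘ₗ g, ⟨?_, ?_⟩, ?_⟩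
  · rintro _ ⟨z, hz, rfl⟩ h0 hne
    simp only [LinearMap.comp_apply, hg z hz]
    exact hpos z hz h0 fun h => hne (by rw [h, map_zero])
  · rw [← hL]
    apply Set.Subset.antisymm
    · rintro _ ⟨_, ⟨⟨⟨x, t⟩, hz, rfl⟩, h0, h1⟩, rfl⟩
      simp only [LinearMap.comp_apply, hg _ hz, LinearMap.snd_apply] at h1
      subst h1
      refine ⟨x, hmem x hz h0, ?_⟩
      simp [LinearMap.comp_apply, hg _ hz]
    · rintro _ ⟨x, hx, rfl⟩
      have hz : (x, (1 : ℝ)) ∈ V := mem_homSpan hx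
      refine ⟨S (x, 1), ⟨⟨_, hz, rfl⟩, hSQ x hx, ?_⟩, ?_⟩ <;>
        simp [LinearMap.comp_apply, hg _ hz]
  · intro i
    -- distinct facets are not nested
    have hex : ∀ j : Fin N, j ≠ i → ∃ x ∈ Q.carrier, φ i (x, 1) = 0 ∧ 0 < φ j (x, 1) := by
      intro j hj
      by_contra! hcon
      have hsub : (e.symm i : Set (Fin Q.n → ℝ)) ⊆ e.symm j := by
        intro x hx
        rw [hφF] at hx ⊢
        exact ⟨hx.1, le_antisymm (hcon x hx.1 hx.2) (hφ j x hx.1)⟩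
      have hspan : homSpan (e.symm i : Set (Fin Q.n → ℝ)) = homSpan (e.symm j).1 := by
        apply Submodule.eq_of_le_of_finrank_eq (homSpan_mono hsub)
        have h1 := finrank_homSpan_facet (e.symm i).2
        have h2 := finrank_homSpan_facet (e.symm j).2
        omega
      have hsub' : (e.symm j : Set (Fin Q.n → ℝ)) ⊆ e.symm i := by
        intro x hx
        have h1 : (x, (1 : ℝ)) ∈ homSpan (e.symm i : Set (Fin Q.n → ℝ)) :=
          hspan ▸ mem_homSpan hx
        have h2 : homSpan (e.symm i : Set (Fin Q.n → ℝ)) ≤ LinearMap.ker (φ i) := by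
          refine Submodule.span_le.2 ?_
          rintro _ ⟨y, hy, rfl⟩
          rw [hφF] at hy
          exact hy.2
        rw [hφF] at hx ⊢
        exact ⟨hx.1, h2 h1⟩
      exact hj (e.symm.injective (Subtype.ext (hsub'.antisymm hsub)))
    choose! x hxQ hxi hxj using hex
    refine ⟨S (∑ j ∈ Finset.univ.erase i, (x j, 1)), ⟨_, V.sum_mem fun j hj =>
      mem_homSpan (hxQ j (Finset.ne_of_mem_erase hj)), rfl⟩, ?_, fun k => ?_⟩
    · rw [map_sum]
      exact Finset.sum_nonneg fun j hj => hSQ _ (hxQ j (Finset.ne_of_mem_erase hj))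
    · have hk : S (∑ j ∈ Finset.univ.erase i, (x j, 1)) k =
          ∑ j ∈ Finset.univ.erase i, φ k (x j, 1) := by
        simp [S, LinearMap.pi_apply]
      rw [hk]
      constructor
      · intro h0
        by_contra hne
        have h1 := (Finset.sum_eq_zero_iff_of_nonneg fun j hj =>
          hφ k _ (hxQ j (Finset.ne_of_mem_erase hj))).1 h0 k (Finset.mem_erase.2 ⟨hne, by simp⟩)
        exact (hxj k hne).ne' h1
      · rintro rfl
        exact Finset.sum_eq_zero fun j hj => hxi j (Finset.ne_of_mem_erase hj)

end Polytope

/-! ### Vertices as atoms, and supports of nonnegative vectors -/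

/-- The elements covering the least element. -/
def atomSet (X : Type*) [PartialOrder X] : Set X := {x | ∃ b, IsBot b ∧ b ⋖ x}

/-- The elements covered by the greatest element. -/
def coatomSet (X : Type*) [PartialOrder X] : Set X := {x | ∃ t, IsTop t ∧ x ⋖ t}

lemma OrderIso.apply_mem_atomSet {X Y : Type*} [PartialOrder X] [PartialOrder Y] (e : X ≃o Y)
    {x : X} (hx : x ∈ atomSet X) : e x ∈ atomSet Y := by
  obtain ⟨b, hb, hbx⟩ := hx
  exact ⟨e b, fun y => by simpa using e.monotone (hb (e.symm y)),
    (apply_covBy_apply_iff e).2 hbx⟩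

lemma OrderIso.apply_mem_coatomSet {X Y : Type*} [PartialOrder X] [PartialOrder Y] (e : X ≃o Y)
    {x : X} (hx : x ∈ coatomSet X) : e x ∈ coatomSet Y := by
  obtain ⟨t, ht, htx⟩ := hx
  exact ⟨e t, fun y => by simpa using e.monotone (ht (e.symm y)),
    (apply_covBy_apply_iff e).2 htx⟩

lemma OrderIso.image_atomSet {X Y : Type*} [PartialOrder X] [PartialOrder Y] (e : X ≃o Y) :
    e '' atomSet X = atomSet Y := by
  refine Set.Subset.antisymm (Set.image_subset_iff.2 fun x hx => e.apply_mem_atomSet hx) ?_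
  exact fun y hy => ⟨e.symm y, e.symm.apply_mem_atomSet hy, e.apply_symm_apply y⟩

lemma OrderIso.image_coatomSet {X Y : Type*} [PartialOrder X] [PartialOrder Y] (e : X ≃o Y) :
    e '' coatomSet X = coatomSet Y := by
  refine Set.Subset.antisymm (Set.image_subset_iff.2 fun x hx => e.apply_mem_coatomSet hx) ?_
  exact fun y hy => ⟨e.symm y, e.symm.apply_mem_coatomSet hy, e.apply_symm_apply y⟩

namespace Polytope

lemma isExposed_singleton_of_mem_vertices {P : Polytope} {p : Fin P.n → ℝ}
    (hp : p ∈ P.vertices) : IsExposed ℝ P.carrier {p} := by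
  classical
  obtain ⟨s, hsne, hs⟩ := P.exists_hull
  have hps : p ∈ s := by
    have : p ∈ (convexHull ℝ (s : Set (Fin P.n → ℝ))).extremePoints ℝ := by rw [hs]; exact hp
    exact extremePoints_convexHull_subset this
  have hpn : p ∉ convexHull ℝ ((s.erase p : Finset _) : Set (Fin P.n → ℝ)) := by
    intro h
    have h1 := (P.convex_carrier.mem_extremePoints_iff_mem_sdiff_convexHull_sdiff.1 hp).2
    refine h1 (convexHull_mono ?_ h)
    intro x hx
    rw [Finset.coe_erase] at hx
    exact ⟨hs ▸ subset_convexHull ℝ _ hx.1, hx.2⟩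
  obtain ⟨f, u, hfu, hfp⟩ := geometric_hahn_banach_closed_point (convex_convexHull ℝ _)
    (Set.Finite.isClosed_convexHull ℝ (s.erase p).finite_toSet) hpn
  have hdec : ∀ y ∈ P.carrier, y = p ∨ f y < f p := by
    intro y hy
    rw [← hs, ← Finset.insert_erase hps, Finset.coe_insert] at hy
    rcases (s.erase p).eq_empty_or_nonempty with h0 | hne
    · left
      simpa [h0] using hy
    · rw [convexHull_insert (by exact_mod_cast hne)] at hy
      rw [convexJoin_singleton_left, Set.mem_iUnion₂] at hy
      obtain ⟨z, hz, a, b, ha, hb, hab, rfl⟩ := hy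
      rcases hb.eq_or_lt with rfl | hb
      · left
        have : a = 1 := by linarith
        simp [this]
      · right
        have := hfu z hz
        simp only [map_add, map_smul, smul_eq_mul]
        have h3 : a = 1 - b := by linarith
        rw [h3]
        nlinarith
  rintro -
  refine ⟨f, ?_⟩
  ext x
  simp only [Set.mem_singleton_iff, Set.mem_ofPred_eq]
  constructor
  · rintro rfl
    refine ⟨hp.1, fun y hy => ?_⟩
    rcases hdec y hy with rfl | h
    · exact le_rfl
    · exact h.le
  · rintro ⟨hx, h⟩
    rcases hdec x hx with rfl | h1
    · rfl
    · exact absurd (h p hp.1) (not_le.2 h1)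

lemma isBot_face_iff {P : Polytope} (b : P.Face) : IsBot b ↔ b.1 = ∅ := by
  constructor
  · intro hb
    exact Set.subset_empty_iff.1 (hb ⟨∅, isExposed_empty⟩)
  · intro hb x
    change b.1 ⊆ x.1
    rw [hb]
    exact Set.empty_subset _

/-- The vertices of a polytope are the atoms of its face lattice. -/
lemma ncard_vertices (P : Polytope) : P.vertices.ncard = (atomSet P.Face).ncard := by
  refine Set.ncard_congr (fun p hp => ⟨{p}, isExposed_singleton_of_mem_vertices hp⟩) ?_ ?_ ?_
  · intro p hp
    refine ⟨⟨∅, isExposed_empty⟩, (isBot_face_iff _).2 rfl, ?_, ?_⟩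
    · rw [← Subtype.coe_lt_coe]
      exact (Set.empty_ssubset).2 (Set.singleton_nonempty p)
    · rintro ⟨c, hc⟩ h1 h2
      rw [← Subtype.coe_lt_coe] at h1 h2
      have h3 : c ⊂ {p} := h2
      rw [Set.ssubset_singleton_iff] at h3
      exact (Set.empty_ssubset.1 h1).ne_empty h3
  · intro p q hp hq h
    exact Set.singleton_injective (congrArg Subtype.val h)
  · rintro ⟨F, hF⟩ ⟨b, hb, hlt, hcov⟩
    rw [isBot_face_iff] at hb
    have hne : F.Nonempty := by
      rw [← Subtype.coe_lt_coe, hb] at hlt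
      exact Set.empty_ssubset.1 hlt
    obtain ⟨p, hp⟩ := (hF.isCompact P.isCompact_carrier).extremePoints_nonempty hne
    have hpv : p ∈ P.vertices := hF.isExtreme.extremePoints_subset_extremePoints hp
    refine ⟨p, hpv, ?_⟩
    have hle : (⟨{p}, isExposed_singleton_of_mem_vertices hpv⟩ : P.Face) ≤ ⟨F, hF⟩ :=
      Set.singleton_subset_iff.2 hp.1
    rcases hle.eq_or_lt with h | h
    · exact h
    · refine absurd h (hcov ?_)
      rw [← Subtype.coe_lt_coe, hb]
      exact Set.empty_ssubset.2 (Set.singleton_nonempty p)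

end Polytope

section Supports

variable {ι : Type*}

/-- `v` is balanced on `Z` if it is zero on `Z` or takes both signs there; equivalently, `v` is
orthogonal to a vector that is positive exactly on `Z`. -/
def SignBalanced (v : ι → ℝ) (Z : Finset ι) : Prop :=
  (∀ i ∈ Z, v i = 0) ∨ ((∃ i ∈ Z, 0 < v i) ∧ ∃ i ∈ Z, v i < 0)

lemma signBalanced_of_not {v : ι → ℝ} {Z : Finset ι}
    (h1 : ¬((∀ i ∈ Z, 0 ≤ v i) ∧ ∃ i ∈ Z, v i ≠ 0))
    (h2 : ¬((∀ i ∈ Z, v i ≤ 0) ∧ ∃ i ∈ Z, v i ≠ 0)) : SignBalanced v Z := by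
  by_cases h : ∃ i ∈ Z, v i ≠ 0
  · right
    constructor
    · by_contra! hc
      exact h2 ⟨hc, h⟩
    · by_contra! hc
      exact h1 ⟨hc, h⟩
  · left
    push Not at h
    exact h

variable [Fintype ι]

/-- The support of a vector, as a finite set of coordinates. -/
noncomputable def coordSupport (y : ι → ℝ) : Finset ι := Finset.univ.filter fun i => y i ≠ 0

@[simp] lemma mem_coordSupport {y : ι → ℝ} {i : ι} : i ∈ coordSupport y ↔ y i ≠ 0 := by
  simp [coordSupport]

/-- The supports of the nonnegative vectors of a subspace. -/
def IsSupport (W : Submodule ℝ (ι → ℝ)) (σ : Finset ι) : Prop :=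
  ∃ y ∈ W, 0 ≤ y ∧ coordSupport y = σ

/-- The supports of nonnegative vectors of `W` with `v` balanced on the complement. They encode the
faces of the section of the orthant by `W` that survive the projection along `v`. -/
def faceSupports [DecidableEq ι] (W : Submodule ℝ (ι → ℝ)) (v : ι → ℝ) : Set (Finset ι) :=
  {σ | IsSupport W σ ∧ SignBalanced v σᶜ}

lemma SignBalanced.exists_weights {v : ι → ℝ} {Z : Finset ι} (h : SignBalanced v Z) :
    ∃ c : ι → ℝ, (∀ i ∈ Z, 0 < c i) ∧ (∀ i ∉ Z, c i = 0) ∧ ∑ i, c i * v i = 0 := by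
  classical
  let c₀ : ι → ℝ := fun i => if i ∈ Z then 1 else 0
  have hc₀ : ∀ i ∈ Z, c₀ i = 1 := fun i hi => if_pos hi
  have hc₁ : ∀ i ∉ Z, c₀ i = 0 := fun i hi => if_neg hi
  rcases h with h | ⟨⟨p, hp, hvp⟩, n, hn, hvn⟩
  · refine ⟨c₀, fun i hi => by rw [hc₀ i hi]; exact one_pos, hc₁, ?_⟩
    refine Finset.sum_eq_zero fun i _ => ?_
    by_cases hi : i ∈ Z
    · rw [h i hi, mul_zero]
    · rw [hc₁ i hi, zero_mul]
  · set s := ∑ i, c₀ i * v i with hs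
    -- correct the sum at one coordinate of the sign opposite to it
    have key : ∀ k ∈ Z, v k ≠ 0 → 0 ≤ -s / v k → ∃ c : ι → ℝ,
        (∀ i ∈ Z, 0 < c i) ∧ (∀ i ∉ Z, c i = 0) ∧ ∑ i, c i * v i = 0 := by
      intro k hk hvk h0
      refine ⟨c₀ + Pi.single k (-s / v k), fun i hi => ?_, fun i hi => ?_, ?_⟩
      · have : (0 : ℝ) ≤ (Pi.single k (-s / v k) : ι → ℝ) i :=
          (Pi.single_nonneg.2 h0 : (0 : ι → ℝ) ≤ Pi.single k (-s / v k)) i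
        rw [Pi.add_apply, hc₀ i hi]
        linarith
      · have : i ≠ k := fun h => hi (h ▸ hk)
        rw [Pi.add_apply, hc₁ i hi, Pi.single_eq_of_ne this, add_zero]
      · simp only [Pi.add_apply, add_mul, Finset.sum_add_distrib, ← hs]
        rw [Finset.sum_eq_single k (fun i _ hi => by rw [Pi.single_eq_of_ne hi, zero_mul])
          (fun h => absurd (Finset.mem_univ k) h), Pi.single_eq_same]
        field_simp
        ring
    rcases le_total 0 s with h0 | h0
    · exact key n hn hvn.ne (div_nonneg_of_nonpos (by linarith) hvn.le)
    · exact key p hp hvp.ne' (div_nonneg (by linarith) hvp.le)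

/-- A nonnegative vector can be moved a little in any direction that is nonnegative off its
support. -/
lemma exists_pos_add_smul_nonneg {y z : ι → ℝ} (hy : 0 ≤ y) (hz : ∀ i, y i = 0 → 0 ≤ z i) :
    ∃ t : ℝ, 0 < t ∧ 0 ≤ y + t • z := by
  have h : ∀ᶠ t : ℝ in nhdsWithin 0 (Set.Ioi 0), ∀ i, 0 ≤ y i + t * z i := by
    rw [eventually_all]
    intro i
    rcases (hy i).eq_or_lt with h0 | h0
    · filter_upwards [self_mem_nhdsWithin] with t ht
      have ht : 0 < t := ht
      have h1 : y i = 0 := h0.symm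
      rw [h1, zero_add]
      exact mul_nonneg ht.le (hz i h1)
    · have hcont : Tendsto (fun t : ℝ => y i + t * z i) (nhdsWithin 0 (Set.Ioi 0))
          (nhds (y i + 0 * z i)) := by
        apply Tendsto.mono_left _ nhdsWithin_le_nhds
        exact Continuous.tendsto (by fun_prop) 0
      rw [zero_mul, add_zero] at hcont
      filter_upwards [hcont.eventually (lt_mem_nhds h0)] with t ht
      exact le_of_lt ht
  obtain ⟨t, ht, ht0⟩ := (h.and self_mem_nhdsWithin).exists
  exact ⟨t, ht0, fun i => by simpa using ht i⟩

/-- A nonempty convex set of nonnegative vectors has a member of largest support. -/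
lemma exists_max_support {K : Set (ι → ℝ)} (hK : Convex ℝ K) (h0 : ∀ y ∈ K, 0 ≤ y)
    (hne : K.Nonempty) : ∃ y ∈ K, ∀ z ∈ K, coordSupport z ⊆ coordSupport y := by
  have hbdd : BddAbove ((fun y => (coordSupport y).card) '' K) :=
    ⟨Fintype.card ι, by rintro _ ⟨y, -, rfl⟩; exact Finset.card_le_univ _⟩
  obtain ⟨y, hy, hmax⟩ := Nat.sSup_mem (hne.image fun y => (coordSupport y).card) hbdd
  refine ⟨y, hy, fun z hz => ?_⟩
  have hw : (1 / 2 : ℝ) • y + (1 / 2 : ℝ) • z ∈ K :=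
    hK hy hz (by norm_num) (by norm_num) (by norm_num)
  set w := (1 / 2 : ℝ) • y + (1 / 2 : ℝ) • z with hwdef
  have hwi : ∀ i, w i = 1 / 2 * y i + 1 / 2 * z i := fun i => by simp [hwdef]
  have hyw : coordSupport y ⊆ coordSupport w := by
    intro i hi
    rw [mem_coordSupport] at hi ⊢
    have h1 := h0 y hy i
    have h2 := h0 z hz i
    have h3 : 0 < y i := lt_of_le_of_ne h1 (Ne.symm hi)
    rw [hwi]
    have h2' : 0 ≤ z i := h2
    exact ne_of_gt (by positivity)
  have hzw : coordSupport z ⊆ coordSupport w := by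
    intro i hi
    rw [mem_coordSupport] at hi ⊢
    have h1 : 0 ≤ y i := h0 y hy i
    have h3 : 0 < z i := lt_of_le_of_ne (h0 z hz i) (Ne.symm hi)
    rw [hwi]
    exact ne_of_gt (by positivity)
  have hcard : (coordSupport w).card ≤ (coordSupport y).card := by
    change (fun y => (coordSupport y).card) y = _ at hmax
    simp only at hmax
    rw [hmax]
    exact le_csSup hbdd ⟨w, hw, rfl⟩
  rw [Finset.eq_of_subset_of_card_le hyw hcard]
  exact hzw

end Supports

/-! ### The face lattice of a projected section -/

section FaceLattice

variable {ι : Type*}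

/-- A linear form that vanishes where `T` and `h` both vanish on `W` factors through them. -/
lemma exists_factor {m : ℕ} (W : Submodule ℝ (ι → ℝ)) (h : (ι → ℝ) →ₗ[ℝ] ℝ)
    (T : (ι → ℝ) →ₗ[ℝ] (Fin m → ℝ)) (f : (ι → ℝ) →ₗ[ℝ] ℝ)
    (hf : ∀ y ∈ W, h y = 0 → T y = 0 → f y = 0) :
    ∃ (l : (Fin m → ℝ) →ₗ[ℝ] ℝ) (c : ℝ), ∀ y ∈ W, f y = l (T y) + c * h y := by
  let g : W →ₗ[ℝ] (Fin m → ℝ) × ℝ := (T.prod h).domRestrict W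
  have hmem : f.domRestrict W ∈ (LinearMap.ker g).dualAnnihilator := by
    rw [Submodule.mem_dualAnnihilator]
    rintro ⟨y, hy⟩ hk
    have hk : (T y, h y) = 0 := hk
    exact hf y hy (congrArg Prod.snd hk) (congrArg Prod.fst hk)
  rw [← LinearMap.range_dualMap_eq_dualAnnihilator_ker] at hmem
  obtain ⟨k, hk⟩ := hmem
  refine ⟨k ∘ₗ LinearMap.inl ℝ _ ℝ, k (0, 1), fun y hy => ?_⟩
  have h1 : k (T y, h y) = f y := LinearMap.congr_fun hk ⟨y, hy⟩
  have h2 : ((T y, h y) : (Fin m → ℝ) × ℝ) = (T y, 0) + h y • (0, 1) := by ext <;> simp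
  rw [← h1, h2, map_add, map_smul, smul_eq_mul, mul_comm]
  simp

variable [Fintype ι]

/-- The support of a face: the coordinates that are nonzero somewhere on its preimage. -/
noncomputable def faceSupport {m : ℕ} (W : Submodule ℝ (ι → ℝ)) (h : (ι → ℝ) →ₗ[ℝ] ℝ)
    (T : (ι → ℝ) →ₗ[ℝ] (Fin m → ℝ)) (G : Set (Fin m → ℝ)) : Finset ι := by
  classical
  exact Finset.univ.filter fun i => ∃ y ∈ W, 0 ≤ y ∧ h y = 1 ∧ T y ∈ G ∧ y i ≠ 0

lemma mem_faceSupport {m : ℕ} {W : Submodule ℝ (ι → ℝ)} {h : (ι → ℝ) →ₗ[ℝ] ℝ}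
    {T : (ι → ℝ) →ₗ[ℝ] (Fin m → ℝ)} {G : Set (Fin m → ℝ)} {i : ι} :
    i ∈ faceSupport W h T G ↔ ∃ y ∈ W, 0 ≤ y ∧ h y = 1 ∧ T y ∈ G ∧ y i ≠ 0 := by
  simp [faceSupport]

variable {m : ℕ} {C : Set (Fin m → ℝ)} {W : Submodule ℝ (ι → ℝ)} {h : (ι → ℝ) →ₗ[ℝ] ℝ}
  {T : (ι → ℝ) →ₗ[ℝ] (Fin m → ℝ)}

lemma exists_coordSupport_eq_faceSupport {G : Set (Fin m → ℝ)} (hG : Convex ℝ G)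
    (hne : ∃ y ∈ W, 0 ≤ y ∧ h y = 1 ∧ T y ∈ G) :
    ∃ y ∈ W, 0 ≤ y ∧ h y = 1 ∧ T y ∈ G ∧ coordSupport y = faceSupport W h T G := by
  have hK : Convex ℝ {y | y ∈ W ∧ 0 ≤ y ∧ h y = 1 ∧ T y ∈ G} := by
    rintro y ⟨hy, hy0, hy1, hyG⟩ z ⟨hz, hz0, hz1, hzG⟩ a b ha hb hab
    refine ⟨W.add_mem (W.smul_mem a hy) (W.smul_mem b hz),
      add_nonneg (smul_nonneg ha hy0) (smul_nonneg hb hz0), ?_, ?_⟩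
    · simp [hy1, hz1, hab]
    · rw [map_add, map_smul, map_smul]
      exact hG hyG hzG ha hb hab
  obtain ⟨y, ⟨hy, hy0, hy1, hyG⟩, hmax⟩ := exists_max_support hK (fun y hy => hy.2.1) hne
  refine ⟨y, hy, hy0, hy1, hyG, ?_⟩
  ext i
  rw [mem_faceSupport]
  constructor
  · exact fun hi => ⟨y, hy, hy0, hy1, hyG, mem_coordSupport.1 hi⟩
  · rintro ⟨z, hz, hz0, hz1, hzG, hzi⟩
    exact hmax z ⟨hz, hz0, hz1, hzG⟩ (mem_coordSupport.2 hzi)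

/-- A face consists of the images of the vectors supported in its support. -/
lemma mem_iff_coordSupport_subset (hC : IsOrthantLift C W h T) {G : Set (Fin m → ℝ)}
    (hconv : Convex ℝ C) (hG : IsExposed ℝ C G) (hne : G.Nonempty) {y : ι → ℝ} (hy : y ∈ W)
    (hy0 : 0 ≤ y) (hy1 : h y = 1) : T y ∈ G ↔ coordSupport y ⊆ faceSupport W h T G := by
  have hlift : ∃ y ∈ W, 0 ≤ y ∧ h y = 1 ∧ T y ∈ G := by
    obtain ⟨x, hx⟩ := hne
    have hxC : x ∈ C := hG.subset hx
    rw [← hC.image_eq] at hxC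
    obtain ⟨y, ⟨h1, h2, h3⟩, rfl⟩ := hxC
    exact ⟨y, h1, h2, h3, hx⟩
  constructor
  · exact fun hyG i hi => mem_faceSupport.2 ⟨y, hy, hy0, hy1, hyG, mem_coordSupport.1 hi⟩
  · intro hsub
    obtain ⟨z, hz, hz0, hz1, hzG, hzs⟩ :=
      exists_coordSupport_eq_faceSupport (hG.convex hconv) hlift
    rw [← hzs] at hsub
    -- the segment from `y` through `z` can be prolonged inside the section
    obtain ⟨t, ht, hnn⟩ := exists_pos_add_smul_nonneg (z := z - y) hz0 (by
      intro i hi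
      have : y i = 0 := by
        by_contra hyi
        exact mem_coordSupport.1 (hsub (mem_coordSupport.2 hyi)) hi
      simp [hi, this])
    obtain ⟨l, hl⟩ := hG hne
    have hyC : T y ∈ C := hC.image_eq ▸ ⟨y, ⟨hy, hy0, hy1⟩, rfl⟩
    have hwC : T (z + t • (z - y)) ∈ C := hC.image_eq ▸ ⟨_, ⟨W.add_mem hz
      (W.smul_mem t (W.sub_mem hz hy)), hnn, by simp [hy1, hz1]⟩, rfl⟩
    rw [hl] at hzG ⊢
    have h1 := hzG.2 _ hwC
    simp only [map_add, map_smul, map_sub, smul_eq_mul] at h1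
    refine ⟨hyC, fun x hx => (hzG.2 x hx).trans ?_⟩
    by_contra! hlt
    nlinarith

/-- If `T` collapses exactly the direction `v` of the section, then the face lattice of the image
is the poset of supports with `v` balanced off the support. -/
theorem face_orderIso_faceSupports [DecidableEq ι] {P : Polytope} {W : Submodule ℝ (ι → ℝ)}
    {h : (ι → ℝ) →ₗ[ℝ] ℝ} {T : (ι → ℝ) →ₗ[ℝ] (Fin P.n → ℝ)}
    (hC : IsOrthantLift P.carrier W h T) (v : ι → ℝ)
    (hv : ∀ y, (y ∈ W ∧ h y = 0 ∧ T y = 0) ↔ y ∈ Submodule.span ℝ {v}) :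
    Nonempty (P.Face ≃o faceSupports W v) := by
  have hconv := P.convex_carrier
  obtain ⟨hvW, hvh, hvT⟩ := (hv v).2 (Submodule.mem_span_singleton_self v)
  have hlift : ∀ {G : Set (Fin P.n → ℝ)}, IsExposed ℝ P.carrier G → G.Nonempty →
      ∃ y ∈ W, 0 ≤ y ∧ h y = 1 ∧ T y ∈ G := by
    rintro G hG ⟨x, hx⟩
    have hxC : x ∈ P.carrier := hG.subset hx
    rw [← hC.image_eq] at hxC
    obtain ⟨y, ⟨h1, h2, h3⟩, rfl⟩ := hxC
    exact ⟨y, h1, h2, h3, hx⟩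
  have hempty : faceSupport W h T ∅ = ∅ := by
    ext i
    simp [mem_faceSupport]
  have hmem : ∀ G : P.Face, faceSupport W h T G.1 ∈ faceSupports W v := by
    rintro ⟨G, hG⟩
    rcases G.eq_empty_or_nonempty with rfl | hne
    · simp only [hempty]
      refine ⟨⟨0, W.zero_mem, le_rfl, by ext; simp⟩, ?_⟩
      apply signBalanced_of_not
      · rintro ⟨h1, i, -, hi⟩
        have := hC.pos v hvW (fun i => h1 i (by simp)) fun h0 => hi (by simp [h0])
        exact this.ne' hvh
      · rintro ⟨h1, i, -, hi⟩
        have := hC.pos (-v) (W.neg_mem hvW)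
          (fun i => by simpa using h1 i (by simp)) fun h0 => hi (by simpa using congrFun h0 i)
        rw [map_neg, hvh, neg_zero] at this
        exact this.ne rfl
    · obtain ⟨y, hy, hy0, hy1, hyG, hys⟩ :=
        exists_coordSupport_eq_faceSupport (hG.convex hconv) (hlift hG hne)
      refine ⟨⟨y, hy, hy0, hys⟩, ?_⟩
      have key : ∀ z ∈ W, h z = 0 → T z = 0 →
          ¬((∀ i ∈ (faceSupport W h T G)ᶜ, 0 ≤ z i) ∧
            ∃ i ∈ (faceSupport W h T G)ᶜ, z i ≠ 0) := by
        rintro z hz hz0 hzT ⟨h1, i, hi, hzi⟩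
        rw [← hys] at h1 hi
        obtain ⟨t, ht, hnn⟩ := exists_pos_add_smul_nonneg (z := z) hy0 (by
          intro i hi
          exact h1 i (by simpa using hi))
        have h2 : i ∈ faceSupport W h T G := by
          refine mem_faceSupport.2 ⟨y + t • z, W.add_mem hy (W.smul_mem t hz), hnn,
            by simp [hy1, hz0], by simpa [hzT] using hyG, ?_⟩
          have : y i = 0 := by simpa using hi
          simp [this, ht.ne', hzi]
        rw [hys] at hi
        exact Finset.mem_compl.1 hi h2
      apply signBalanced_of_not
      · exact key v hvW hvh hvT
      · rintro ⟨h1, i, hi, hvi⟩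
        exact key (-v) (W.neg_mem hvW) (by simp [hvh]) (by simp [hvT])
          ⟨fun i hi => by simpa using h1 i hi, i, hi, by simpa using hvi⟩
  have hle : ∀ G G' : P.Face,
      faceSupport W h T G.1 ≤ faceSupport W h T G'.1 ↔ G ≤ G' := by
    rintro ⟨G, hG⟩ ⟨G', hG'⟩
    constructor
    · intro hsub x hx
      have hne : G.Nonempty := ⟨x, hx⟩
      have hxC : x ∈ P.carrier := hG.subset hx
      rw [← hC.image_eq] at hxC
      obtain ⟨y, ⟨hy, hy0, hy1⟩, rfl⟩ := hxC
      have h1 := (mem_iff_coordSupport_subset hC hconv hG hne hy hy0 hy1).1 hx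
      have hne' : G'.Nonempty := by
        by_contra h0
        rw [Set.not_nonempty_iff_eq_empty] at h0
        subst h0
        have h2 : coordSupport y ⊆ ∅ := hempty ▸ h1.trans hsub
        have h3 : y = 0 := by
          ext i
          by_contra hi
          exact absurd (h2 (mem_coordSupport.2 hi)) (Finset.notMem_empty i)
        rw [h3, map_zero] at hy1
        exact zero_ne_one hy1
      exact (mem_iff_coordSupport_subset hC hconv hG' hne' hy hy0 hy1).2 (h1.trans hsub)
    · intro hsub i hi
      obtain ⟨y, hy, hy0, hy1, hyG, hyi⟩ := mem_faceSupport.1 hi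
      exact mem_faceSupport.2 ⟨y, hy, hy0, hy1, hsub hyG, hyi⟩
  have hsurj : ∀ σ ∈ faceSupports W v, ∃ G : P.Face, faceSupport W h T G.1 = σ := by
    rintro σ ⟨⟨y, hy, hy0, hys⟩, hbal⟩
    rcases σ.eq_empty_or_nonempty with rfl | hne
    · exact ⟨⟨∅, isExposed_empty⟩, hempty⟩
    obtain ⟨c, hc, hc0, hcv⟩ := hbal.exists_weights
    let f : (ι → ℝ) →ₗ[ℝ] ℝ := ∑ i, c i • LinearMap.proj i
    have hf : ∀ z, f z = ∑ i, c i * z i := fun z => by simp [f, LinearMap.sum_apply]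
    obtain ⟨l, b, hlb⟩ := exists_factor W h T f (by
      intro z hz hz0 hzT
      obtain ⟨a, rfl⟩ := Submodule.mem_span_singleton.1 ((hv z).1 ⟨hz, hz0, hzT⟩)
      rw [map_smul, hf, hcv, smul_zero])
    have hcnn : ∀ i, 0 ≤ c i := fun i => by
      by_cases hi : i ∈ σᶜ
      · exact (hc i hi).le
      · exact (hc0 i hi).ge
    have hfnn : ∀ z, 0 ≤ z → 0 ≤ f z := fun z hz => by
      rw [hf]
      exact Finset.sum_nonneg fun i _ => mul_nonneg (hcnn i) (hz i)
    have hf0 : ∀ z, 0 ≤ z → (f z = 0 ↔ coordSupport z ⊆ σ) := by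
      intro z hz
      rw [hf, Finset.sum_eq_zero_iff_of_nonneg fun i _ => mul_nonneg (hcnn i) (hz i)]
      constructor
      · intro h0 i hi
        by_contra hiσ
        rcases mul_eq_zero.1 (h0 i (Finset.mem_univ i)) with h1 | h1
        · exact (hc i (Finset.mem_compl.2 hiσ)).ne' h1
        · exact mem_coordSupport.1 hi h1
      · intro hsub i _
        by_cases hi : i ∈ σ
        · rw [hc0 i (by simpa using hi), zero_mul]
        · have : z i = 0 := by
            by_contra h1
            exact hi (hsub (mem_coordSupport.2 h1))
          rw [this, mul_zero]
    -- the section at height one contains a multiple of `y`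
    have hyne : y ≠ 0 := by
      rintro rfl
      obtain ⟨i, hi⟩ := hne
      rw [← hys] at hi
      simp at hi
    have hhy := hC.pos y hy hy0 hyne
    set y₁ := (h y)⁻¹ • y with hy₁
    have hy₁W : y₁ ∈ W := W.smul_mem _ hy
    have hy₁0 : 0 ≤ y₁ := smul_nonneg (inv_nonneg.2 hhy.le) hy0
    have hy₁1 : h y₁ = 1 := by rw [hy₁, map_smul, smul_eq_mul, inv_mul_cancel₀ hhy.ne']
    have hy₁s : coordSupport y₁ = σ := by
      rw [← hys]
      ext i
      simp [hy₁, hhy.ne']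
    let ψ : (Fin P.n → ℝ) × ℝ →ₗ[ℝ] ℝ :=
      l ∘ₗ LinearMap.fst ℝ _ ℝ + b • LinearMap.snd ℝ _ ℝ
    have hψ : ∀ z ∈ W, h z = 1 → ψ (T z, 1) = f z := fun z hz hz1 => by
      rw [hlb z hz, hz1]
      simp [ψ]
    have hψnn : ∀ x ∈ P.carrier, 0 ≤ ψ (x, 1) := by
      intro x hx
      rw [← hC.image_eq] at hx
      obtain ⟨z, ⟨hz, hz0, hz1⟩, rfl⟩ := hx
      rw [hψ z hz hz1]
      exact hfnn z hz0
    refine ⟨⟨_, Polytope.isExposed_of_form ψ hψnn⟩, ?_⟩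
    ext i
    rw [mem_faceSupport]
    constructor
    · rintro ⟨z, hz, hz0, hz1, ⟨-, hz2⟩, hzi⟩
      rw [hψ z hz hz1, hf0 z hz0] at hz2
      exact hz2 (mem_coordSupport.2 hzi)
    · intro hi
      refine ⟨y₁, hy₁W, hy₁0, hy₁1, ⟨?_, ?_⟩, ?_⟩
      · rw [← hC.image_eq]
        exact ⟨y₁, ⟨hy₁W, hy₁0, hy₁1⟩, rfl⟩
      · rw [hψ y₁ hy₁W hy₁1, hf0 y₁ hy₁0, hy₁s]
      · rw [← hy₁s] at hi
        exact mem_coordSupport.1 hi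
  let F : P.Face → faceSupports W v := fun G => ⟨_, hmem G⟩
  have hFle : ∀ {G G'}, F G ≤ F G' ↔ G ≤ G' := fun {G G'} => hle G G'
  exact ⟨RelIso.ofSurjective (OrderEmbedding.ofMapLEIff F fun G G' => hFle)
    fun ⟨σ, hσ⟩ => (hsurj σ hσ).imp fun G hG => Subtype.ext hG⟩

end FaceLattice

/-! ### Circuits and the vertices of a projection -/

lemma val_image_atomSet {ι : Type*} {S : Set (Finset ι)} (h0 : ∅ ∈ S) :
    Subtype.val '' atomSet S = {σ | Minimal (fun σ => σ ∈ S ∧ σ.Nonempty) σ} := by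
  have hbot : ∀ b : S, IsBot b ↔ b.1 = ∅ := by
    intro b
    refine ⟨fun hb => Finset.subset_empty.1 (hb ⟨∅, h0⟩), fun hb x => ?_⟩
    change b.1 ⊆ x.1
    rw [hb]
    exact Finset.empty_subset _
  ext σ
  constructor
  · rintro ⟨⟨σ, hσ⟩, ⟨b, hb, hlt, hcov⟩, rfl⟩
    rw [hbot] at hb
    rw [← Subtype.coe_lt_coe, hb] at hlt
    refine ⟨⟨hσ, Finset.nonempty_iff_ne_empty.2 hlt.ne'⟩, ?_⟩
    rintro τ ⟨hτ, hτne⟩ hle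
    rcases hle.eq_or_lt with h | h
    · exact h.ge
    · refine absurd (show (⟨τ, hτ⟩ : S) < ⟨σ, hσ⟩ from h) (hcov ?_)
      rw [← Subtype.coe_lt_coe, hb]
      exact Finset.empty_ssubset.2 hτne
  · rintro ⟨⟨hσ, hne⟩, hmin⟩
    refine ⟨⟨σ, hσ⟩, ⟨⟨∅, h0⟩, (hbot _).2 rfl, ?_, ?_⟩, rfl⟩
    · exact Finset.empty_ssubset.2 hne
    · rintro ⟨τ, hτ⟩ h1 h2
      have h1 : ∅ ⊂ τ := h1
      have h2 : τ ⊂ σ := h2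
      exact h2.2 (hmin ⟨hτ, Finset.empty_ssubset.1 h1⟩ h2.1)

section Circuits

variable {ι : Type*} [Fintype ι]

/-- The minimal nonempty supports of nonnegative vectors of `W`. -/
def IsCircuit (W : Submodule ℝ (ι → ℝ)) (C : Finset ι) : Prop :=
  Minimal (fun σ => IsSupport W σ ∧ σ.Nonempty) C

lemma exists_isCircuit_subset {W : Submodule ℝ (ι → ℝ)} {σ : Finset ι} (h : IsSupport W σ)
    (hne : σ.Nonempty) : ∃ C ⊆ σ, IsCircuit W C :=
  exists_minimal_le_of_wellFoundedLT (fun σ => IsSupport W σ ∧ σ.Nonempty) σ ⟨h, hne⟩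

lemma coordSupport_nonempty {y : ι → ℝ} (hy : y ≠ 0) : (coordSupport y).Nonempty := by
  obtain ⟨i, hi⟩ := Function.ne_iff.1 hy
  exact ⟨i, mem_coordSupport.2 hi⟩

/-- Subtract the largest possible multiple of `w` from a nonnegative vector. -/
lemma exists_sub_smul_nonneg {y w : ι → ℝ} (hy : 0 ≤ y) (hw : ∀ i, y i = 0 → w i ≤ 0)
    (hpos : ∃ i, 0 < w i) :
    ∃ t : ℝ, 0 < t ∧ 0 ≤ y - t • w ∧ ∃ i, y i ≠ 0 ∧ 0 < w i ∧ (y - t • w) i = 0 := by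
  classical
  obtain ⟨k, hk⟩ := hpos
  obtain ⟨i, hi, hmin⟩ := (Finset.univ.filter fun i => 0 < w i).exists_min_image
    (fun i => y i / w i) ⟨k, by simpa using hk⟩
  have hi : 0 < w i := by simpa using hi
  have hyi : y i ≠ 0 := fun h => absurd hi (not_lt.2 (hw i h))
  have hyi' : 0 < y i := lt_of_le_of_ne (hy i) (Ne.symm hyi)
  refine ⟨y i / w i, by positivity, fun j => ?_, i, hyi, hi, ?_⟩
  · simp only [Pi.zero_apply, Pi.sub_apply, Pi.smul_apply, smul_eq_mul, sub_nonneg]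
    rcases le_or_gt (w j) 0 with h | h
    · exact (mul_nonpos_of_nonneg_of_nonpos (by positivity) h).trans (hy j)
    · rw [← le_div_iff₀ h]
      exact hmin j (by simpa using h)
  · simp [hi.ne']

/-- The vectors of `W` supported in a circuit form a line. -/
lemma IsCircuit.mem_span_singleton {W : Submodule ℝ (ι → ℝ)} {C : Finset ι} (hC : IsCircuit W C)
    {y w : ι → ℝ} (hy : y ∈ W) (hy0 : 0 ≤ y) (hys : coordSupport y = C) (hw : w ∈ W)
    (hws : coordSupport w ⊆ C) : w ∈ Submodule.span ℝ {y} := by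
  have key : ∀ w ∈ W, coordSupport w ⊆ C → (∃ i, 0 < w i) → w ∈ Submodule.span ℝ {y} := by
    intro w hw hws hpos
    have hoff : ∀ i, y i = 0 → w i = 0 := by
      intro i hi
      by_contra h
      have := hws (mem_coordSupport.2 h)
      rw [← hys, mem_coordSupport] at this
      exact this hi
    obtain ⟨t, ht, hnn, i, hyi, hwi, h0⟩ :=
      exists_sub_smul_nonneg hy0 (fun i hi => (hoff i hi).le) hpos
    have hz : y - t • w = 0 := by
      by_contra hne
      have hsub : coordSupport (y - t • w) ⊆ C := by
        intro j hj
        rw [← hys, mem_coordSupport]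
        intro hj0
        rw [mem_coordSupport] at hj
        exact hj (by simp [hj0, hoff j hj0])
      have h1 : C ⊆ coordSupport (y - t • w) := hC.2 ⟨⟨_, W.sub_mem hy (W.smul_mem t hw), hnn, rfl⟩,
        coordSupport_nonempty hne⟩ hsub
      have h2 : i ∈ C := by rw [← hys]; exact mem_coordSupport.2 hyi
      exact mem_coordSupport.1 (h1 h2) h0
    rw [Submodule.mem_span_singleton]
    refine ⟨t⁻¹, ?_⟩
    rw [sub_eq_zero.1 hz, smul_smul, inv_mul_cancel₀ ht.ne', one_smul]
  by_cases hpos : ∃ i, 0 < w i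
  · exact key w hw hws hpos
  · push Not at hpos
    by_cases hneg : ∃ i, w i < 0
    · have := key (-w) (W.neg_mem hw) (by intro i hi; exact hws (by simpa using hi))
        (hneg.imp fun i hi => by simpa using hi)
      simpa using Submodule.neg_mem _ this
    · push Not at hneg
      have : w = 0 := funext fun i => le_antisymm (hpos i) (hneg i)
      rw [this]
      exact Submodule.zero_mem _

/-- A nonnegative vector of `W` is a combination of the circuits in its support. -/
lemma mem_span_circuits {W : Submodule ℝ (ι → ℝ)} {z : Finset ι → ι → ℝ}
    (hz : ∀ C, IsCircuit W C → z C ∈ W ∧ 0 ≤ z C ∧ coordSupport (z C) = C)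
    {y : ι → ℝ} (hy : y ∈ W) (hy0 : 0 ≤ y) :
    y ∈ Submodule.span ℝ (z '' {C | IsCircuit W C ∧ C ⊆ coordSupport y}) := by
  induction hn : (coordSupport y).card using Nat.strong_induction_on generalizing y with
  | _ n ih =>
    by_cases hne : y = 0
    · rw [hne]
      exact Submodule.zero_mem _
    obtain ⟨C, hCs, hC⟩ := exists_isCircuit_subset ⟨y, hy, hy0, rfl⟩ (coordSupport_nonempty hne)
    obtain ⟨hzW, hz0, hzs⟩ := hz C hC
    have hoff : ∀ i, y i = 0 → z C i = 0 := by
      intro i hi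
      by_contra h
      have h1 : i ∈ C := hzs ▸ mem_coordSupport.2 h
      exact mem_coordSupport.1 (hCs h1) hi
    obtain ⟨i, hi⟩ := hC.1.2
    have hpos : ∃ i, 0 < z C i := ⟨i, lt_of_le_of_ne (hz0 i) (Ne.symm (by
      rw [← hzs, mem_coordSupport] at hi; exact hi))⟩
    obtain ⟨t, ht, hnn, j, hyj, hzj, h0⟩ :=
      exists_sub_smul_nonneg hy0 (fun i hi => (hoff i hi).le) hpos
    have hsub : coordSupport (y - t • z C) ⊆ coordSupport y := by
      intro k hk
      rw [mem_coordSupport] at hk ⊢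
      intro hk0
      exact hk (by simp [hk0, hoff k hk0])
    have hlt : (coordSupport (y - t • z C)).card < n := by
      rw [← hn]
      apply Finset.card_lt_card
      rw [Finset.ssubset_iff_of_subset hsub]
      exact ⟨j, mem_coordSupport.2 hyj, fun h => mem_coordSupport.1 h h0⟩
    have h1 := ih _ hlt (W.sub_mem hy (W.smul_mem t hzW)) hnn rfl
    have h2 : y - t • z C ∈ Submodule.span ℝ (z '' {C | IsCircuit W C ∧ C ⊆ coordSupport y}) :=
      Submodule.span_mono (Set.image_mono fun D (hD : IsCircuit W D ∧ _) =>
        show IsCircuit W D ∧ _ from ⟨hD.1, hD.2.trans hsub⟩) h1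
    have h3 : z C ∈ Submodule.span ℝ (z '' {C | IsCircuit W C ∧ C ⊆ coordSupport y}) :=
      Submodule.subset_span (Set.mem_image_of_mem z ⟨hC, hCs⟩)
    simpa using Submodule.add_mem _ h2 (Submodule.smul_mem _ t h3)

lemma exists_circuit_vectors (W : Submodule ℝ (ι → ℝ)) : ∃ z : Finset ι → ι → ℝ,
    ∀ C, IsCircuit W C → z C ∈ W ∧ 0 ≤ z C ∧ coordSupport (z C) = C := by
  have : ∀ C, ∃ y, IsCircuit W C → y ∈ W ∧ 0 ≤ y ∧ coordSupport y = C := by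
    intro C
    by_cases hC : IsCircuit W C
    · obtain ⟨y, h1, h2, h3⟩ := hC.1.1
      exact ⟨y, fun _ => ⟨h1, h2, h3⟩⟩
    · exact ⟨0, fun h => absurd h hC⟩
  choose z hz using this
  exact ⟨z, hz⟩

lemma exists_neg_of_pointed {W : Submodule ℝ (ι → ℝ)} {h : (ι → ℝ) →ₗ[ℝ] ℝ}
    (hh : ∀ y ∈ W, 0 ≤ y → y ≠ 0 → 0 < h y) {v : ι → ℝ} (hv : v ∈ W) (hv0 : h v = 0)
    (hne : v ≠ 0) : ∃ i, v i < 0 := by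
  by_contra! hc
  exact (hh v hv hc hne).ne' hv0

lemma exists_pos_of_pointed {W : Submodule ℝ (ι → ℝ)} {h : (ι → ℝ) →ₗ[ℝ] ℝ}
    (hh : ∀ y ∈ W, 0 ≤ y → y ≠ 0 → 0 < h y) {v : ι → ℝ} (hv : v ∈ W) (hv0 : h v = 0)
    (hne : v ≠ 0) : ∃ i, 0 < v i := by
  obtain ⟨i, hi⟩ := exists_neg_of_pointed hh (W.neg_mem hv) (by simp [hv0]) (neg_ne_zero.2 hne)
  exact ⟨i, by simpa using hi⟩

variable [DecidableEq ι]

/-- The minimal nonempty members of `faceSupports W v`. -/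
def minFaceSupports (W : Submodule ℝ (ι → ℝ)) (v : ι → ℝ) : Set (Finset ι) :=
  {σ | Minimal (fun σ => σ ∈ faceSupports W v ∧ σ.Nonempty) σ}

lemma ncard_atomSet_faceSupports {W : Submodule ℝ (ι → ℝ)} {v : ι → ℝ}
    (h0 : ∅ ∈ faceSupports W v) :
    (atomSet (faceSupports W v)).ncard = (minFaceSupports W v).ncard := by
  rw [minFaceSupports, ← val_image_atomSet h0, Set.ncard_image_of_injective _
    Subtype.val_injective]

lemma empty_mem_faceSupports {W : Submodule ℝ (ι → ℝ)} {h : (ι → ℝ) →ₗ[ℝ] ℝ}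
    (hh : ∀ y ∈ W, 0 ≤ y → y ≠ 0 → 0 < h y) {v : ι → ℝ} (hv : v ∈ W) (hv0 : h v = 0) :
    ∅ ∈ faceSupports W v := by
  refine ⟨⟨0, W.zero_mem, le_rfl, by ext; simp⟩, ?_⟩
  by_cases hne : v = 0
  · left
    simp [hne]
  · right
    simpa using ⟨exists_pos_of_pointed hh hv hv0 hne, exists_neg_of_pointed hh hv hv0 hne⟩

lemma IsCircuit.mem_minFaceSupports {W : Submodule ℝ (ι → ℝ)} {v : ι → ℝ} {C : Finset ι}
    (hC : IsCircuit W C) (hb : SignBalanced v Cᶜ) : C ∈ minFaceSupports W v :=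
  ⟨⟨⟨hC.1.1, hb⟩, hC.1.2⟩, fun _ hσ hle => hC.2 ⟨hσ.1.1, hσ.2⟩ hle⟩

lemma mem_minFaceSupports_zero {W : Submodule ℝ (ι → ℝ)} {C : Finset ι} :
    C ∈ minFaceSupports W 0 ↔ IsCircuit W C := by
  have hb : ∀ Z : Finset ι, SignBalanced (0 : ι → ℝ) Z := fun Z => Or.inl fun i _ => rfl
  exact ⟨fun h => ⟨⟨h.1.1.1, h.1.2⟩, fun σ hσ hle => h.2 ⟨⟨hσ.1, hb _⟩, hσ.2⟩ hle⟩,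
    fun h => h.mem_minFaceSupports (hb _)⟩

/-- A vertex of the projection is the image of a vertex at which one cannot move along `v`: move
along `v` inside the fibre as far as possible. -/
lemma exists_isCircuit_of_mem_minFaceSupports {W : Submodule ℝ (ι → ℝ)} {h : (ι → ℝ) →ₗ[ℝ] ℝ}
    (hh : ∀ y ∈ W, 0 ≤ y → y ≠ 0 → 0 < h y) {v : ι → ℝ} (hv : v ∈ W) (hv0 : h v = 0)
    (hvne : v ≠ 0) {σ : Finset ι} (hσ : σ ∈ minFaceSupports W v) :
    ∃ C ⊆ σ, IsCircuit W C ∧ ∃ i ∉ C, v i < 0 := by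
  obtain ⟨⟨⟨⟨y, hy, hy0, hys⟩, hb⟩, hne⟩, -⟩ := hσ
  rcases hb with hb | ⟨-, i, hi, hvi⟩
  · obtain ⟨k, hk⟩ := exists_neg_of_pointed hh hv hv0 hvne
    have hoff : ∀ i, y i = 0 → v i = 0 := by
      intro i hi
      refine hb i ?_
      rw [Finset.mem_compl, ← hys, mem_coordSupport]
      simpa using hi
    obtain ⟨t, ht, hnn, i, hyi, hvi, h0⟩ := exists_sub_smul_nonneg (w := -v) hy0
      (fun i hi => by simp [hoff i hi]) ⟨k, by simpa using hk⟩
    have hyne : y ≠ 0 := by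
      rintro rfl
      exact hyi rfl
    have hsub : coordSupport (y - t • -v) ⊆ σ := by
      intro j hj
      rw [← hys, mem_coordSupport]
      intro hj0
      rw [mem_coordSupport] at hj
      exact hj (by simp [hj0, hoff j hj0])
    have hyne' : y - t • -v ≠ 0 := by
      intro hz
      have h1 := congrArg h hz
      simp [hv0] at h1
      exact (hh y hy hy0 hyne).ne' h1
    obtain ⟨C, hCs, hC⟩ := exists_isCircuit_subset
      ⟨_, W.sub_mem hy (W.smul_mem t (W.neg_mem hv)), hnn, rfl⟩ (coordSupport_nonempty hyne')
    exact ⟨C, hCs.trans hsub, hC, i, fun hi => mem_coordSupport.1 (hCs hi) h0, by simpa using hvi⟩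
  · obtain ⟨C, hCs, hC⟩ := exists_isCircuit_subset ⟨y, hy, hy0, hys⟩ hne
    exact ⟨C, hCs, hC, i, fun h => (Finset.mem_compl.1 hi) (hCs h), hvi⟩

/-- Two vertices of the projection with a common circuit agree: the largest support inside the
intersection is again balanced. -/
lemma eq_of_isCircuit_subset {W : Submodule ℝ (ι → ℝ)} {v : ι → ℝ} (hv : v ∈ W) {σ τ C : Finset ι}
    (hσ : σ ∈ minFaceSupports W v) (hτ : τ ∈ minFaceSupports W v) (hC : IsCircuit W C)
    (hCσ : C ⊆ σ) (hCτ : C ⊆ τ) : σ = τ := by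
  have hK : Convex ℝ {y | y ∈ W ∧ 0 ≤ y ∧ coordSupport y ⊆ σ ∩ τ} := by
    rintro y ⟨hy, hy0, hys⟩ z ⟨hz, hz0, hzs⟩ a b ha hb -
    refine ⟨W.add_mem (W.smul_mem a hy) (W.smul_mem b hz),
      add_nonneg (smul_nonneg ha hy0) (smul_nonneg hb hz0), fun i hi => ?_⟩
    by_contra hi'
    have h1 : y i = 0 := by
      by_contra h1
      exact hi' (hys (mem_coordSupport.2 h1))
    have h2 : z i = 0 := by
      by_contra h2
      exact hi' (hzs (mem_coordSupport.2 h2))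
    rw [mem_coordSupport] at hi
    exact hi (by simp [h1, h2])
  obtain ⟨c, hc, hc0, hcs⟩ := hC.1.1
  have hcK : c ∈ {y | y ∈ W ∧ 0 ≤ y ∧ coordSupport y ⊆ σ ∩ τ} :=
    ⟨hc, hc0, by rw [hcs]; exact Finset.subset_inter hCσ hCτ⟩
  obtain ⟨y, ⟨hy, hy0, hys⟩, hmax⟩ := exists_max_support hK (fun y hy => hy.2.1) ⟨c, hcK⟩
  have hyne : (coordSupport y).Nonempty := hC.1.2.mono (hcs ▸ hmax c hcK)
  have key : ∀ w ∈ W, (SignBalanced w σᶜ) → (SignBalanced w τᶜ) →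
      ¬((∀ i ∈ (coordSupport y)ᶜ, 0 ≤ w i) ∧ ∃ i ∈ (coordSupport y)ᶜ, w i ≠ 0) := by
    rintro w hw hbσ hbτ ⟨h1, i, hi, hwi⟩
    have hz : ∀ ρ : Finset ι, coordSupport y ⊆ ρ → SignBalanced w ρᶜ → ∀ i ∉ ρ, w i = 0 := by
      rintro ρ hρ (hb | ⟨-, j, hj, hwj⟩) i hi
      · exact hb i (Finset.mem_compl.2 hi)
      · refine absurd (h1 j ?_) (not_le.2 hwj)
        rw [Finset.mem_compl] at hj ⊢
        exact fun h => hj (hρ h)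
    obtain ⟨t, ht, hnn⟩ := exists_pos_add_smul_nonneg (z := w) hy0
      (fun i hi => h1 i (by simpa using hi))
    have hmem : y + t • w ∈ {y | y ∈ W ∧ 0 ≤ y ∧ coordSupport y ⊆ σ ∩ τ} := by
      refine ⟨W.add_mem hy (W.smul_mem t hw), hnn, fun j hj => ?_⟩
      by_contra hj'
      have hyj : y j = 0 := by
        by_contra h2
        exact hj' (hys (mem_coordSupport.2 h2))
      have hwj : w j = 0 := by
        rw [Finset.mem_inter, not_and_or] at hj'
        rcases hj' with h2 | h2
        · exact hz σ (hys.trans Finset.inter_subset_left) hbσ j h2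
        · exact hz τ (hys.trans Finset.inter_subset_right) hbτ j h2
      rw [mem_coordSupport] at hj
      exact hj (by simp [hyj, hwj])
    have hyi : y i = 0 := by simpa using hi
    have h2 : i ∈ coordSupport (y + t • w) := by
      simp [hyi, ht.ne', hwi]
    exact Finset.mem_compl.1 hi (hmax _ hmem h2)
  have hneg : ∀ {Z : Finset ι}, SignBalanced v Z → SignBalanced (-v) Z := by
    rintro Z (hb | ⟨⟨i, hi, h1⟩, j, hj, h2⟩)
    · exact Or.inl fun i hi => by simp [hb i hi]
    · exact Or.inr ⟨⟨j, hj, by simpa using h2⟩, i, hi, by simpa using h1⟩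
  have hbal : SignBalanced v (coordSupport y)ᶜ := by
    apply signBalanced_of_not
    · exact key v hv hσ.1.1.2 hτ.1.1.2
    · rintro ⟨h1, i, hi, hvi⟩
      exact key (-v) (W.neg_mem hv) (hneg hσ.1.1.2) (hneg hτ.1.1.2)
        ⟨fun i hi => by simpa using h1 i hi, i, hi, by simpa using hvi⟩
  have hF : coordSupport y ∈ faceSupports W v ∧ (coordSupport y).Nonempty :=
    ⟨⟨⟨y, hy, hy0, rfl⟩, hbal⟩, hyne⟩
  have h1 := hys.trans Finset.inter_subset_left
  have h2 := hys.trans Finset.inter_subset_right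
  exact ((hσ.2 hF h1).antisymm h1).trans ((hτ.2 hF h2).antisymm h2).symm

/-- Upper bound for the number of vertices of the projection. -/
lemma ncard_minFaceSupports_le {W : Submodule ℝ (ι → ℝ)} {h : (ι → ℝ) →ₗ[ℝ] ℝ}
    (hh : ∀ y ∈ W, 0 ≤ y → y ≠ 0 → 0 < h y) {v : ι → ℝ} (hv : v ∈ W) (hv0 : h v = 0)
    (hvne : v ≠ 0) :
    (minFaceSupports W v).ncard ≤ {C | IsCircuit W C ∧ ∃ i ∉ C, v i < 0}.ncard := by
  choose! f hf1 hf2 hf3 using fun σ (hσ : σ ∈ minFaceSupports W v) =>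
    exists_isCircuit_of_mem_minFaceSupports hh hv hv0 hvne hσ
  refine Set.ncard_le_ncard_of_injOn f (fun σ hσ => ⟨hf2 σ hσ, hf3 σ hσ⟩) ?_ (Set.toFinite _)
  intro σ hσ τ hτ hst
  exact eq_of_isCircuit_subset hv hσ hτ (hf2 σ hσ) (hf1 σ hσ) (hst ▸ hf1 τ hτ)

end Circuits

/-! ### Sections by a hyperplane -/

section Tame

/-- A family of finite sets is tame with bound `c` if, outside an exceptional set of at most `c`
elements, membership depends only on which of three colours occur in the set and in its
complement. -/
def IsTame {ι : Type*} [DecidableEq ι] (c : ℕ) (S : Set (Finset ι)) : Prop :=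
  ∃ (E : Finset ι) (col : ι → Fin 3), E.card ≤ c ∧ ∀ σ τ : Finset ι, σ ∩ E = τ ∩ E →
    (∀ k, (∃ i ∈ σ, i ∉ E ∧ col i = k) ↔ ∃ i ∈ τ, i ∉ E ∧ col i = k) →
    (∀ k, (∃ i ∉ σ, i ∉ E ∧ col i = k) ↔ ∃ i ∉ τ, i ∉ E ∧ col i = k) → (σ ∈ S ↔ τ ∈ S)

lemma IsTame.mono {ι : Type*} [DecidableEq ι] {c d : ℕ} {S : Set (Finset ι)} (h : IsTame c S)
    (hcd : c ≤ d) : IsTame d S := by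
  obtain ⟨E, col, hE, h⟩ := h
  exact ⟨E, col, hE.trans hcd, h⟩

lemma signBalanced_iff {ι : Type*} {v : ι → ℝ} {Z : Finset ι} :
    SignBalanced v Z ↔ ((∃ i ∈ Z, 0 < v i) ↔ ∃ i ∈ Z, v i < 0) := by
  constructor
  · rintro (h | ⟨h1, h2⟩)
    · constructor
      · rintro ⟨i, hi, hv⟩
        exact absurd (h i hi) hv.ne'
      · rintro ⟨i, hi, hv⟩
        exact absurd (h i hi) hv.ne
    · exact ⟨fun _ => h2, fun _ => h1⟩
  · intro h
    by_cases h1 : ∃ i ∈ Z, 0 < v i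
    · exact Or.inr ⟨h1, h.1 h1⟩
    · refine Or.inl fun i hi => le_antisymm ?_ ?_
      · by_contra! h2
        exact h1 ⟨i, hi, h2⟩
      · by_contra! h2
        exact h1 (h.2 ⟨i, hi, h2⟩)

lemma pair_injective_of_sign {ι : Type*} [DecidableEq ι] {α : ι → ℝ} {i i' j j' : ι}
    (hi : 0 < α i) (hi' : 0 < α i') (hj : α j < 0)
    (hj' : α j' < 0) (h : ({i, j} : Finset ι) = {i', j'}) : i = i' ∧ j = j' := by
  have h1 : i ∈ ({i', j'} : Finset ι) := by rw [← h]; simp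
  have h2 : j ∈ ({i', j'} : Finset ι) := by rw [← h]; simp
  simp only [Finset.mem_insert, Finset.mem_singleton] at h1 h2
  constructor
  · rcases h1 with h1 | rfl
    · exact h1
    · linarith
  · rcases h2 with rfl | h2
    · linarith
    · exact h2

end Tame

section Hyperplane

variable {ι : Type*} [Fintype ι] {W : Submodule ℝ (ι → ℝ)} {α : ι → ℝ}

lemma isSupport_iff_signBalanced (hα : ∀ y, y ∈ W ↔ ∑ i, α i * y i = 0) {σ : Finset ι} :
    IsSupport W σ ↔ SignBalanced α σ := by
  constructor
  · rintro ⟨y, hy, hy0, rfl⟩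
    rw [hα] at hy
    have key : ∀ β : ι → ℝ, ∑ i, β i * y i = 0 → (∃ i ∈ coordSupport y, 0 < β i) →
        ∃ i ∈ coordSupport y, β i < 0 := by
      rintro β hβ ⟨i, hi, hp⟩
      by_contra! hc
      have hnn : ∀ j ∈ Finset.univ, 0 ≤ β j * y j := by
        intro j _
        by_cases hj : y j = 0
        · simp [hj]
        · exact mul_nonneg (hc j (mem_coordSupport.2 hj)) (hy0 j)
      have := (Finset.sum_eq_zero_iff_of_nonneg hnn).1 hβ i (Finset.mem_univ i)
      exact mul_ne_zero hp.ne' (mem_coordSupport.1 hi) this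
    rw [signBalanced_iff]
    refine ⟨key α hy, fun h => ?_⟩
    have := key (-α) (by simpa using hy) (h.imp fun i hi => by simpa using hi)
    exact this.imp fun i hi => by simpa using hi
  · intro h
    obtain ⟨c, hc, hc0, hs⟩ := h.exists_weights
    refine ⟨c, (hα c).2 (by simpa only [mul_comm] using hs), fun i => ?_, ?_⟩
    · by_cases hi : i ∈ σ
      · exact (hc i hi).le
      · exact (hc0 i hi).ge
    · ext i
      rw [mem_coordSupport]
      constructor
      · intro h
        by_contra hi
        exact h (hc0 i hi)
      · exact fun hi => (hc i hi).ne'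

variable [DecidableEq ι]

lemma isCircuit_iff (hα : ∀ y, y ∈ W ↔ ∑ i, α i * y i = 0) {C : Finset ι} :
    IsCircuit W C ↔
      (∃ l, α l = 0 ∧ C = {l}) ∨ ∃ i j, 0 < α i ∧ α j < 0 ∧ C = {i, j} := by
  have hsing : ∀ l, IsSupport W {l} ↔ α l = 0 := by
    intro l
    rw [isSupport_iff_signBalanced hα, signBalanced_iff]
    simp only [Finset.mem_singleton, exists_eq_left]
    constructor
    · intro h
      rcases lt_trichotomy (α l) 0 with h1 | h1 | h1
      · exact absurd (h.2 h1) (not_lt.2 h1.le)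
      · exact h1
      · exact absurd (h.1 h1) (not_lt.2 h1.le)
    · intro h
      simp [h]
  have hpair : ∀ i j, 0 < α i → α j < 0 → IsSupport W {i, j} := by
    intro i j hi hj
    rw [isSupport_iff_signBalanced hα]
    exact Or.inr ⟨⟨i, by simp, hi⟩, j, by simp, hj⟩
  constructor
  · rintro ⟨⟨hs, hne⟩, hmin⟩
    have hs' := (isSupport_iff_signBalanced hα).1 hs
    rcases hs' with h | ⟨⟨i, hi, hi0⟩, j, hj, hj0⟩
    · obtain ⟨l, hl⟩ := hne
      left
      refine ⟨l, h l hl, ?_⟩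
      have h1 : ({l} : Finset ι) ≤ C := Finset.singleton_subset_iff.2 hl
      exact (hmin ⟨(hsing l).2 (h l hl), Finset.singleton_nonempty l⟩ h1).antisymm h1
    · right
      refine ⟨i, j, hi0, hj0, ?_⟩
      have h1 : ({i, j} : Finset ι) ≤ C := by
        intro k hk
        rcases Finset.mem_insert.1 hk with rfl | hk
        · exact hi
        · rw [Finset.mem_singleton.1 hk]; exact hj
      exact (hmin ⟨hpair i j hi0 hj0, Finset.insert_nonempty _ _⟩ h1).antisymm h1
  · rintro (⟨l, hl, rfl⟩ | ⟨i, j, hi, hj, rfl⟩)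
    · refine ⟨⟨(hsing l).2 hl, Finset.singleton_nonempty l⟩, ?_⟩
      rintro σ ⟨-, hne⟩ hle
      exact (Finset.Nonempty.subset_singleton_iff hne).1 hle |>.ge
    · refine ⟨⟨hpair i j hi hj, Finset.insert_nonempty _ _⟩, ?_⟩
      rintro σ ⟨hs, k, hk⟩ hle
      have hs' := (isSupport_iff_signBalanced hα).1 hs
      have hsub : ∀ l ∈ σ, l = i ∨ l = j := fun l hl => by simpa using hle hl
      rcases hs' with h | ⟨⟨p, hp, hp0⟩, n, hn, hn0⟩
      · have := h k hk
        rcases hsub k hk with rfl | rfl <;> linarith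
      · have h1 : i ∈ σ := by
          rcases hsub p hp with rfl | rfl
          · exact hp
          · linarith
        have h2 : j ∈ σ := by
          rcases hsub n hn with rfl | rfl
          · linarith
          · exact hn
        intro l hl
        rcases Finset.mem_insert.1 hl with rfl | hl
        · exact h1
        · rw [Finset.mem_singleton.1 hl]; exact h2

/-- The section of the orthant by a hyperplane is an iterated pyramid over a product of two
simplices; this counts its vertices. -/
lemma ncard_isCircuit (hα : ∀ y, y ∈ W ↔ ∑ i, α i * y i = 0) :
    {C | IsCircuit W C}.ncard =
      (Finset.univ.filter fun i => 0 < α i).card * (Finset.univ.filter fun i => α i < 0).card +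
        (Finset.univ.filter fun i => α i = 0).card := by
  set A := Finset.univ.filter fun i => 0 < α i
  set B := Finset.univ.filter fun i => α i < 0
  set Z := Finset.univ.filter fun i => α i = 0
  have hset : {C | IsCircuit W C} =
      (((A ×ˢ B).image fun p => ({p.1, p.2} : Finset ι)) ∪ Z.image fun l => {l} : Finset _) := by
    ext C
    rw [Set.mem_ofPred_eq, isCircuit_iff hα]
    simp only [Finset.coe_union, Finset.coe_image, Set.mem_union, Set.mem_image, Finset.mem_coe,
      Finset.mem_product, A, B, Z, Finset.mem_filter, Finset.mem_univ, true_and, Prod.exists]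
    rw [or_comm]
    constructor
    · rintro (⟨i, j, hi, hj, rfl⟩ | ⟨l, hl, rfl⟩)
      · exact Or.inl ⟨i, j, ⟨hi, hj⟩, rfl⟩
      · exact Or.inr ⟨l, hl, rfl⟩
    · rintro (⟨i, j, ⟨hi, hj⟩, rfl⟩ | ⟨l, hl, rfl⟩)
      · exact Or.inl ⟨i, j, hi, hj, rfl⟩
      · exact Or.inr ⟨l, hl, rfl⟩
  rw [hset, Set.ncard_coe_finset, Finset.card_union_of_disjoint, Finset.card_image_of_injOn,
    Finset.card_product, Finset.card_image_of_injective _ (Finset.singleton_injective)]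
  · rintro ⟨i, j⟩ hp ⟨i', j'⟩ hp' h
    simp only [Finset.coe_product, Set.mem_prod, Finset.mem_coe, A, B, Finset.mem_filter,
      Finset.mem_univ, true_and] at hp hp'
    obtain ⟨h1, h2⟩ := pair_injective_of_sign hp.1 hp'.1 hp.2 hp'.2 h
    rw [h1, h2]
  · rw [Finset.disjoint_left]
    rintro C h1 h2
    obtain ⟨⟨i, j⟩, hp, rfl⟩ := Finset.mem_image.1 h1
    obtain ⟨l, hl, h⟩ := Finset.mem_image.1 h2
    simp only [Finset.mem_product, A, B, Z, Finset.mem_filter, Finset.mem_univ, true_and] at hp hl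
    have : i ∈ ({l} : Finset ι) := by rw [h]; simp
    rw [Finset.mem_singleton] at this
    rw [this] at hp
    linarith

lemma ncard_isCircuit_mem_of_neg (hα : ∀ y, y ∈ W ↔ ∑ i, α i * y i = 0) {i : ι} (hi : α i < 0) :
    {C | IsCircuit W C ∧ i ∈ C}.ncard = (Finset.univ.filter fun i => 0 < α i).card := by
  have hset : {C | IsCircuit W C ∧ i ∈ C} =
      ((Finset.univ.filter fun j => 0 < α j).image fun j => ({j, i} : Finset ι) : Finset _) := by
    ext C
    rw [Set.mem_ofPred_eq, isCircuit_iff hα]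
    simp only [Finset.coe_image, Set.mem_image, Finset.mem_coe,
      Finset.mem_filter, Finset.mem_univ, true_and]
    constructor
    · rintro ⟨⟨l, hl, rfl⟩ | ⟨p, n, hp, hn, rfl⟩, h⟩
      · rw [Finset.mem_singleton] at h
        rw [h] at hi
        linarith
      · simp only [Finset.mem_insert, Finset.mem_singleton] at h
        rcases h with rfl | rfl
        · linarith
        · exact ⟨p, hp, rfl⟩
    · rintro ⟨j, hj, rfl⟩
      exact ⟨Or.inr ⟨j, i, hj, hi, rfl⟩, by simp⟩
  rw [hset, Set.ncard_coe_finset, Finset.card_image_of_injOn]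
  intro j hj j' hj' h
  exact (pair_injective_of_sign (α := α) (by simpa using hj) (by simpa using hj') hi hi h).1

lemma ncard_isCircuit_mem_of_pos (hα : ∀ y, y ∈ W ↔ ∑ i, α i * y i = 0) {i : ι} (hi : 0 < α i) :
    {C | IsCircuit W C ∧ i ∈ C}.ncard = (Finset.univ.filter fun i => α i < 0).card := by
  have := ncard_isCircuit_mem_of_neg (W := W) (α := -α) (fun y => by rw [hα]; simp) (i := i)
    (by simpa using hi)
  simpa using this

lemma IsCircuit.eq_singleton_of_mem (hα : ∀ y, y ∈ W ↔ ∑ i, α i * y i = 0) {i : ι} (hi : α i = 0)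
    {C : Finset ι} (hC : IsCircuit W C) (hiC : i ∈ C) : C = {i} := by
  rcases (isCircuit_iff hα).1 hC with ⟨l, -, rfl⟩ | ⟨p, n, hp, hn, rfl⟩
  · rw [Finset.mem_singleton.1 hiC]
  · simp only [Finset.mem_insert, Finset.mem_singleton] at hiC
    rcases hiC with rfl | rfl <;> linarith

/-- The number of circuits containing a given nonempty set. -/
lemma ncard_isCircuit_superset (hα : ∀ y, y ∈ W ↔ ∑ i, α i * y i = 0) {T : Finset ι}
    (hT : T.Nonempty) :
    {C | IsCircuit W C ∧ T ⊆ C}.ncard ≤ 1 ∨ T.card = 1 ∧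
      ({C | IsCircuit W C ∧ T ⊆ C}.ncard = (Finset.univ.filter fun i => α i < 0).card ∨
        {C | IsCircuit W C ∧ T ⊆ C}.ncard = (Finset.univ.filter fun i => 0 < α i).card) := by
  rcases Nat.lt_or_ge 1 T.card with hT2 | hT2
  · left
    have : {C | IsCircuit W C ∧ T ⊆ C} ⊆ {T} := by
      rintro C ⟨hC, hTC⟩
      have hcard : C.card ≤ 2 := by
        rcases (isCircuit_iff hα).1 hC with ⟨l, -, rfl⟩ | ⟨i, j, -, -, rfl⟩
        · simp
        · exact Finset.card_le_two
      exact (Finset.eq_of_subset_of_card_le hTC (by omega)).symm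
    exact (Set.ncard_le_ncard this).trans (Set.ncard_singleton T).le
  · have hT1 : T.card = 1 := le_antisymm hT2 hT.card_pos
    obtain ⟨i, rfl⟩ := Finset.card_eq_one.1 hT1
    simp only [Finset.singleton_subset_iff]
    rcases lt_trichotomy (α i) 0 with hi | hi | hi
    · exact Or.inr ⟨hT1, Or.inr (ncard_isCircuit_mem_of_neg hα hi)⟩
    · left
      have : {C | IsCircuit W C ∧ i ∈ C} ⊆ {{i}} := fun C hC =>
        hC.1.eq_singleton_of_mem hα hi hC.2
      exact (Set.ncard_le_ncard this).trans (Set.ncard_singleton _).le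
    · exact Or.inr ⟨hT1, Or.inl (ncard_isCircuit_mem_of_pos hα hi)⟩

/-- Numerical core of the codimension-one case: `a`, `b`, `k` count the coordinates of each sign,
`s` and `t` the circuits lost in the two directions of the projection. -/
lemma le_six_of_vertex_count {a b k s t : ℕ} (ha : 2 ≤ a) (hb : 2 ≤ b)
    (h1 : a * b + k ≤ a + b + k + 1 + s + t) (h2 : a + b + k + 1 + s ≤ a * b + k)
    (hs : s ≤ 1 ∨ s = b ∨ s = a) (ht : t ≤ 1) : a ≤ 6 ∧ b ≤ 6 := by
  obtain ⟨a, rfl⟩ := Nat.exists_eq_add_of_le ha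
  obtain ⟨b, rfl⟩ := Nat.exists_eq_add_of_le hb
  have e : (2 + a) * (2 + b) = 4 + 2 * a + 2 * b + a * b := by ring
  rw [e] at h1 h2
  have key : ∀ a b : ℕ, a + a * b ≤ 4 → 3 ≤ a + a * b → a ≤ 4 ∧ b ≤ 4 := by
    intro a b h3 h4
    have ha1 : 1 ≤ a := by
      rcases Nat.eq_zero_or_pos a with rfl | h
      · simp at h4
      · exact h
    exact ⟨by omega, by nlinarith⟩
  rcases hs with hs | rfl | rfl
  · omega
  · have := key a b (by omega) (by omega)
    omega
  · rw [mul_comm a b] at h1 h2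
    have := key b a (by omega) (by omega)
    omega

/-- If the projection of a section of the orthant by a hyperplane has one vertex more than there are
coordinates, then either few coordinates carry the hyperplane, or the direction of the projection
has at most two nonzero coordinates. -/
lemma few_coordinates_of_ncard_eq (hα : ∀ y, y ∈ W ↔ ∑ i, α i * y i = 0) (hirr : Irredundant W)
    {h : (ι → ℝ) →ₗ[ℝ] ℝ} (hh : ∀ y ∈ W, 0 ≤ y → y ≠ 0 → 0 < h y) {v : ι → ℝ} (hv : v ∈ W)
    (hv0 : h v = 0) (hvne : v ≠ 0) (hα0 : α ≠ 0)
    (hcard : (minFaceSupports W v).ncard = Fintype.card ι + 1) :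
    (coordSupport α).card ≤ 12 ∨ (coordSupport v).card ≤ 2 := by
  set A := Finset.univ.filter fun i => 0 < α i with hA
  set B := Finset.univ.filter fun i => α i < 0 with hB
  set Z := Finset.univ.filter fun i => α i = 0 with hZ
  -- a coordinate that is alone in its sign class would vanish only together with the other class
  have htwo : ∀ β : ι → ℝ, (∀ y, y ∈ W ↔ ∑ i, β i * y i = 0) → β ≠ 0 →
      2 ≤ (Finset.univ.filter fun i => 0 < β i).card := by
    intro β hβ hβ0
    have hposne : ∀ k, (∃ i ≠ k, β i ≠ 0) → ∃ i ≠ k, 0 < β i := by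
      rintro k ⟨i, hik, hi⟩
      obtain ⟨y, hy, hy0, hyk⟩ := hirr k
      have hs := (isSupport_iff_signBalanced hβ).1 ⟨y, hy, hy0, rfl⟩
      have hmem : ∀ j, j ∈ coordSupport y ↔ j ≠ k := fun j => by
        rw [mem_coordSupport, Ne, hyk]
      rcases hs with hs | ⟨⟨j, hj, hj0⟩, -⟩
      · exact absurd (hs i ((hmem i).2 hik)) hi
      · exact ⟨j, (hmem j).1 hj, hj0⟩
    have hnegne : ∀ k, (∃ i ≠ k, β i ≠ 0) → ∃ i ≠ k, β i < 0 := by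
      rintro k ⟨i, hik, hi⟩
      obtain ⟨y, hy, hy0, hyk⟩ := hirr k
      have hs := (isSupport_iff_signBalanced hβ).1 ⟨y, hy, hy0, rfl⟩
      have hmem : ∀ j, j ∈ coordSupport y ↔ j ≠ k := fun j => by
        rw [mem_coordSupport, Ne, hyk]
      rcases hs with hs | ⟨-, j, hj, hj0⟩
      · exact absurd (hs i ((hmem i).2 hik)) hi
      · exact ⟨j, (hmem j).1 hj, hj0⟩
    have hsingle : ∀ k, β k ≠ 0 → ∃ i ≠ k, β i ≠ 0 := by
      intro k hk
      by_contra! hc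
      have hW : ∀ y ∈ W, y k = 0 := by
        intro y hy
        rw [hβ, Finset.sum_eq_single k (fun i _ hi => by rw [hc i hi, zero_mul]) (by simp)] at hy
        exact (mul_eq_zero.1 hy).resolve_left hk
      have hall : ∀ j, j = k := by
        intro j
        obtain ⟨y, hy, -, hyj⟩ := hirr j
        exact ((hyj k).1 (hW y hy)).symm
      exact hvne (funext fun j => by rw [hall j]; exact hW v hv)
    obtain ⟨k, hk⟩ := Function.ne_iff.1 hβ0
    obtain ⟨p, -, hp⟩ := hposne k (hsingle k hk)
    obtain ⟨q, hqp, hq⟩ := hposne p (hsingle p hp.ne')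
    exact Finset.one_lt_card.2 ⟨p, by simpa using hp, q, by simpa using hq, hqp.symm⟩
  have ha : 2 ≤ A.card := htwo α hα hα0
  have hb : 2 ≤ B.card := by
    have := htwo (-α) (fun y => by rw [hα]; simp) (neg_ne_zero.2 hα0)
    simpa using this
  have hN : Fintype.card ι = A.card + B.card + Z.card := by
    rw [← Finset.card_union_of_disjoint, ← Finset.card_union_of_disjoint, ← Finset.card_univ]
    · congr 1
      ext i
      rcases lt_trichotomy (α i) 0 with h1 | h1 | h1 <;> simp [hA, hB, hZ, h1]
    · rw [Finset.disjoint_left]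
      intro i h1 h2
      simp only [hA, hB, hZ, Finset.mem_union, Finset.mem_filter, Finset.mem_univ,
        true_and] at h1 h2
      rcases h1 with h1 | h1 <;> linarith
    · rw [Finset.disjoint_left]
      intro i h1 h2
      simp only [hA, hB, Finset.mem_filter, Finset.mem_univ, true_and] at h1 h2
      linarith
  have hM := ncard_isCircuit hα
  rw [← hA, ← hB, ← hZ] at hM
  set Ng := Finset.univ.filter fun i => v i < 0 with hNg
  set Ps := Finset.univ.filter fun i => 0 < v i with hPs
  have hNgne : Ng.Nonempty := by
    obtain ⟨i, hi⟩ := exists_neg_of_pointed hh hv hv0 hvne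
    exact ⟨i, by simpa [hNg] using hi⟩
  have hPsne : Ps.Nonempty := by
    obtain ⟨i, hi⟩ := exists_pos_of_pointed hh hv hv0 hvne
    exact ⟨i, by simpa [hPs] using hi⟩
  have hs := ncard_isCircuit_superset hα hNgne
  have ht := ncard_isCircuit_superset hα hPsne
  rw [← hA, ← hB] at hs ht
  -- circuits that can be moved in a direction are lost
  have hup : ∀ w ∈ W, h w = 0 → w ≠ 0 → minFaceSupports W w = minFaceSupports W v →
      Fintype.card ι + 1 +
        {C | IsCircuit W C ∧ (Finset.univ.filter fun i => w i < 0) ⊆ C}.ncard ≤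
        {C | IsCircuit W C}.ncard := by
    intro w hw hw0 hwne heq
    have h1 := ncard_minFaceSupports_le hh hw hw0 hwne
    rw [heq, hcard] at h1
    have h2 : {C | IsCircuit W C ∧ ∃ i ∉ C, w i < 0} =
        {C | IsCircuit W C} \
          {C | IsCircuit W C ∧ (Finset.univ.filter fun i => w i < 0) ⊆ C} := by
      ext C
      simp only [Set.mem_ofPred_eq, Set.mem_sdiff, not_and, Finset.subset_iff,
        Finset.mem_filter, Finset.mem_univ, true_and]
      refine and_congr_right fun hC => ?_
      constructor
      · rintro ⟨i, hi, hwi⟩ - hsub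
        exact hi (hsub hwi)
      · intro h3
        have h4 := h3 hC
        push Not at h4
        exact h4.imp fun i hi => ⟨hi.2, hi.1⟩
    rw [h2] at h1
    have h3 := Set.ncard_sdiff_add_ncard_of_subset (s := {C | IsCircuit W C ∧
      (Finset.univ.filter fun i => w i < 0) ⊆ C}) (t := {C | IsCircuit W C})
      (fun C hC => hC.1) (Set.toFinite _)
    omega
  have hneg : minFaceSupports W (-v) = minFaceSupports W v := by
    have : faceSupports W (-v) = faceSupports W v := by
      ext σ
      refine and_congr_right fun _ => ?_
      rw [signBalanced_iff, signBalanced_iff]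
      simp only [Pi.neg_apply, Left.neg_pos_iff, Left.neg_neg_iff]
      exact ⟨Iff.symm, Iff.symm⟩
    rw [minFaceSupports, this, minFaceSupports]
  have hupv := hup v hv hv0 hvne rfl
  have hupn := hup (-v) (W.neg_mem hv) (by simp [hv0]) (neg_ne_zero.2 hvne) hneg
  simp only [Pi.neg_apply, Left.neg_neg_iff] at hupn
  rw [← hNg] at hupv
  rw [← hPs] at hupn
  -- all other circuits survive
  have hlow : {C | IsCircuit W C}.ncard ≤ Fintype.card ι + 1 +
      {C | IsCircuit W C ∧ Ng ⊆ C}.ncard + {C | IsCircuit W C ∧ Ps ⊆ C}.ncard := by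
    have hsub : {C | IsCircuit W C} ⊆ (minFaceSupports W v ∪
        {C | IsCircuit W C ∧ Ng ⊆ C}) ∪ {C | IsCircuit W C ∧ Ps ⊆ C} := by
      intro C hC
      have hC : IsCircuit W C := hC
      by_cases h1 : Ng ⊆ C
      · exact Or.inl (Or.inr ⟨hC, h1⟩)
      by_cases h2 : Ps ⊆ C
      · exact Or.inr ⟨hC, h2⟩
      refine Or.inl (Or.inl (hC.mem_minFaceSupports (Or.inr ⟨?_, ?_⟩)))
      · obtain ⟨i, hi, hiC⟩ := Finset.not_subset.1 h2
        exact ⟨i, Finset.mem_compl.2 hiC, by simpa [hPs] using hi⟩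
      · obtain ⟨i, hi, hiC⟩ := Finset.not_subset.1 h1
        exact ⟨i, Finset.mem_compl.2 hiC, by simpa [hNg] using hi⟩
    have h1 := Set.ncard_le_ncard hsub (Set.toFinite _)
    have h2 := Set.ncard_union_le (minFaceSupports W v ∪ {C | IsCircuit W C ∧ Ng ⊆ C})
      {C | IsCircuit W C ∧ Ps ⊆ C}
    have h3 := Set.ncard_union_le (minFaceSupports W v) {C | IsCircuit W C ∧ Ng ⊆ C}
    omega
  have hsuppα : (coordSupport α).card ≤ A.card + B.card := by
    refine (Finset.card_le_card ?_).trans (Finset.card_union_le A B)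
    intro i hi
    rw [mem_coordSupport] at hi
    rcases lt_or_gt_of_ne hi with h1 | h1 <;> simp [hA, hB, h1]
  have hsuppv : (coordSupport v).card ≤ Ng.card + Ps.card := by
    refine (Finset.card_le_card ?_).trans (Finset.card_union_le Ng Ps)
    intro i hi
    rw [mem_coordSupport] at hi
    rcases lt_or_gt_of_ne hi with h1 | h1 <;> simp [hNg, hPs, h1]
  rw [hM, hN] at hlow hupv hupn
  rcases hs with hs | ⟨hs1, hs⟩
  · left
    have := le_six_of_vertex_count ha hb (by omega) hupn
      (ht.imp id fun h => h.2) hs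
    omega
  · rcases ht with ht | ⟨ht1, ht⟩
    · left
      have := le_six_of_vertex_count ha hb hlow hupv (Or.inr hs) ht
      omega
    · right
      omega

lemma isTame_faceSupports_of_hyperplane (hα : ∀ y, y ∈ W ↔ ∑ i, α i * y i = 0) {v : ι → ℝ}
    {c : ℕ} (hc : (coordSupport α).card ≤ c ∨ (coordSupport v).card ≤ c) :
    IsTame c (faceSupports W v) := by
  let col : (ι → ℝ) → ι → Fin 3 := fun w i => if 0 < w i then 0 else if w i < 0 then 1 else 2
  have hcol : ∀ w i j, col w i = col w j → ((0 < w i ↔ 0 < w j) ∧ (w i < 0 ↔ w j < 0)) := by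
    intro w i j hij
    simp only [col] at hij
    split_ifs at hij <;> first
      | exact absurd hij (by decide)
      | (refine ⟨⟨fun _ => ?_, fun _ => ?_⟩, fun _ => ?_, fun _ => ?_⟩ <;> first
          | assumption
          | linarith)
  -- in both cases one vector is supported in the exceptional set and the other gives the colours
  have key : ∀ E : Finset ι, ∀ w : ι → ℝ, (∀ i ∉ E, α i = 0 ∨ w = α) →
      (∀ i ∉ E, v i = 0 ∨ w = v) → ∀ σ τ : Finset ι, σ ∩ E = τ ∩ E →
      (∀ k, (∃ i ∈ σ, i ∉ E ∧ col w i = k) ↔ ∃ i ∈ τ, i ∉ E ∧ col w i = k) →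
      (∀ k, (∃ i ∉ σ, i ∉ E ∧ col w i = k) ↔ ∃ i ∉ τ, i ∉ E ∧ col w i = k) →
      (σ ∈ faceSupports W v ↔ τ ∈ faceSupports W v) := by
    intro E w h1 h2 σ τ hE hin hout
    have hEi : ∀ i ∈ E, i ∈ σ ↔ i ∈ τ := by
      intro i hi
      have := Finset.ext_iff.1 hE i
      simpa [hi] using this
    have htrans : ∀ σ τ : Finset ι, (∀ i ∈ E, i ∈ σ → i ∈ τ) →
        (∀ k, (∃ i ∈ σ, i ∉ E ∧ col w i = k) → ∃ i ∈ τ, i ∉ E ∧ col w i = k) →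
        ∀ p : ι → Prop, (∀ i j, i ∉ E → j ∉ E → col w i = col w j → p i → p j) →
        (∃ i ∈ σ, p i) → ∃ i ∈ τ, p i := by
      rintro σ τ hE hcols p hp ⟨i, hi, hpi⟩
      by_cases hiE : i ∈ E
      · exact ⟨i, hE i hiE hi, hpi⟩
      · obtain ⟨j, hj, hjE, hjc⟩ := hcols _ ⟨i, hi, hiE, rfl⟩
        exact ⟨j, hj, hp i j hiE hjE hjc.symm hpi⟩
    have hresp : ∀ u : ι → ℝ, (∀ i ∉ E, u i = 0 ∨ w = u) →
        (∀ i j, i ∉ E → j ∉ E → col w i = col w j → 0 < u i → 0 < u j) ∧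
        (∀ i j, i ∉ E → j ∉ E → col w i = col w j → u i < 0 → u j < 0) := by
      intro u hu
      constructor
      · intro i j hi hj hij hpos
        rcases hu i hi with h | rfl
        · exact absurd h hpos.ne'
        · exact (hcol w i j hij).1.1 hpos
      · intro i j hi hj hij hneg
        rcases hu i hi with h | rfl
        · exact absurd h hneg.ne
        · exact (hcol w i j hij).2.1 hneg
    have hiff : ∀ p : ι → Prop, (∀ i j, i ∉ E → j ∉ E → col w i = col w j → p i → p j) →
        ((∃ i ∈ σ, p i) ↔ ∃ i ∈ τ, p i) := fun p hp =>
      ⟨htrans σ τ (fun i hi => (hEi i hi).1) (fun k => (hin k).1) p hp,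
        htrans τ σ (fun i hi => (hEi i hi).2) (fun k => (hin k).2) p hp⟩
    have hiffc : ∀ p : ι → Prop, (∀ i j, i ∉ E → j ∉ E → col w i = col w j → p i → p j) →
        ((∃ i ∈ σᶜ, p i) ↔ ∃ i ∈ τᶜ, p i) := fun p hp =>
      ⟨htrans σᶜ τᶜ (fun i hi h => Finset.mem_compl.2 (mt (hEi i hi).2 (Finset.mem_compl.1 h)))
          (fun k => by simpa using (hout k).1) p hp,
        htrans τᶜ σᶜ (fun i hi h => Finset.mem_compl.2 (mt (hEi i hi).1 (Finset.mem_compl.1 h)))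
          (fun k => by simpa using (hout k).2) p hp⟩
    change IsSupport W σ ∧ SignBalanced v σᶜ ↔ IsSupport W τ ∧ SignBalanced v τᶜ
    rw [isSupport_iff_signBalanced hα, isSupport_iff_signBalanced hα, signBalanced_iff,
      signBalanced_iff, signBalanced_iff, signBalanced_iff, hiff _ (hresp α h1).1,
      hiff _ (hresp α h1).2, hiffc _ (hresp v h2).1, hiffc _ (hresp v h2).2]
  rcases hc with hc | hc
  · refine ⟨coordSupport α, col v, hc, key _ v (fun i hi => Or.inl ?_) fun i _ => Or.inr rfl⟩
    simpa using hi
  · refine ⟨coordSupport v, col α, hc, key _ α (fun i _ => Or.inr rfl) fun i hi => Or.inl ?_⟩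
    simpa using hi

end Hyperplane

/-! ### Sections of codimension two -/

section CodimTwo

variable {ι : Type*} [Fintype ι] {W : Submodule ℝ (ι → ℝ)}

/-- The coordinate subspace of the vectors supported in `U`. -/
def coordSubspace {ι : Type*} (U : Finset ι) : Submodule ℝ (ι → ℝ) where
  carrier := {y | ∀ i ∉ U, y i = 0}
  add_mem' := fun ha hb i hi => by simp [ha i hi, hb i hi]
  zero_mem' := fun _ _ => rfl
  smul_mem' := fun c _ ha i hi => by simp [ha i hi]

lemma finrank_coordSubspace (U : Finset ι) : Module.finrank ℝ (coordSubspace U) = U.card := by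
  classical
  have h1 : coordSubspace U =
      ⨅ i ∈ ((Uᶜ : Finset ι) : Set ι), LinearMap.ker (LinearMap.proj i : (ι → ℝ) →ₗ[ℝ] ℝ) := by
    ext y
    simp [coordSubspace, Submodule.mem_iInf]
  have e := LinearMap.iInfKerProjEquiv ℝ (fun _ : ι => ℝ) (I := (U : Set ι))
    (J := ((Uᶜ : Finset ι) : Set ι)) (by
      rw [Finset.disjoint_coe]
      exact disjoint_compl_right) (by
      intro i _
      simp)
  rw [h1, e.finrank_eq]
  simp

/-- Count of the circuits inside a support `U`: they span the vectors of `W` supported in `U`. -/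
lemma finrank_add_card_le {U : Finset ι} (hU : IsSupport W U) :
    Module.finrank ℝ W + U.card ≤ {C | IsCircuit W C ∧ C ⊆ U}.ncard + Fintype.card ι := by
  classical
  obtain ⟨z, hz⟩ := exists_circuit_vectors W
  obtain ⟨y, hy, hy0, hys⟩ := hU
  have hle : W ⊓ coordSubspace U ≤ Submodule.span ℝ (z '' {C | IsCircuit W C ∧ C ⊆ U}) := by
    have hmem : ∀ w ∈ W, 0 ≤ w → coordSupport w ⊆ U →
        w ∈ Submodule.span ℝ (z '' {C | IsCircuit W C ∧ C ⊆ U}) := fun w hw hw0 hws =>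
      Submodule.span_mono (Set.image_mono fun C (hC : IsCircuit W C ∧ _) =>
        show IsCircuit W C ∧ _ from ⟨hC.1, hC.2.trans hws⟩) (mem_span_circuits hz hw hw0)
    rintro w ⟨hw, hwU⟩
    have hwU : ∀ i ∉ U, w i = 0 := hwU
    have hoff : ∀ i, y i = 0 → w i = 0 := fun i hi =>
      hwU i (by rw [← hys, mem_coordSupport]; simpa using hi)
    obtain ⟨t, ht, hnn⟩ := exists_pos_add_smul_nonneg (z := w) hy0 fun i hi => (hoff i hi).ge
    have h1 := hmem y hy hy0 hys.le
    have h2 := hmem _ (W.add_mem hy (W.smul_mem t hw)) hnn (by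
      intro i hi
      rw [← hys, mem_coordSupport]
      intro hi0
      rw [mem_coordSupport] at hi
      exact hi (by simp [hi0, hoff i hi0]))
    have h3 := Submodule.smul_mem _ t⁻¹ (Submodule.sub_mem _ h2 h1)
    rwa [add_sub_cancel_left, smul_smul, inv_mul_cancel₀ ht.ne', one_smul] at h3
  have h1 := Submodule.finrank_mono hle
  have h2 : Module.finrank ℝ (Submodule.span ℝ (z '' {C | IsCircuit W C ∧ C ⊆ U})) ≤
      {C | IsCircuit W C ∧ C ⊆ U}.ncard := by
    have hfin : {C | IsCircuit W C ∧ C ⊆ U}.Finite := Set.toFinite _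
    have : z '' {C | IsCircuit W C ∧ C ⊆ U} = (hfin.toFinset.image z : Finset _) := by
      rw [Finset.coe_image, hfin.coe_toFinset]
    rw [this]
    refine (finrank_span_finset_le_card _).trans (Finset.card_image_le.trans ?_)
    rw [Set.ncard_eq_toFinset_card _ hfin]
  have h3 := Submodule.finrank_sup_add_finrank_inf_eq W (coordSubspace U)
  have h4 : Module.finrank ℝ (W ⊔ coordSubspace U : Submodule ℝ (ι → ℝ)) ≤ Fintype.card ι := by
    simpa using Submodule.finrank_le (W ⊔ coordSubspace U)
  rw [finrank_coordSubspace] at h3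
  omega

lemma exists_isCircuit_mem (hirr : Irredundant W) (hcard : 2 ≤ Fintype.card ι) (i : ι) :
    ∃ C, IsCircuit W C ∧ i ∈ C := by
  classical
  have : Nontrivial ι := Fintype.one_lt_card_iff_nontrivial.1 hcard
  obtain ⟨j, hj⟩ := exists_ne i
  obtain ⟨y, hy, hy0, hyj⟩ := hirr j
  obtain ⟨z, hz⟩ := exists_circuit_vectors W
  by_contra! hc
  have hle : Submodule.span ℝ (z '' {C | IsCircuit W C ∧ C ⊆ coordSupport y}) ≤
      LinearMap.ker (LinearMap.proj i : (ι → ℝ) →ₗ[ℝ] ℝ) := by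
    refine Submodule.span_le.2 ?_
    rintro _ ⟨C, hC, rfl⟩
    have h1 := hc C hC.1
    rw [← (hz C hC.1).2.2, mem_coordSupport, not_not] at h1
    exact h1
  exact hj ((hyj i).1 (hle (mem_span_circuits hz hy hy0))).symm

variable [DecidableEq ι]

lemma Irredundant.isSupport_compl (hirr : Irredundant W) (i : ι) : IsSupport W {i}ᶜ := by
  obtain ⟨y, hy, hy0, hyi⟩ := hirr i
  refine ⟨y, hy, hy0, ?_⟩
  ext j
  simp [hyi]

lemma IsSupport.union {σ τ : Finset ι} (hσ : IsSupport W σ) (hτ : IsSupport W τ) :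
    IsSupport W (σ ∪ τ) := by
  obtain ⟨y, hy, hy0, rfl⟩ := hσ
  obtain ⟨z, hz, hz0, rfl⟩ := hτ
  refine ⟨y + z, W.add_mem hy hz, add_nonneg hy0 hz0, ?_⟩
  ext i
  rw [Finset.mem_union, mem_coordSupport, mem_coordSupport, mem_coordSupport, Pi.add_apply, Ne,
    add_eq_zero_iff_of_nonneg (hy0 i) (hz0 i)]
  tauto

/-- In codimension two, if there is only one circuit more than there are coordinates, then all but
boundedly many coordinates are circuits by themselves. Each coordinate lies in at most four
circuits and each circuit has at most three elements; so otherwise there are three circuits far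
apart. Any further circuit in their union would meet two of them, so the union contains only these
three, which is less than the number required by counting dimensions. -/
lemma card_not_isCircuit_singleton_le (hirr : Irredundant W)
    (hrank : Module.finrank ℝ W + 2 = Fintype.card ι)
    (hcard : {C | IsCircuit W C}.ncard = Fintype.card ι + 1) :
    {i | ¬IsCircuit W {i}}.ncard ≤ 864 := by
  classical
  have hsize : ∀ C, IsCircuit W C → C.card ≤ 3 := by
    intro C hC
    have h1 := finrank_add_card_le hC.1.1
    have h2 : {D | IsCircuit W D ∧ D ⊆ C} ⊆ {C} := by
      rintro D ⟨hD, hDC⟩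
      exact hDC.antisymm (hC.2 hD.1 hDC)
    have h3 := Set.ncard_le_ncard h2
    rw [Set.ncard_singleton] at h3
    omega
  have hdeg : ∀ i, (Finset.univ.filter fun C => IsCircuit W C ∧ i ∈ C).card ≤ 4 := by
    intro i
    have h1 := finrank_add_card_le (hirr.isSupport_compl i)
    rw [Finset.card_compl, Finset.card_singleton] at h1
    have hsc : ∀ C : Finset ι, C ⊆ {i}ᶜ ↔ i ∉ C := fun C =>
      ⟨fun h hi => by simpa using h hi, fun h j hj => by
        rw [Finset.mem_compl, Finset.mem_singleton]
        rintro rfl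
        exact h hj⟩
    have h2 : {C | IsCircuit W C} = {C | IsCircuit W C ∧ C ⊆ {i}ᶜ} ∪
        ((Finset.univ.filter fun C => IsCircuit W C ∧ i ∈ C : Finset (Finset ι)) :
          Set (Finset ι)) := by
      ext C
      simp only [Set.mem_ofPred_eq, Set.mem_union, Finset.mem_coe, Finset.mem_filter,
        Finset.mem_univ, true_and, hsc]
      tauto
    have h3 : Disjoint {C | IsCircuit W C ∧ C ⊆ {i}ᶜ}
        ((Finset.univ.filter fun C => IsCircuit W C ∧ i ∈ C : Finset (Finset ι)) :
          Set (Finset ι)) := by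
      rw [Set.disjoint_left]
      rintro C ⟨-, hC⟩ hC'
      rw [hsc] at hC
      exact hC (by simpa using hC' : IsCircuit W C ∧ i ∈ C).2
    rw [h2, Set.ncard_union_eq h3 (Set.toFinite _) (Set.toFinite _), Set.ncard_coe_finset] at hcard
    have : 0 < Fintype.card ι := Fintype.card_pos_iff.2 ⟨i⟩
    omega
  -- the neighbourhood of `X` has at most `4 * 3 = 12` elements for each element of `X`, so the
  -- second neighbourhood of a circuit has at most `3 * 12 * 12 = 432`; the bound is twice that
  let nb : Finset ι → Finset ι := fun X =>
    X.biUnion fun x => (Finset.univ.filter fun C => IsCircuit W C ∧ x ∈ C).biUnion id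
  have hnb : ∀ X C, IsCircuit W C → ∀ x ∈ X, x ∈ C → C ⊆ nb X := by
    intro X C hC x hx hxC i hi
    simp only [nb, Finset.mem_biUnion, Finset.mem_filter, Finset.mem_univ, true_and, id]
    exact ⟨x, hx, C, ⟨hC, hxC⟩, hi⟩
  have hnbcard : ∀ X, (nb X).card ≤ X.card * 12 := by
    intro X
    refine Finset.card_biUnion_le_card_mul _ _ _ fun x _ => ?_
    refine (Finset.card_biUnion_le_card_mul _ _ 3 fun C hC => ?_).trans
      (Nat.mul_le_mul_right 3 (hdeg x))
    exact hsize C (Finset.mem_filter.1 hC).2.1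
  have hnb2 : ∀ C, IsCircuit W C → (nb (nb C)).card ≤ 432 := by
    intro C hC
    have h1 := hnbcard (nb C)
    have h2 := hnbcard C
    have h3 := hsize C hC
    omega
  set I : Finset ι := Finset.univ.filter fun i => ¬IsCircuit W {i} with hI
  have hIset : {i | ¬IsCircuit W {i}} = (I : Set ι) := by
    ext i
    simp [hI]
  rw [hIset, Set.ncard_coe_finset]
  by_contra! hlt
  -- circuits with a point outside the second neighbourhood of `C` share no neighbour with `C`
  have hfar : ∀ C D : Finset ι, IsCircuit W D → (∃ i ∈ D, i ∉ nb (nb C)) →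
      ∀ G, IsCircuit W G → (∃ x ∈ G, x ∈ C) → ∀ x ∈ G, x ∉ D := by
    rintro C D hD ⟨i, hiD, hi⟩ G hG ⟨x, hxG, hxC⟩ x' hx' hx'D
    exact hi (hnb (nb C) D hD x' (hnb C G hG x hxC hxG hx') hx'D hiD)
  have hbig : ∀ C, IsCircuit W C → (∃ i ∈ C, i ∈ I) → 2 ≤ C.card := by
    rintro C hC ⟨i, hiC, hiI⟩
    by_contra! h
    have h1 : C.card ≤ 1 := by omega
    have h2 : C = {i} := Finset.eq_singleton_iff_unique_mem.2
      ⟨hiC, fun j hj => Finset.card_le_one.1 h1 j hj i hiC⟩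
    rw [hI, Finset.mem_filter] at hiI
    exact hiI.2 (h2 ▸ hC)
  have hpick : ∀ M : Finset ι, M.card ≤ 864 → ∃ i ∈ I, i ∉ M := by
    intro M hM
    by_contra! hc
    have := Finset.card_le_card (show I ⊆ M from hc)
    omega
  have hex := fun i => exists_isCircuit_mem hirr (by omega : 2 ≤ Fintype.card ι) i
  obtain ⟨i₁, hi₁, -⟩ := hpick ∅ (by simp)
  obtain ⟨C₁, hC₁, hiC₁⟩ := hex i₁
  have hc₁ := hnb2 C₁ hC₁
  obtain ⟨i₂, hi₂, hn₂⟩ := hpick (nb (nb C₁)) (by omega)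
  obtain ⟨C₂, hC₂, hiC₂⟩ := hex i₂
  have hc₂ := hnb2 C₂ hC₂
  obtain ⟨i₃, hi₃, hn₃⟩ := hpick (nb (nb C₁) ∪ nb (nb C₂))
    ((Finset.card_union_le _ _).trans (by omega))
  rw [Finset.mem_union, not_or] at hn₃
  obtain ⟨C₃, hC₃, hiC₃⟩ := hex i₃
  have h12 := hfar C₁ C₂ hC₂ ⟨i₂, hiC₂, hn₂⟩
  have h13 := hfar C₁ C₃ hC₃ ⟨i₃, hiC₃, hn₃.1⟩
  have h23 := hfar C₂ C₃ hC₃ ⟨i₃, hiC₃, hn₃.2⟩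
  have d12 : Disjoint C₁ C₂ := Finset.disjoint_left.2 fun x hx =>
    h12 C₁ hC₁ ⟨i₁, hiC₁, hiC₁⟩ x hx
  have d13 : Disjoint C₁ C₃ := Finset.disjoint_left.2 fun x hx =>
    h13 C₁ hC₁ ⟨i₁, hiC₁, hiC₁⟩ x hx
  have d23 : Disjoint C₂ C₃ := Finset.disjoint_left.2 fun x hx =>
    h23 C₂ hC₂ ⟨i₂, hiC₂, hiC₂⟩ x hx
  have hU := finrank_add_card_le ((hC₁.1.1.union hC₂.1.1).union hC₃.1.1)
  rw [Finset.card_union_of_disjoint (Finset.disjoint_union_left.2 ⟨d13, d23⟩),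
    Finset.card_union_of_disjoint d12] at hU
  have hsub : {C | IsCircuit W C ∧ C ⊆ C₁ ∪ C₂ ∪ C₃} ⊆ {C₁, C₂, C₃} := by
    rintro C ⟨hC, hCU⟩
    have hmem : ∀ x ∈ C, x ∈ C₁ ∨ x ∈ C₂ ∨ x ∈ C₃ := fun x hx => by
      simpa [or_assoc] using hCU hx
    obtain ⟨x, hx⟩ := hC.1.2
    by_cases m1 : ∃ x ∈ C, x ∈ C₁
    · left
      have h1 : C ⊆ C₁ := fun y hy => by
        rcases hmem y hy with h | h | h
        · exact h
        · exact absurd h (h12 C hC m1 y hy)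
        · exact absurd h (h13 C hC m1 y hy)
      exact h1.antisymm (hC₁.2 hC.1 h1)
    · push Not at m1
      by_cases m2 : ∃ x ∈ C, x ∈ C₂
      · right; left
        have h1 : C ⊆ C₂ := fun y hy => by
          rcases hmem y hy with h | h | h
          · exact absurd h (m1 y hy)
          · exact h
          · exact absurd h (h23 C hC m2 y hy)
        exact h1.antisymm (hC₂.2 hC.1 h1)
      · push Not at m2
        right; right
        have h1 : C ⊆ C₃ := fun y hy => by
          rcases hmem y hy with h | h | h
          · exact absurd h (m1 y hy)
          · exact absurd h (m2 y hy)
          · exact h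
        exact h1.antisymm (hC₃.2 hC.1 h1)
  have h3 : ({C₁, C₂, C₃} : Set (Finset ι)).ncard ≤ 3 := by
    refine (Set.ncard_insert_le _ _).trans ?_
    have := Set.ncard_insert_le C₂ {C₃}
    rw [Set.ncard_singleton] at this
    omega
  have h4 := Set.ncard_le_ncard hsub (Set.toFinite _)
  have b1 := hbig C₁ hC₁ ⟨i₁, hiC₁, hi₁⟩
  have b2 := hbig C₂ hC₂ ⟨i₂, hiC₂, hi₂⟩
  have b3 := hbig C₃ hC₃ ⟨i₃, hiC₃, hi₃⟩
  omega

/-- Coordinates that are circuits by themselves do not matter for being a support. -/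
lemma isTame_faceSupports_zero {c : ℕ} (hc : {i | ¬IsCircuit W {i}}.ncard ≤ c) :
    IsTame c (faceSupports W 0) := by
  classical
  set I : Finset ι := Finset.univ.filter fun i => ¬IsCircuit W {i} with hI
  have hIset : {i | ¬IsCircuit W {i}} = (I : Set ι) := by
    ext i
    simp [hI]
  rw [hIset, Set.ncard_coe_finset] at hc
  have hb : ∀ Z : Finset ι, SignBalanced (0 : ι → ℝ) Z := fun Z => Or.inl fun i _ => rfl
  have hsingle : ∀ i ∉ I, Pi.single i (1 : ℝ) ∈ W := by
    intro i hi
    have hC : IsCircuit W {i} := by simpa [hI] using hi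
    obtain ⟨y, hy, hy0, hys⟩ := hC.1.1
    have hyi : y i ≠ 0 := by
      rw [← mem_coordSupport, hys]
      simp
    have : (y i)⁻¹ • y = Pi.single i (1 : ℝ) := by
      ext j
      by_cases hj : j = i
      · subst hj
        simp [hyi]
      · have : y j = 0 := by
          by_contra h
          rw [← Ne, ← mem_coordSupport, hys, Finset.mem_singleton] at h
          exact hj h
        simp [this, hj]
    rw [← this]
    exact W.smul_mem _ hy
  have key : ∀ σ τ : Finset ι, σ ∩ I = τ ∩ I → IsSupport W σ → IsSupport W τ := by
    rintro σ τ hst ⟨y, hy, hy0, hys⟩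
    refine ⟨y + ∑ i ∈ Iᶜ, ((if i ∈ τ then 1 else 0) - y i) • Pi.single i (1 : ℝ),
      W.add_mem hy (W.sum_mem fun i hi => W.smul_mem _ (hsingle i (Finset.mem_compl.1 hi))), ?_⟩
    set w := y + ∑ i ∈ Iᶜ, ((if i ∈ τ then 1 else 0) - y i) • (Pi.single i (1 : ℝ) : ι → ℝ)
    have hw1 : ∀ j ∈ I, w j = y j := by
      intro j hj
      simp only [w, Pi.add_apply, Finset.sum_apply, Pi.smul_apply]
      rw [Finset.sum_eq_zero, add_zero]
      intro i hi
      have : j ≠ i := by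
        rintro rfl
        exact Finset.mem_compl.1 hi hj
      simp [this]
    have hw2 : ∀ j ∉ I, w j = if j ∈ τ then 1 else 0 := by
      intro j hj
      simp only [w, Pi.add_apply, Finset.sum_apply, Pi.smul_apply]
      rw [Finset.sum_eq_single j]
      · simp
      · intro i _ hij
        simp [hij.symm]
      · intro h
        exact absurd (Finset.mem_compl.2 hj) h
    have hmem : ∀ j ∈ I, j ∈ σ ↔ j ∈ τ := fun j hj => by
      have := Finset.ext_iff.1 hst j
      simpa [hj] using this
    constructor
    · intro j
      by_cases hj : j ∈ I
      · rw [hw1 j hj]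
        exact hy0 j
      · rw [hw2 j hj]
        split_ifs <;> simp
    · ext j
      rw [mem_coordSupport]
      by_cases hj : j ∈ I
      · rw [hw1 j hj, ← hmem j hj, ← hys, mem_coordSupport]
      · rw [hw2 j hj]
        simp
  refine ⟨I, fun _ => 0, hc, fun σ τ hst _ _ => ?_⟩
  change IsSupport W σ ∧ _ ↔ IsSupport W τ ∧ _
  exact and_congr ⟨key σ τ hst, key τ σ hst.symm⟩ ⟨fun _ => hb _, fun _ => hb _⟩

end CodimTwo

/-! ### Counting tame families -/

section Counting

/-- The family of sets cut out by a condition `R` on the labels occurring in a set and in its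
complement. -/
def labelFamily {ι Λ : Type*} [Fintype ι] [DecidableEq ι] [DecidableEq Λ] (lab : ι → Λ)
    (R : Set (Finset Λ × Finset Λ)) : Set (Finset ι) :=
  {σ | (σ.image lab, σᶜ.image lab) ∈ R}

/-- Up to isomorphism a label family depends only on how often each label is used. -/
lemma labelFamily_orderIso {ι Λ : Type*} [Fintype ι] [DecidableEq ι] [DecidableEq Λ]
    {lab lab' : ι → Λ}
    (hcard : ∀ x, Fintype.card {i // lab i = x} = Fintype.card {i // lab' i = x})
    (R : Set (Finset Λ × Finset Λ)) :
    Nonempty (labelFamily lab R ≃o labelFamily lab' R) := by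
  let e : ∀ x, {i // lab i = x} ≃ {i // lab' i = x} := fun x => Fintype.equivOfCardEq (hcard x)
  let π : ι ≃ ι := ((Equiv.sigmaFiberEquiv lab).symm.trans (Equiv.sigmaCongrRight e)).trans
    (Equiv.sigmaFiberEquiv lab')
  have hπ : ∀ i, lab' (π i) = lab i := fun i => (e (lab i) ⟨i, rfl⟩).2
  have himg : ∀ σ : Finset ι, (σ.map π.toEmbedding).image lab' = σ.image lab := by
    intro σ
    rw [Finset.map_eq_image, Finset.image_image]
    exact Finset.image_congr fun i _ => hπ i
  have hmem : ∀ σ : Finset ι, σ ∈ labelFamily lab R ↔ σ.map π.toEmbedding ∈ labelFamily lab' R := by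
    intro σ
    have hc : (σ.map π.toEmbedding)ᶜ = σᶜ.map π.toEmbedding := by
      ext x
      simp
    change _ ∈ R ↔ _ ∈ R
    rw [hc, himg, himg]
  refine ⟨⟨(Equiv.finsetCongr π).subtypeEquiv fun σ => ?_, ?_⟩⟩
  · rw [hmem σ]
    rfl
  · rintro ⟨σ, hσ⟩ ⟨τ, hτ⟩
    change σ.map π.toEmbedding ⊆ τ.map π.toEmbedding ↔ σ ⊆ τ
    exact Finset.map_subset_map

/-- A tame family is a label family in which all labels but three are used at most once. -/
lemma IsTame.exists_label {ι : Type*} [Fintype ι] [DecidableEq ι] {c : ℕ} {S : Set (Finset ι)}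
    (hS : IsTame c S) : ∃ (lab : ι → Fin c ⊕ Fin 3)
      (R : Set (Finset (Fin c ⊕ Fin 3) × Finset (Fin c ⊕ Fin 3))),
      (∀ i j x, lab i = Sum.inl x → lab j = Sum.inl x → i = j) ∧ S = labelFamily lab R := by
  obtain ⟨E, col, hE, h⟩ := hS
  obtain ⟨f⟩ : Nonempty (E ↪ Fin c) := by
    apply Function.Embedding.nonempty_of_card_le
    simpa using hE
  let lab : ι → Fin c ⊕ Fin 3 := fun i =>
    if hi : i ∈ E then Sum.inl (f ⟨i, hi⟩) else Sum.inr (col i)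
  have hlab1 : ∀ i (hi : i ∈ E), lab i = Sum.inl (f ⟨i, hi⟩) := fun i hi => dif_pos hi
  have hlab2 : ∀ i, i ∉ E → lab i = Sum.inr (col i) := fun i hi => dif_neg hi
  have hinv1 : ∀ i x, lab i = Sum.inl x → ∃ hi : i ∈ E, f ⟨i, hi⟩ = x := by
    intro i x hix
    by_cases hi : i ∈ E
    · rw [hlab1 i hi] at hix
      exact ⟨hi, Sum.inl_injective hix⟩
    · rw [hlab2 i hi] at hix
      exact absurd hix Sum.inr_ne_inl
  have hinv2 : ∀ i k, lab i = Sum.inr k → i ∉ E ∧ col i = k := by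
    intro i k hik
    by_cases hi : i ∈ E
    · rw [hlab1 i hi] at hik
      exact absurd hik Sum.inl_ne_inr
    · rw [hlab2 i hi] at hik
      exact ⟨hi, Sum.inr_injective hik⟩
  have hinj : ∀ i j x, lab i = Sum.inl x → lab j = Sum.inl x → i = j := by
    intro i j x hi hj
    obtain ⟨hiE, hi⟩ := hinv1 i x hi
    obtain ⟨hjE, hj⟩ := hinv1 j x hj
    exact congrArg Subtype.val (f.injective (hi.trans hj.symm))
  refine ⟨lab, {p | ∃ σ ∈ S, (σ.image lab, σᶜ.image lab) = p}, hinj, ?_⟩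
  ext σ
  constructor
  · exact fun hσ => ⟨σ, hσ, rfl⟩
  · rintro ⟨τ, hτ, hp⟩
    have h1 : τ.image lab = σ.image lab := congrArg Prod.fst hp
    have h2 : τᶜ.image lab = σᶜ.image lab := congrArg Prod.snd hp
    have hcol : ∀ ρ ρ' : Finset ι, ρ.image lab = ρ'.image lab → ∀ k,
        (∃ i ∈ ρ, i ∉ E ∧ col i = k) → ∃ i ∈ ρ', i ∉ E ∧ col i = k := by
      rintro ρ ρ' hρ k ⟨i, hi, hiE, rfl⟩
      have : lab i ∈ ρ'.image lab := hρ ▸ Finset.mem_image_of_mem lab hi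
      obtain ⟨j, hj, hji⟩ := Finset.mem_image.1 this
      rw [hlab2 i hiE] at hji
      exact ⟨j, hj, hinv2 j _ hji⟩
    have hin : ∀ ρ ρ' : Finset ι, ρ.image lab = ρ'.image lab → ∀ i ∈ E, i ∈ ρ → i ∈ ρ' := by
      intro ρ ρ' hρ i hiE hi
      have : lab i ∈ ρ'.image lab := hρ ▸ Finset.mem_image_of_mem lab hi
      obtain ⟨j, hj, hji⟩ := Finset.mem_image.1 this
      have hi' := hlab1 i hiE
      rw [← hinj j i _ (hji.trans hi') hi']
      exact hj
    refine (h τ σ ?_ ?_ ?_).1 hτ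
    · ext i
      simp only [Finset.mem_inter]
      exact and_congr_left fun hi => ⟨hin τ σ h1 i hi, hin σ τ h1.symm i hi⟩
    · exact fun k => ⟨hcol τ σ h1 k, hcol σ τ h1.symm k⟩
    · intro k
      have a := hcol τᶜ σᶜ h2 k
      have b := hcol σᶜ τᶜ h2.symm k
      simp only [Finset.mem_compl] at a b
      exact ⟨a, b⟩

/-- The data that determine a label family with labels `Fin c ⊕ Fin 3` up to isomorphism: the
condition, the labels of the first kind in use, and the multiplicities of two of the colours. -/
abbrev LabelCode (c N : ℕ) : Type :=
  Set (Finset (Fin c ⊕ Fin 3) × Finset (Fin c ⊕ Fin 3)) × Set (Fin c) × Fin (N + 1) × Fin (N + 1)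

lemma card_fiber_eq {c N : ℕ} {lab lab' : Fin N → Fin c ⊕ Fin 3}
    (hinj : ∀ i j x, lab i = Sum.inl x → lab j = Sum.inl x → i = j)
    (hinj' : ∀ i j x, lab' i = Sum.inl x → lab' j = Sum.inl x → i = j)
    (hused : {x | ∃ i, lab i = Sum.inl x} = {x | ∃ i, lab' i = Sum.inl x})
    (h0 : Fintype.card {i // lab i = Sum.inr 0} = Fintype.card {i // lab' i = Sum.inr 0})
    (h1 : Fintype.card {i // lab i = Sum.inr 1} = Fintype.card {i // lab' i = Sum.inr 1})
    (x : Fin c ⊕ Fin 3) :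
    Fintype.card {i // lab i = x} = Fintype.card {i // lab' i = x} := by
  have hl : ∀ x, Fintype.card {i // lab i = Sum.inl x} =
      Fintype.card {i // lab' i = Sum.inl x} := by
    intro x
    have hs : Subsingleton {i // lab i = Sum.inl x} :=
      ⟨fun a b => Subtype.ext (hinj _ _ x a.2 b.2)⟩
    have hs' : Subsingleton {i // lab' i = Sum.inl x} :=
      ⟨fun a b => Subtype.ext (hinj' _ _ x a.2 b.2)⟩
    have hx : (∃ i, lab i = Sum.inl x) ↔ ∃ i, lab' i = Sum.inl x := Set.ext_iff.1 hused x
    apply Fintype.card_congr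
    exact ⟨fun a => ⟨_, (hx.1 ⟨a.1, a.2⟩).choose_spec⟩,
      fun a => ⟨_, (hx.2 ⟨a.1, a.2⟩).choose_spec⟩,
      fun _ => Subsingleton.elim _ _, fun _ => Subsingleton.elim _ _⟩
  have htot : ∀ lab : Fin N → Fin c ⊕ Fin 3,
      (∑ x, Fintype.card {i // lab i = Sum.inl x}) + (Fintype.card {i // lab i = Sum.inr 0} +
        Fintype.card {i // lab i = Sum.inr 1} + Fintype.card {i // lab i = Sum.inr 2}) = N := by
    intro lab
    have := Fintype.card_congr (Equiv.sigmaFiberEquiv lab)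
    rw [Fintype.card_sigma, Fintype.sum_sum_type, Fin.sum_univ_three, Fintype.card_fin] at this
    exact this
  have ht := htot lab
  have ht' := htot lab'
  rw [Finset.sum_congr rfl fun x _ => hl x] at ht
  rcases x with x | k
  · exact hl x
  · fin_cases k
    · exact h0
    · exact h1
    · change Fintype.card {i // lab i = Sum.inr 2} = Fintype.card {i // lab' i = Sum.inr 2}
      omega

/-- There are at most quadratically many combinatorial types whose face lattice is a tame family of
subsets of an `N`-element set. -/
theorem exists_bound_tame_types (c : ℕ) : ∃ K : ℕ, ∀ (N : ℕ) (X : Set Polytope.CombType),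
    (∀ t ∈ X, ∃ (P : Polytope) (S : Set (Finset (Fin N))),
      P.combType = t ∧ IsTame c S ∧ Nonempty (P.Face ≃o S)) →
    X.Finite ∧ X.ncard ≤ K * (N + 1) ^ 2 := by
  classical
  refine ⟨Nat.card (Set (Finset (Fin c ⊕ Fin 3) × Finset (Fin c ⊕ Fin 3))) *
    Nat.card (Set (Fin c)), fun N X hX => ?_⟩
  have hX' : ∀ t ∈ X, ∃ (P : Polytope) (lab : Fin N → Fin c ⊕ Fin 3)
      (R : Set (Finset (Fin c ⊕ Fin 3) × Finset (Fin c ⊕ Fin 3))), P.combType = t ∧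
      (∀ i j x, lab i = Sum.inl x → lab j = Sum.inl x → i = j) ∧
      Nonempty (P.Face ≃o labelFamily lab R) := by
    intro t ht
    obtain ⟨P, S, hP, hS, hiso⟩ := hX t ht
    obtain ⟨lab, R, hinj, rfl⟩ := hS.exists_label
    exact ⟨P, lab, R, hP, hinj, hiso⟩
  have : Nonempty Polytope := ⟨⟨0, {0}, {0}, by simp, by simp⟩⟩
  choose! P lab R hP hinj hiso using hX'
  have hlt : ∀ (t : Polytope.CombType) (k : Fin 3),
      Fintype.card {i // lab t i = Sum.inr k} < N + 1 := by
    intro t k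
    have := Fintype.card_subtype_le fun i => lab t i = Sum.inr k
    rw [Fintype.card_fin] at this
    omega
  let code : Polytope.CombType → LabelCode c N := fun t =>
    (R t, {x | ∃ i, lab t i = Sum.inl x}, ⟨_, hlt t 0⟩, ⟨_, hlt t 1⟩)
  have hcode : Set.InjOn code X := by
    intro t ht t' ht' heq
    simp only [code, Prod.mk.injEq, Fin.mk.injEq] at heq
    obtain ⟨hR, hused, h0, h1⟩ := heq
    obtain ⟨e⟩ := labelFamily_orderIso (card_fiber_eq (hinj t ht) (hinj t' ht') hused h0 h1) (R t)
    obtain ⟨f⟩ := hiso t ht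
    obtain ⟨g⟩ := hiso t' ht'
    rw [← hR] at g
    rw [← hP t ht, ← hP t' ht']
    exact Quotient.sound ⟨(f.trans e).trans g.symm⟩
  have hfin : X.Finite := Set.Finite.of_injOn (Set.mapsTo_univ code X) hcode Set.finite_univ
  refine ⟨hfin, ?_⟩
  calc X.ncard ≤ (Set.univ : Set (LabelCode c N)).ncard :=
        Set.ncard_le_ncard_of_injOn code (fun _ _ => Set.mem_univ _) hcode
    _ = _ := by
        rw [Set.ncard_univ, Nat.card_prod, Nat.card_prod, Nat.card_prod, Nat.card_fin]
        ring

end Counting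

/-! ### The upper bound -/

section Dimension

variable {ι : Type*}

/-- The directions of the subspace `W` that are collapsed by the projection. -/
def collapsed {m : ℕ} (W : Submodule ℝ (ι → ℝ)) (h : (ι → ℝ) →ₗ[ℝ] ℝ)
    (T : (ι → ℝ) →ₗ[ℝ] (Fin m → ℝ)) : Submodule ℝ (ι → ℝ) :=
  W ⊓ (LinearMap.ker h ⊓ LinearMap.ker T)

lemma mem_collapsed {m : ℕ} {W : Submodule ℝ (ι → ℝ)} {h : (ι → ℝ) →ₗ[ℝ] ℝ}
    {T : (ι → ℝ) →ₗ[ℝ] (Fin m → ℝ)} {y : ι → ℝ} :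
    y ∈ collapsed W h T ↔ y ∈ W ∧ h y = 0 ∧ T y = 0 := Iff.rfl

variable [Fintype ι]

/-- The dimension of an orthant lift is that of the image plus that of the collapsed directions;
the support condition makes the nonnegative vectors of `W` span `W`. -/
lemma finrank_eq_finrank_homSpan_add {m : ℕ} {C : Set (Fin m → ℝ)} {W : Submodule ℝ (ι → ℝ)}
    {h : (ι → ℝ) →ₗ[ℝ] ℝ} {T : (ι → ℝ) →ₗ[ℝ] (Fin m → ℝ)} (hC : IsOrthantLift C W h T)
    (hfull : IsSupport W Finset.univ) :
    Module.finrank ℝ W =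
      Module.finrank ℝ (Polytope.homSpan C) + Module.finrank ℝ (collapsed W h T) := by
  let f : W →ₗ[ℝ] (Fin m → ℝ) × ℝ := (T.prod h).domRestrict W
  have hf : ∀ y (hy : y ∈ W), f ⟨y, hy⟩ = (T y, h y) := fun y hy => rfl
  have hrange : LinearMap.range f = Polytope.homSpan C := by
    apply le_antisymm
    · have hnn : ∀ y (hy : y ∈ W), 0 ≤ y → f ⟨y, hy⟩ ∈ Polytope.homSpan C := by
        intro y hy hy0
        by_cases hne : y = 0
        · have : (⟨y, hy⟩ : W) = 0 := Subtype.ext hne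
          rw [this, map_zero]
          exact Submodule.zero_mem _
        · have hpos := hC.pos y hy hy0 hne
          have hmem : T ((h y)⁻¹ • y) ∈ C := hC.image_eq ▸ ⟨_, ⟨W.smul_mem _ hy,
            smul_nonneg (inv_nonneg.2 hpos.le) hy0, by simp [hpos.ne']⟩, rfl⟩
          have := Submodule.smul_mem _ (h y) (Polytope.mem_homSpan hmem)
          convert this using 1
          rw [hf]
          ext <;> simp [hpos.ne']
      rintro _ ⟨⟨w, hw⟩, rfl⟩
      obtain ⟨y, hy, hy0, hys⟩ := hfull
      have hyne : ∀ i, y i ≠ 0 := fun i => by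
        rw [← mem_coordSupport, hys]
        exact Finset.mem_univ i
      obtain ⟨t, ht, hnn'⟩ := exists_pos_add_smul_nonneg (z := w) hy0
        fun i hi => absurd hi (hyne i)
      have h1 := hnn y hy hy0
      have h2 := hnn _ (W.add_mem hy (W.smul_mem t hw)) hnn'
      have h3 := Submodule.smul_mem _ t⁻¹ (Submodule.sub_mem _ h2 h1)
      convert h3 using 1
      rw [hf, hf, hf]
      ext <;> simp [ht.ne']
    · refine Submodule.span_le.2 ?_
      rintro _ ⟨x, hx, rfl⟩
      rw [← hC.image_eq] at hx
      obtain ⟨y, ⟨hy, -, hy1⟩, rfl⟩ := hx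
      exact ⟨⟨y, hy⟩, by rw [hf, hy1]⟩
  have hker : (LinearMap.ker f).map W.subtype = collapsed W h T := by
    ext y
    rw [mem_collapsed]
    constructor
    · rintro ⟨⟨y, hy⟩, hk, rfl⟩
      have hk : (T y, h y) = 0 := hk
      exact ⟨hy, congrArg Prod.snd hk, congrArg Prod.fst hk⟩
    · rintro ⟨hy, h1, h2⟩
      refine ⟨⟨y, hy⟩, ?_, rfl⟩
      change (T y, h y) = 0
      rw [h1, h2]
      rfl
  have e := (Submodule.equivMapOfInjective _ W.injective_subtype (LinearMap.ker f)).finrank_eq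
  have := LinearMap.finrank_range_add_finrank_ker f
  rw [hrange, e, hker] at this
  exact this.symm

/-- If `W` is the whole space, the section of the orthant is a simplex. -/
lemma ncard_vertices_le_of_eq_top {P : Polytope} {h : (ι → ℝ) →ₗ[ℝ] ℝ}
    {T : (ι → ℝ) →ₗ[ℝ] (Fin P.n → ℝ)} (hC : IsOrthantLift P.carrier ⊤ h T) :
    P.vertices.ncard ≤ Fintype.card ι := by
  classical
  have hpos : ∀ i, 0 < h (Pi.single i 1) := fun i => hC.pos _ Submodule.mem_top
    (Pi.single_nonneg.2 zero_le_one) (by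
      intro h0
      have := congrFun h0 i
      simp at this)
  let p : ι → Fin P.n → ℝ := fun i => T ((h (Pi.single i 1))⁻¹ • Pi.single i 1)
  have hdec : ∀ y : ι → ℝ, y = ∑ i, y i • (Pi.single i 1 : ι → ℝ) := fun y => by
    ext j
    simp [Finset.sum_apply, Pi.single_apply]
  have heq : P.carrier = convexHull ℝ (Set.range p) := by
    apply Set.Subset.antisymm
    · rw [← hC.image_eq]
      rintro _ ⟨y, ⟨-, hy0, hy1⟩, rfl⟩
      have h1 : T y = ∑ i, (y i * h (Pi.single i 1)) • p i := by
        conv_lhs => rw [hdec y]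
        rw [map_sum]
        refine Finset.sum_congr rfl fun i _ => ?_
        simp only [p, map_smul, smul_smul]
        rw [mul_assoc, mul_inv_cancel₀ (hpos i).ne', mul_one]
      rw [h1]
      refine (convex_convexHull ℝ _).sum_mem (fun i _ => mul_nonneg (hy0 i) (hpos i).le) ?_
        fun i _ => subset_convexHull ℝ _ ⟨i, rfl⟩
      have h2 : h y = ∑ i, y i * h (Pi.single i 1) := by
        conv_lhs => rw [hdec y]
        simp [map_sum]
      rw [← h2, hy1]
    · refine convexHull_min ?_ P.convex_carrier
      rintro _ ⟨i, rfl⟩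
      rw [← hC.image_eq]
      exact ⟨_, ⟨Submodule.mem_top, smul_nonneg (inv_nonneg.2 (hpos i).le)
        (Pi.single_nonneg.2 zero_le_one), by simp [(hpos i).ne']⟩, rfl⟩
  have hsub : P.vertices ⊆ Set.range p := by
    intro x hx
    have hx : x ∈ P.carrier.extremePoints ℝ := hx
    rw [heq] at hx
    exact extremePoints_convexHull_subset hx
  refine (Set.ncard_le_ncard hsub (Set.finite_range p)).trans ?_
  rw [← Set.image_univ]
  refine (Set.ncard_image_le Set.finite_univ).trans ?_
  rw [Set.ncard_univ, Nat.card_eq_fintype_card]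

lemma Irredundant.isSupport_univ [DecidableEq ι] {W : Submodule ℝ (ι → ℝ)} (hirr : Irredundant W)
    (hcard : 2 ≤ Fintype.card ι) : IsSupport W Finset.univ := by
  have : Nontrivial ι := Fintype.one_lt_card_iff_nontrivial.1 hcard
  obtain ⟨i, j, hij⟩ := exists_pair_ne ι
  have := (hirr.isSupport_compl i).union (hirr.isSupport_compl j)
  convert this using 1
  ext k
  simp only [Finset.mem_univ, Finset.mem_union, Finset.mem_compl, Finset.mem_singleton, true_iff]
  by_contra! hc
  exact hij (hc.1.symm.trans hc.2)

/-- A subspace of codimension one is the orthogonal complement of a nonzero vector. -/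
lemma exists_normal {W : Submodule ℝ (ι → ℝ)}
    (hW : Module.finrank ℝ W + 1 = Fintype.card ι) :
    ∃ α : ι → ℝ, α ≠ 0 ∧ ∀ y, y ∈ W ↔ ∑ i, α i * y i = 0 := by
  classical
  have hne : W < ⊤ := by
    rw [lt_top_iff_ne_top]
    rintro rfl
    simp at hW
  obtain ⟨f, hf, hle⟩ := Submodule.exists_le_ker_of_lt_top W hne
  have hker : W = LinearMap.ker f := by
    refine Submodule.eq_of_le_of_finrank_le hle ?_
    have h1 : LinearMap.ker f < ⊤ := by
      rw [lt_top_iff_ne_top, Ne, LinearMap.ker_eq_top]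
      exact hf
    have h2 := Submodule.finrank_lt h1.ne
    rw [Module.finrank_fintype_fun_eq_card] at h2
    omega
  have hfy : ∀ y, f y = ∑ i, f (Pi.single i 1) * y i := by
    intro y
    rw [LinearMap.pi_apply_eq_sum_univ f y]
    refine Finset.sum_congr rfl fun i _ => ?_
    rw [smul_eq_mul, mul_comm]
    congr 2
    ext j
    simp [Pi.single_apply, eq_comm]
  refine ⟨fun i => f (Pi.single i 1), ?_, fun y => ?_⟩
  · intro h0
    apply hf
    ext y
    exact congrFun h0 y
  · rw [hker, LinearMap.mem_ker, hfy]

end Dimension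

namespace Polytope

/-- An irredundant orthant lift with `xc P` coordinates. -/
theorem exists_isOrthantLift_of_xc_eq {P : Polytope} (hP : P.carrier.Nontrivial) {N : ℕ}
    (hxc : P.xc = N) :
    ∃ (W : Submodule ℝ (Fin N → ℝ)) (h : (Fin N → ℝ) →ₗ[ℝ] ℝ)
      (T : (Fin N → ℝ) →ₗ[ℝ] (Fin P.n → ℝ)),
      IsOrthantLift P.carrier W h T ∧ Irredundant W := by
  have hne : {N : ℕ | ∃ (Q : Polytope) (L : (Fin Q.n → ℝ) →ₗ[ℝ] (Fin P.n → ℝ)),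
      L '' Q.carrier = P.carrier ∧ Q.facets.ncard = N}.Nonempty :=
    ⟨_, P, LinearMap.id, by simp, rfl⟩
  obtain ⟨Q, L, hL, hN⟩ := Nat.sInf_mem hne
  have hN : Q.facets.ncard = N := hN.trans hxc
  subst hN
  exact exists_isOrthantLift hP L hL

lemma nontrivial_of_ncard_vertices {P : Polytope} (h : 2 ≤ P.vertices.ncard) :
    P.carrier.Nontrivial := by
  by_contra hc
  rw [Set.not_nontrivial_iff] at hc
  have hs : P.vertices.Subsingleton := hc.anti extremePoints_subset
  have := (Set.ncard_le_one hs.finite).2 hs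
  omega

lemma finrank_homSpan_of_dim_eq {P : Polytope} {d : ℕ} (hdim : P.dim = d) :
    Module.finrank ℝ (homSpan P.carrier) = d + 1 := by
  have := finrank_homSpan P.carrier
  rw [dim] at hdim
  omega

section

variable {ι : Type*} [Fintype ι] [DecidableEq ι] {P : Polytope} {W : Submodule ℝ (ι → ℝ)}
  {h : (ι → ℝ) →ₗ[ℝ] ℝ} {T : (ι → ℝ) →ₗ[ℝ] (Fin P.n → ℝ)}

lemma face_orderIso_of_collapsed (hC : IsOrthantLift P.carrier W h T) {v : ι → ℝ}
    (hv : collapsed W h T = Submodule.span ℝ {v}) : Nonempty (P.Face ≃o faceSupports W v) :=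
  face_orderIso_faceSupports hC v fun y => by rw [← hv, mem_collapsed]

lemma ncard_vertices_of_collapsed (hC : IsOrthantLift P.carrier W h T) {v : ι → ℝ}
    (hv : collapsed W h T = Submodule.span ℝ {v}) :
    P.vertices.ncard = (minFaceSupports W v).ncard := by
  obtain ⟨e⟩ := face_orderIso_of_collapsed hC hv
  have hvm : v ∈ collapsed W h T := hv ▸ Submodule.mem_span_singleton_self v
  rw [ncard_vertices, ← ncard_atomSet_faceSupports (empty_mem_faceSupports hC.pos hvm.1 hvm.2.1),
    ← e.image_atomSet, Set.ncard_image_of_injective _ e.injective]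

end

/-- The face lattice of a `d`-polytope with `d + 4` vertices and extension complexity `d + 3` is
tame. -/
theorem exists_isTame_face {d : ℕ} {P : Polytope} (hdim : P.dim = d)
    (hvert : P.vertices.ncard = d + 4) (hxc : P.xc = d + 3) :
    ∃ S : Set (Finset (Fin (d + 3))), IsTame 864 S ∧ Nonempty (P.Face ≃o S) := by
  have hP : P.carrier.Nontrivial := nontrivial_of_ncard_vertices (by omega)
  obtain ⟨W, h, T, hlift, hirr⟩ := exists_isOrthantLift_of_xc_eq hP hxc
  have hN : Fintype.card (Fin (d + 3)) = d + 3 := Fintype.card_fin _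
  have hrank := finrank_eq_finrank_homSpan_add hlift (hirr.isSupport_univ (by omega))
  rw [finrank_homSpan_of_dim_eq hdim] at hrank
  have hle := Submodule.finrank_le W
  rw [Module.finrank_fintype_fun_eq_card, hN] at hle
  obtain hk | hk | hk : Module.finrank ℝ (collapsed W h T) = 0 ∨
      Module.finrank ℝ (collapsed W h T) = 1 ∨ Module.finrank ℝ (collapsed W h T) = 2 := by omega
  · -- the lift is `P` itself
    have hv : collapsed W h T = Submodule.span ℝ {0} := by
      rw [Submodule.finrank_eq_zero.1 hk, Submodule.span_zero_singleton]
    refine ⟨faceSupports W 0, isTame_faceSupports_zero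
      (card_not_isCircuit_singleton_le hirr (by omega) ?_), face_orderIso_of_collapsed hlift hv⟩
    have h1 := ncard_vertices_of_collapsed hlift hv
    have h2 : minFaceSupports W 0 = {C | IsCircuit W C} := by
      ext C
      exact mem_minFaceSupports_zero
    rw [← h2, ← h1, hN]
    exact hvert
  · -- the lift has one dimension more than `P`
    obtain ⟨⟨v, hvm⟩, hv0, hvs⟩ := finrank_eq_one_iff'.1 hk
    have hv : collapsed W h T = Submodule.span ℝ {v} := by
      apply le_antisymm
      · intro w hw
        obtain ⟨c, hc⟩ := hvs ⟨w, hw⟩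
        exact Submodule.mem_span_singleton.2 ⟨c, congrArg Subtype.val hc⟩
      · exact (Submodule.span_singleton_le_iff_mem _ _).2 hvm
    obtain ⟨α, hα0, hα⟩ := exists_normal (W := W) (by omega)
    have hcount := few_coordinates_of_ncard_eq hα hirr hlift.pos hvm.1 hvm.2.1
      (fun h0 => hv0 (Subtype.ext h0)) hα0
      (by rw [← ncard_vertices_of_collapsed hlift hv, hN]; exact hvert)
    exact ⟨faceSupports W v, (isTame_faceSupports_of_hyperplane hα
      (hcount.imp id fun h => h.trans (by omega))).mono (by omega),
      face_orderIso_of_collapsed hlift hv⟩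
  · -- the lift is a simplex with too few vertices
    have htop : W = ⊤ := by
      apply Submodule.eq_top_of_finrank_eq
      rw [Module.finrank_fintype_fun_eq_card, hN]
      omega
    subst htop
    have := ncard_vertices_le_of_eq_top hlift
    omega

/-- The types in question are finite in number, and at most quadratically many in `d`. -/
theorem exists_bound_ncard_typesWithXc : ∃ K : ℕ, ∀ d : ℕ,
    (typesWithXc d).Finite ∧ (typesWithXc d).ncard ≤ K * (d + 3 + 1) ^ 2 := by
  obtain ⟨K, hK⟩ := exists_bound_tame_types 864
  refine ⟨K, fun d => hK (d + 3) _ ?_⟩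
  rintro t ⟨P, hPt, hdim, hvert, hxc⟩
  obtain ⟨S, hS, hiso⟩ := exists_isTame_face hdim hvert hxc
  exact ⟨P, S, hPt, hS, hiso⟩

end Polytope

/-! ### Facets of sections, and facets and vertices of projections -/

section Section

variable {ι : Type*}

/-- The section at height one of the cone of nonnegative vectors of `W`. -/
def orthantSection (W : Submodule ℝ (ι → ℝ)) (h : (ι → ℝ) →ₗ[ℝ] ℝ) : Set (ι → ℝ) :=
  {y | y ∈ W ∧ 0 ≤ y ∧ h y = 1}

lemma convex_orthantSection (W : Submodule ℝ (ι → ℝ)) (h : (ι → ℝ) →ₗ[ℝ] ℝ) :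
    Convex ℝ (orthantSection W h) := by
  rintro y ⟨hy, hy0, hy1⟩ z ⟨hz, hz0, hz1⟩ a b ha hb hab
  exact ⟨W.add_mem (W.smul_mem a hy) (W.smul_mem b hz),
    add_nonneg (smul_nonneg ha hy0) (smul_nonneg hb hz0), by simp [hy1, hz1, hab]⟩

variable [Fintype ι]

/-- A bounded section of the orthant is a polytope: an extreme point is determined by its
support. -/
lemma exists_convexHull_eq_orthantSection {W : Submodule ℝ (ι → ℝ)} {h : (ι → ℝ) →ₗ[ℝ] ℝ}
    (hbdd : ∀ y ∈ orthantSection W h, y ≤ 1) (hne : (orthantSection W h).Nonempty) :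
    ∃ s : Finset (ι → ℝ), s.Nonempty ∧
      convexHull ℝ (s : Set (ι → ℝ)) = orthantSection W h := by
  classical
  have hclosed : IsClosed (orthantSection W h) := by
    have h1 : IsClosed (W : Set (ι → ℝ)) := W.closed_of_finiteDimensional
    have h2 : IsClosed {y : ι → ℝ | 0 ≤ y} := isClosed_Ici
    have h3 : IsClosed {y : ι → ℝ | h y = 1} :=
      isClosed_eq h.continuous_of_finiteDimensional continuous_const
    exact h1.inter (h2.inter h3)
  have hcomp : IsCompact (orthantSection W h) :=
    (isCompact_Icc (a := (0 : ι → ℝ)) (b := 1)).of_isClosed_subset hclosed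
      fun y hy => ⟨hy.2.1, hbdd y hy⟩
  have hinj : Set.InjOn coordSupport ((orthantSection W h).extremePoints ℝ) := by
    intro y hy z hz hyz
    obtain ⟨⟨hyW, hy0, hy1⟩, -⟩ := id hy
    obtain ⟨⟨hzW, hz0, hz1⟩, -⟩ := id hz
    obtain ⟨t, ht, hnn⟩ := exists_pos_add_smul_nonneg (z := y - z) hy0 (by
      intro i hi
      have : i ∉ coordSupport z := by
        rw [← hyz, mem_coordSupport]
        simpa using hi
      rw [mem_coordSupport, not_not] at this
      simp [hi, this])
    have hw : y + t • (y - z) ∈ orthantSection W h :=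
      ⟨W.add_mem hyW (W.smul_mem t (W.sub_mem hyW hzW)), hnn, by simp [hy1, hz1]⟩
    refine (hy.2 hz.1 hw ⟨t / (1 + t), 1 / (1 + t), by positivity, by positivity, ?_, ?_⟩).symm
    · field_simp
      ring
    · ext i
      simp only [Pi.add_apply, Pi.smul_apply, Pi.sub_apply, smul_eq_mul]
      field_simp
      ring
  have hfin : ((orthantSection W h).extremePoints ℝ).Finite :=
    Set.Finite.of_injOn (Set.mapsTo_univ _ _) hinj Set.finite_univ
  refine ⟨hfin.toFinset, ?_, ?_⟩
  · rw [Set.Finite.toFinset_nonempty]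
    exact hcomp.extremePoints_nonempty hne
  · rw [hfin.coe_toFinset, ← (hfin.isClosed_convexHull ℝ).closure_eq]
    exact closure_convexHull_extremePoints hcomp (convex_orthantSection W h)

end Section

namespace Polytope

/-- A polytope that is a section of the nonnegative orthant has at most as many facets as there are
coordinates: every facet is cut out by the vanishing of one coordinate. -/
lemma ncard_facets_le {Q : Polytope} {W : Submodule ℝ (Fin Q.n → ℝ)}
    {h : (Fin Q.n → ℝ) →ₗ[ℝ] ℝ} (hlift : IsOrthantLift Q.carrier W h LinearMap.id)
    (hfull : IsSupport W Finset.univ) (hQ : Q.carrier.Nontrivial) : Q.facets.ncard ≤ Q.n := by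
  have hsec : ∀ y, y ∈ Q.carrier ↔ y ∈ W ∧ 0 ≤ y ∧ h y = 1 := by
    intro y
    rw [← hlift.image_eq]
    simp
  have hsub : Q.facets ⊆ Set.range fun i : Fin Q.n => {y ∈ Q.carrier | y i = 0} := by
    intro F hF
    have hne := nonempty_of_mem_facets hQ hF
    have hmem : ∀ y ∈ Q.carrier, y ∈ F ↔ coordSupport y ⊆ faceSupport W h LinearMap.id F := by
      intro y hy
      obtain ⟨h1, h2, h3⟩ := (hsec y).1 hy
      exact mem_iff_coordSupport_subset hlift Q.convex_carrier hF.1 hne h1 h2 h3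
    have hrank := finrank_homSpan_facet hF
    obtain ⟨i, hi⟩ : ∃ i, i ∉ faceSupport W h LinearMap.id F := by
      by_contra! hc
      have : F = Q.carrier := hF.1.subset.antisymm fun y hy => (hmem y hy).2 fun i _ => hc i
      rw [this] at hrank
      omega
    refine ⟨i, ?_⟩
    set G : Set (Fin Q.n → ℝ) := {y ∈ Q.carrier | y i = 0} with hG
    have hFG : F ⊆ G := by
      intro y hy
      have hyQ := hF.1.subset hy
      refine ⟨hyQ, ?_⟩
      by_contra h0
      exact hi ((hmem y hyQ).1 hy (mem_coordSupport.2 h0))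
    have hlt : homSpan G < homSpan Q.carrier := by
      refine lt_of_le_of_ne (homSpan_mono fun y hy => hy.1) fun heq => ?_
      obtain ⟨y, hy, hy0, hys⟩ := hfull
      have hyi : y i ≠ 0 := by
        rw [← mem_coordSupport, hys]
        exact Finset.mem_univ i
      have hpos := hlift.pos y hy hy0 fun h0 => hyi (by rw [h0]; rfl)
      have hmemQ : (h y)⁻¹ • y ∈ Q.carrier := (hsec _).2
        ⟨W.smul_mem _ hy, smul_nonneg (inv_nonneg.2 hpos.le) hy0, by simp [hpos.ne']⟩
      have hker : homSpan G ≤ LinearMap.ker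
          ((LinearMap.proj i : (Fin Q.n → ℝ) →ₗ[ℝ] ℝ) ∘ₗ LinearMap.fst ℝ _ ℝ) := by
        refine Submodule.span_le.2 ?_
        rintro _ ⟨z, hz, rfl⟩
        exact hz.2
      have h0 : ((h y)⁻¹ • y) i = 0 := hker (heq ▸ mem_homSpan hmemQ)
      simp [hpos.ne', hyi] at h0
    have heq : homSpan F = homSpan G := by
      apply Submodule.eq_of_le_of_finrank_le (homSpan_mono hFG)
      have := Submodule.finrank_lt_finrank_of_lt hlt
      omega
    obtain ⟨φ, hφ, hφF⟩ := exists_form_of_isExposed hF.1 hne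
    refine Set.Subset.antisymm (fun y hy => ?_) hFG
    have hker : homSpan F ≤ LinearMap.ker φ := by
      refine Submodule.span_le.2 ?_
      rintro _ ⟨z, hz, rfl⟩
      rw [hφF] at hz
      exact hz.2
    rw [hφF]
    exact ⟨hy.1, hker (heq ▸ mem_homSpan hy)⟩
  refine (Set.ncard_le_ncard hsub (Set.finite_range _)).trans ?_
  rw [← Set.image_univ]
  refine (Set.ncard_image_le Set.finite_univ).trans ?_
  rw [Set.ncard_univ, Nat.card_eq_fintype_card, Fintype.card_fin]

end Polytope

lemma val_image_coatomSet {ι : Type*} [Fintype ι] {S : Set (Finset ι)}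
    (h1 : Finset.univ ∈ S) : Subtype.val '' coatomSet S =
      {σ | Maximal (fun σ => σ ∈ S ∧ σ ≠ Finset.univ) σ} := by
  have htop : ∀ t : S, IsTop t ↔ t.1 = Finset.univ := by
    intro t
    refine ⟨fun ht => Finset.univ_subset_iff.1 (ht ⟨Finset.univ, h1⟩), fun ht x => ?_⟩
    change x.1 ⊆ t.1
    rw [ht]
    exact Finset.subset_univ _
  ext σ
  constructor
  · rintro ⟨⟨σ, hσ⟩, ⟨t, ht, hlt, hcov⟩, rfl⟩
    rw [htop] at ht
    rw [← Subtype.coe_lt_coe, ht] at hlt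
    refine ⟨⟨hσ, hlt.ne⟩, ?_⟩
    rintro τ ⟨hτ, hτne⟩ hle
    rcases hle.eq_or_lt with h | h
    · exact h.ge
    · refine absurd ?_ (hcov (show (⟨σ, hσ⟩ : S) < ⟨τ, hτ⟩ from h))
      rw [← Subtype.coe_lt_coe, ht]
      exact lt_of_le_of_ne (Finset.subset_univ τ) hτne
  · rintro ⟨⟨hσ, hne⟩, hmax⟩
    refine ⟨⟨σ, hσ⟩, ⟨⟨Finset.univ, h1⟩, (htop _).2 rfl, ?_, ?_⟩, rfl⟩
    · exact Finset.ssubset_univ_iff.2 hne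
    · rintro ⟨τ, hτ⟩ h2 h3
      have h2 : σ ⊂ τ := h2
      have h3 : τ ⊂ Finset.univ := h3
      exact h2.2 (hmax ⟨hτ, h3.ne⟩ h2.1)

/-- The facets of an irredundant section of the orthant are among the zero sets of single
coordinates. -/
lemma ncard_coatomSet_le {ι : Type*} [Fintype ι] [DecidableEq ι] {W : Submodule ℝ (ι → ℝ)}
    (hirr : Irredundant W) (hcard : 2 ≤ Fintype.card ι) :
    (coatomSet (faceSupports W 0)).ncard ≤ Fintype.card ι := by
  have hb : ∀ Z : Finset ι, SignBalanced (0 : ι → ℝ) Z := fun Z => Or.inl fun i _ => rfl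
  have huniv : Finset.univ ∈ faceSupports W 0 := ⟨hirr.isSupport_univ hcard, hb _⟩
  rw [← Set.ncard_image_of_injective _ Subtype.val_injective, val_image_coatomSet huniv]
  have hsub : {σ | Maximal (fun σ => σ ∈ faceSupports W 0 ∧ σ ≠ Finset.univ) σ} ⊆
      Set.range fun i : ι => ({i}ᶜ : Finset ι) := by
    rintro σ ⟨⟨hσ, hne⟩, hmax⟩
    obtain ⟨i, hi⟩ : ∃ i, i ∉ σ := by
      by_contra! hc
      exact hne (Finset.eq_univ_iff_forall.2 hc)
    have hle : σ ≤ ({i}ᶜ : Finset ι) := fun j hj => by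
      rw [Finset.mem_compl, Finset.mem_singleton]
      rintro rfl
      exact hi hj
    have hne' : ({i}ᶜ : Finset ι) ≠ Finset.univ := fun h => by
      have := Finset.mem_univ i
      rw [← h] at this
      simp at this
    exact ⟨i, (hmax ⟨⟨hirr.isSupport_compl i, hb _⟩, hne'⟩ hle).antisymm hle⟩
  refine (Set.ncard_le_ncard hsub (Set.finite_range _)).trans ?_
  rw [← Set.image_univ]
  refine (Set.ncard_image_le Set.finite_univ).trans ?_
  rw [Set.ncard_univ, Nat.card_eq_fintype_card]

namespace Polytope

/-- A lift with at most `d + 2` facets of a `d`-polytope with `d + 4` vertices collapses no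
direction: otherwise it would be a simplex, with too few vertices. Hence it has the same face
lattice, so the polytope cannot have `d + 3` facets. -/
lemma le_xc_of_coatoms {d : ℕ} {P : Polytope} (hdim : P.dim = d)
    (hvert : P.vertices.ncard = d + 4) (hco : d + 3 ≤ (coatomSet P.Face).ncard) :
    d + 3 ≤ P.xc := by
  by_contra! hlt
  have hP : P.carrier.Nontrivial := nontrivial_of_ncard_vertices (by omega)
  have hd := one_le_dim hP
  obtain ⟨N, hxc⟩ : ∃ N, P.xc = N := ⟨_, rfl⟩
  rw [hxc] at hlt
  obtain ⟨W, h, T, hlift, hirr⟩ := exists_isOrthantLift_of_xc_eq hP hxc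
  have hN : Fintype.card (Fin N) = N := Fintype.card_fin _
  have hspan := finrank_homSpan_of_dim_eq hdim
  have hle : homSpan P.carrier ≤ LinearMap.range (T.prod h) := by
    refine Submodule.span_le.2 ?_
    rintro _ ⟨x, hx, rfl⟩
    rw [← hlift.image_eq] at hx
    obtain ⟨y, ⟨-, -, hy1⟩, rfl⟩ := hx
    exact ⟨y, by simp [hy1]⟩
  have h1 := (Submodule.finrank_mono hle).trans (LinearMap.finrank_range_le _)
  rw [Module.finrank_fintype_fun_eq_card, hN, hspan] at h1
  have hrank := finrank_eq_finrank_homSpan_add hlift (hirr.isSupport_univ (by omega))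
  rw [hspan] at hrank
  have hWle := Submodule.finrank_le W
  rw [Module.finrank_fintype_fun_eq_card, hN] at hWle
  rcases hWle.eq_or_lt with hW | hW
  · have htop : W = ⊤ := by
      apply Submodule.eq_top_of_finrank_eq
      rw [Module.finrank_fintype_fun_eq_card, hN, hW]
    subst htop
    have := ncard_vertices_le_of_eq_top hlift
    omega
  · have hv : collapsed W h T = Submodule.span ℝ {0} := by
      rw [Submodule.finrank_eq_zero.1 (by omega : Module.finrank ℝ (collapsed W h T) = 0),
        Submodule.span_zero_singleton]
    obtain ⟨e⟩ := face_orderIso_of_collapsed hlift hv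
    have h2 := ncard_coatomSet_le hirr (by omega)
    rw [← e.image_coatomSet, Set.ncard_image_of_injective _ e.injective] at h2
    omega

end Polytope

/-! ### Miss counts, a combinatorial invariant -/

/-- The numbers of coatoms not above a given atom, over all atoms. -/
def missCounts (X : Type*) [PartialOrder X] : Set ℕ :=
  {k | ∃ x ∈ atomSet X, {y | y ∈ coatomSet X ∧ ¬x ≤ y}.ncard = k}

lemma OrderIso.missCounts_subset {X Y : Type*} [PartialOrder X] [PartialOrder Y] (e : X ≃o Y) :
    missCounts X ⊆ missCounts Y := by
  rintro k ⟨x, hx, rfl⟩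
  refine ⟨e x, e.apply_mem_atomSet hx, ?_⟩
  rw [← Set.ncard_image_of_injective _ e.injective]
  congr 1
  ext y
  constructor
  · rintro ⟨hy, hxy⟩
    refine ⟨e.symm y, ⟨e.symm.apply_mem_coatomSet hy, fun h => hxy ?_⟩, e.apply_symm_apply y⟩
    rw [← e.apply_symm_apply y]
    exact e.monotone h
  · rintro ⟨z, ⟨hz, hxz⟩, rfl⟩
    exact ⟨e.apply_mem_coatomSet hz, fun h => hxz (e.le_iff_le.1 h)⟩

lemma OrderIso.missCounts_eq {X Y : Type*} [PartialOrder X] [PartialOrder Y] (e : X ≃o Y) :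
    missCounts X = missCounts Y :=
  e.missCounts_subset.antisymm e.symm.missCounts_subset

section Duality

variable {ι : Type*} [Fintype ι] [DecidableEq ι]

/-- If no vertex is lost in the projection, the vertices of the image are given by the circuits. -/
lemma minFaceSupports_eq {W : Submodule ℝ (ι → ℝ)} {v : ι → ℝ}
    (hall : ∀ C, IsCircuit W C → SignBalanced v Cᶜ) :
    minFaceSupports W v = {C | IsCircuit W C} := by
  ext σ
  constructor
  · intro hσ
    obtain ⟨C, hCσ, hC⟩ := exists_isCircuit_subset hσ.1.1.1 hσ.1.2
    have := hσ.2 ⟨⟨hC.1.1, hall C hC⟩, hC.1.2⟩ hCσ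
    rw [← hCσ.antisymm this]
    exact hC
  · exact fun hC => IsCircuit.mem_minFaceSupports hC (hall σ hC)

/-- Dually, the facets are the complements of the circuits of the hyperplane orthogonal to `v`, if
those complements are supports. -/
lemma maximal_faceSupports_eq {W V : Submodule ℝ (ι → ℝ)} {v : ι → ℝ}
    (hV : ∀ y, y ∈ V ↔ ∑ i, v i * y i = 0) (hall : ∀ C, IsCircuit V C → IsSupport W Cᶜ) :
    {σ | Maximal (fun σ => σ ∈ faceSupports W v ∧ σ ≠ Finset.univ) σ} =
      compl '' {C | IsCircuit V C} := by
  have hmem : ∀ C, IsCircuit V C → Cᶜ ∈ faceSupports W v ∧ Cᶜ ≠ Finset.univ := by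
    intro C hC
    refine ⟨⟨hall C hC, ?_⟩, ?_⟩
    · rw [compl_compl]
      exact (isSupport_iff_signBalanced hV).1 hC.1.1
    · rw [Ne, Finset.compl_eq_univ_iff]
      exact hC.1.2.ne_empty
  ext σ
  constructor
  · rintro ⟨⟨hσ, hne⟩, hmax⟩
    have hne' : σᶜ.Nonempty := by
      rw [Finset.nonempty_iff_ne_empty, Ne, Finset.compl_eq_empty_iff]
      exact hne
    obtain ⟨C, hCσ, hC⟩ := exists_isCircuit_subset
      ((isSupport_iff_signBalanced hV).2 hσ.2) hne'
    have hle : σ ≤ Cᶜ := Finset.subset_compl_comm.1 hCσ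
    exact ⟨C, hC, (hmax (hmem C hC) hle).antisymm hle⟩
  · rintro ⟨C, hC, rfl⟩
    refine ⟨hmem C hC, ?_⟩
    rintro σ ⟨hσ, hne⟩ hle
    have hne' : σᶜ.Nonempty := by
      rw [Finset.nonempty_iff_ne_empty, Ne, Finset.compl_eq_empty_iff]
      exact hne
    have h1 : σᶜ ≤ C := by
      have := Finset.compl_subset_compl.2 hle
      rwa [compl_compl] at this
    have h2 := hC.2 ⟨(isSupport_iff_signBalanced hV).2 hσ.2, hne'⟩ h1
    have h3 := Finset.compl_subset_compl.2 h2
    rwa [compl_compl] at h3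

/-- If `α` and `v` have disjoint supports and `v` has two entries of each sign, then removing a
circuit of the hyperplane orthogonal to `α` leaves `v` with both signs. -/
lemma IsCircuit.signBalanced_compl {W : Submodule ℝ (ι → ℝ)} {α v : ι → ℝ}
    (hα : ∀ y, y ∈ W ↔ ∑ i, α i * y i = 0) (hdisj : ∀ i, α i = 0 ∨ v i = 0)
    (hpos : 2 ≤ (Finset.univ.filter fun i => 0 < v i).card)
    (hneg : 2 ≤ (Finset.univ.filter fun i => v i < 0).card) {C : Finset ι} (hC : IsCircuit W C) :
    SignBalanced v Cᶜ := by
  have key : ∀ p : ι → Prop, [DecidablePred p] → 2 ≤ (Finset.univ.filter p).card →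
      (∀ i, p i → v i ≠ 0) → ∃ i ∈ Cᶜ, p i := by
    intro p _ hp hpv
    rcases (isCircuit_iff hα).1 hC with ⟨l, -, rfl⟩ | ⟨i, j, hi, hj, rfl⟩
    · obtain ⟨k, hk, hkl⟩ := Finset.exists_mem_ne
        (show 1 < (Finset.univ.filter p).card by omega) l
      exact ⟨k, by simpa using hkl, (Finset.mem_filter.1 hk).2⟩
    · obtain ⟨k, hk⟩ := Finset.card_pos.1 (by omega : 0 < (Finset.univ.filter p).card)
      have hk := (Finset.mem_filter.1 hk).2
      have hαk := (hdisj k).resolve_right (hpv k hk)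
      refine ⟨k, ?_, hk⟩
      simp only [Finset.mem_compl, Finset.mem_insert, Finset.mem_singleton, not_or]
      constructor <;> rintro rfl <;> linarith
  exact Or.inr ⟨key _ hpos fun i hi => hi.ne', key _ hneg fun i hi => hi.ne⟩

variable {W V : Submodule ℝ (ι → ℝ)} {α v : ι → ℝ}

/-- For the hyperplanes `W` and `V` orthogonal to vectors `α` and `v` with disjoint supports, the
atoms of `faceSupports W v` are the circuits of `W` and its coatoms the complements of the circuits
of `V`, so an atom misses the coatoms whose circuit meets it. An atom `{l}` with `v l ≠ 0` misses
as many coatoms as `v` has entries of the opposite sign; every other atom misses at most two. -/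
lemma missCounts_faceSupports (hα : ∀ y, y ∈ W ↔ ∑ i, α i * y i = 0)
    (hV : ∀ y, y ∈ V ↔ ∑ i, v i * y i = 0) (hdisj : ∀ i, α i = 0 ∨ v i = 0)
    (hαpos : 2 ≤ (Finset.univ.filter fun i => 0 < α i).card)
    (hαneg : 2 ≤ (Finset.univ.filter fun i => α i < 0).card)
    (hpos : 3 ≤ (Finset.univ.filter fun i => 0 < v i).card)
    (hneg : 3 ≤ (Finset.univ.filter fun i => v i < 0).card) :
    missCounts (faceSupports W v) ∩ {k | 3 ≤ k} =
      {(Finset.univ.filter fun i => 0 < v i).card, (Finset.univ.filter fun i => v i < 0).card} ∧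
    (coatomSet (faceSupports W v)).ncard =
      (Finset.univ.filter fun i => 0 < v i).card * (Finset.univ.filter fun i => v i < 0).card +
        (Finset.univ.filter fun i => v i = 0).card := by
  have hat : ∀ C, IsCircuit W C → SignBalanced v Cᶜ := fun C hC =>
    hC.signBalanced_compl hα hdisj (by omega) (by omega)
  have hco : ∀ C, IsCircuit V C → IsSupport W Cᶜ := fun C hC =>
    (isSupport_iff_signBalanced hα).2
      (hC.signBalanced_compl hV (fun i => (hdisj i).symm) hαpos hαneg)
  have hboth : ∀ w : ι → ℝ, 2 ≤ (Finset.univ.filter fun i => 0 < w i).card →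
      2 ≤ (Finset.univ.filter fun i => w i < 0).card → SignBalanced w Finset.univ := by
    intro w h1 h2
    obtain ⟨i, hi⟩ := Finset.card_pos.1 (by omega : 0 < (Finset.univ.filter fun i => 0 < w i).card)
    obtain ⟨j, hj⟩ := Finset.card_pos.1 (by omega : 0 < (Finset.univ.filter fun i => w i < 0).card)
    exact Or.inr ⟨⟨i, Finset.mem_univ i, (Finset.mem_filter.1 hi).2⟩,
      j, Finset.mem_univ j, (Finset.mem_filter.1 hj).2⟩
  have hempty : ∅ ∈ faceSupports W v := by
    refine ⟨⟨0, W.zero_mem, le_rfl, by ext; simp⟩, ?_⟩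
    rw [Finset.compl_empty]
    exact hboth v (by omega) (by omega)
  have huniv : Finset.univ ∈ faceSupports W v := by
    refine ⟨(isSupport_iff_signBalanced hα).2 (hboth α hαpos hαneg), ?_⟩
    rw [Finset.compl_univ]
    exact Or.inl (by simp)
  have hatoms := val_image_atomSet hempty
  change _ = minFaceSupports W v at hatoms
  rw [minFaceSupports_eq hat] at hatoms
  have hcoatoms := val_image_coatomSet huniv
  rw [maximal_faceSupports_eq hV hco] at hcoatoms
  have hmiss : ∀ x : faceSupports W v,
      {y | y ∈ coatomSet (faceSupports W v) ∧ ¬x ≤ y}.ncard =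
        {C | IsCircuit V C ∧ ∃ i ∈ x.1, i ∈ C}.ncard := by
    intro x
    rw [← Set.ncard_image_of_injective _ Subtype.val_injective,
      ← Set.ncard_image_of_injective {C | IsCircuit V C ∧ ∃ i ∈ x.1, i ∈ C}
        (compl_injective : Function.Injective (compl : Finset ι → Finset ι))]
    congr 1
    have hx : ∀ C : Finset ι, ¬x.1 ⊆ Cᶜ ↔ ∃ i ∈ x.1, i ∈ C := by
      intro C
      rw [Finset.not_subset]
      simp
    ext σ
    constructor
    · rintro ⟨y, ⟨hy, hxy⟩, rfl⟩
      have h1 : y.1 ∈ compl '' {C | IsCircuit V C} := hcoatoms ▸ ⟨y, hy, rfl⟩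
      obtain ⟨C, hC, hCy⟩ := h1
      refine ⟨C, ⟨hC, (hx C).1 ?_⟩, hCy⟩
      rw [hCy]
      exact hxy
    · rintro ⟨C, ⟨hC, hCx⟩, rfl⟩
      have h1 : Cᶜ ∈ Subtype.val '' coatomSet (faceSupports W v) := hcoatoms ▸ ⟨C, hC, rfl⟩
      obtain ⟨y, hy, hyC⟩ := h1
      refine ⟨y, ⟨hy, fun hle => (hx C).2 hCx ?_⟩, hyC⟩
      rw [← hyC]
      exact hle
  have hsingle : ∀ l, {C | IsCircuit V C ∧ ∃ i ∈ ({l} : Finset ι), i ∈ C} =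
      {C | IsCircuit V C ∧ l ∈ C} := by
    intro l
    simp
  constructor
  · ext k
    constructor
    · rintro ⟨⟨x, hx, rfl⟩, hk⟩
      have hk : 3 ≤ _ := hk
      rw [hmiss] at hk ⊢
      have hxC : IsCircuit W x.1 := by
        have : x.1 ∈ {C | IsCircuit W C} := hatoms ▸ ⟨x, hx, rfl⟩
        exact this
      rcases (isCircuit_iff hα).1 hxC with ⟨l, -, hl⟩ | ⟨i, j, hi, hj, hij⟩
      · rw [hl, hsingle] at hk ⊢
        rcases lt_trichotomy (v l) 0 with h | h | h
        · left
          exact ncard_isCircuit_mem_of_neg hV h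
        · have : {C | IsCircuit V C ∧ l ∈ C} ⊆ {{l}} := fun C hC =>
            hC.1.eq_singleton_of_mem hV h hC.2
          have := Set.ncard_le_ncard this
          rw [Set.ncard_singleton] at this
          omega
        · right
          exact ncard_isCircuit_mem_of_pos hV h
      · have hvi := (hdisj i).resolve_left hi.ne'
        have hvj := (hdisj j).resolve_left hj.ne
        have hsub : {C | IsCircuit V C ∧ ∃ i ∈ x.1, i ∈ C} ⊆ {{i}, {j}} := by
          rintro C ⟨hC, k, hk, hkC⟩
          rw [hij, Finset.mem_insert, Finset.mem_singleton] at hk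
          rcases hk with rfl | rfl
          · exact Or.inl (hC.eq_singleton_of_mem hV hvi hkC)
          · exact Or.inr (hC.eq_singleton_of_mem hV hvj hkC)
        have h1 := Set.ncard_le_ncard hsub (Set.toFinite _)
        have h2 := Set.ncard_insert_le ({i} : Finset ι) {{j}}
        rw [Set.ncard_singleton] at h2
        omega
    · have hex : ∀ l, v l ≠ 0 → ∀ k, {C | IsCircuit V C ∧ l ∈ C}.ncard = k →
          k ∈ missCounts (faceSupports W v) := by
        intro l hl k hk
        have hC : IsCircuit W {l} :=
          (isCircuit_iff hα).2 (Or.inl ⟨l, (hdisj l).resolve_right hl, rfl⟩)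
        have : ({l} : Finset ι) ∈ Subtype.val '' atomSet (faceSupports W v) := hatoms ▸ hC
        obtain ⟨x, hx, hxl⟩ := this
        refine ⟨x, hx, ?_⟩
        rw [hmiss, hxl, hsingle, hk]
      rintro (rfl | rfl)
      · obtain ⟨j, hj⟩ := Finset.card_pos.1
          (by omega : 0 < (Finset.univ.filter fun i => v i < 0).card)
        have hj := (Finset.mem_filter.1 hj).2
        exact ⟨hex j hj.ne _ (ncard_isCircuit_mem_of_neg hV hj), hpos⟩
      · obtain ⟨j, hj⟩ := Finset.card_pos.1
          (by omega : 0 < (Finset.univ.filter fun i => 0 < v i).card)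
        have hj := (Finset.mem_filter.1 hj).2
        exact ⟨hex j hj.ne' _ (ncard_isCircuit_mem_of_pos hV hj), hneg⟩
  · rw [← Set.ncard_image_of_injective _ Subtype.val_injective, hcoatoms,
      Set.ncard_image_of_injective _ compl_injective, ncard_isCircuit hV]

end Duality

/-! ### The construction -/

section Construction

/-- Vectors `α` and `v` with disjoint supports and prescribed numbers of entries of each sign. The
hyperplane orthogonal to `α` cuts out an iterated pyramid over a triangular prism, and `v` is the
direction of the projection. -/
lemma exists_sign_vectors {N p q r : ℕ} (hN : N = 5 + (p + q + r)) (hp : 0 < p) (hq : 0 < q) :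
    ∃ α v : Fin N → ℝ, (∀ i, α i = 1 ∨ α i = -1 ∨ α i = 0) ∧ (∀ i, α i = 0 ∨ v i = 0) ∧
      ∑ i, v i = 0 ∧
      (Finset.univ.filter fun i => 0 < α i).card = 2 ∧
      (Finset.univ.filter fun i => α i < 0).card = 3 ∧
      (Finset.univ.filter fun i => α i = 0).card = p + q + r ∧
      (Finset.univ.filter fun i => 0 < v i).card = p ∧
      (Finset.univ.filter fun i => v i < 0).card = q ∧
      (Finset.univ.filter fun i => v i = 0).card = 5 + r := by
  let e : Fin N ≃ (Fin 2 ⊕ Fin 3) ⊕ (Fin p ⊕ Fin q) ⊕ Fin r := Fintype.equivOfCardEq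
    (by simp; omega)
  let α₀ : (Fin 2 ⊕ Fin 3) ⊕ (Fin p ⊕ Fin q) ⊕ Fin r → ℝ :=
    Sum.elim (Sum.elim (fun _ => 1) fun _ => -1) fun _ => 0
  -- the entries `q` (taken `p` times) and `-p` (taken `q` times) of `v` sum to zero
  let v₀ : (Fin 2 ⊕ Fin 3) ⊕ (Fin p ⊕ Fin q) ⊕ Fin r → ℝ :=
    Sum.elim (fun _ => 0) (Sum.elim (Sum.elim (fun _ => (q : ℝ)) fun _ => -(p : ℝ)) fun _ => 0)
  have hcard : ∀ (P : (Fin 2 ⊕ Fin 3) ⊕ (Fin p ⊕ Fin q) ⊕ Fin r → Prop) [DecidablePred P],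
      (Finset.univ.filter fun i => P (e i)).card = ∑ x, if P x then 1 else 0 := by
    intro P _
    rw [Finset.card_filter, e.sum_comp fun x => if P x then 1 else 0]
  have hp' : (0 : ℝ) < p := by exact_mod_cast hp
  have hq' : (0 : ℝ) < q := by exact_mod_cast hq
  refine ⟨α₀ ∘ e, v₀ ∘ e, fun i => ?_, fun i => ?_, ?_, ?_, ?_, ?_, ?_, ?_, ?_⟩
  · rcases h : e i with (x | x) | x <;> simp [α₀, h]
  · rcases h : e i with x | x <;> simp [α₀, v₀, h]
  · change ∑ i, v₀ (e i) = 0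
    rw [e.sum_comp v₀]
    simp [v₀, Fintype.sum_sum_type]
    ring
  · exact (hcard fun x => 0 < α₀ x).trans (by simp [-Finset.sum_boole, α₀, Fintype.sum_sum_type])
  · exact (hcard fun x => α₀ x < 0).trans
      (by norm_num [-Finset.sum_boole, α₀, Fintype.sum_sum_type])
  · exact (hcard fun x => α₀ x = 0).trans (by simp [-Finset.sum_boole, α₀, Fintype.sum_sum_type])
  · exact (hcard fun x => 0 < v₀ x).trans
      (by simp [-Finset.sum_boole, v₀, Fintype.sum_sum_type, hq])
  · exact (hcard fun x => v₀ x < 0).trans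
      (by simp [-Finset.sum_boole, v₀, Fintype.sum_sum_type, hp, hq'.not_gt])
  · exact (hcard fun x => v₀ x = 0).trans
      (by simp [-Finset.sum_boole, v₀, Fintype.sum_sum_type, hp.ne', hq.ne'])

namespace Polytope

/-- The join of a triangular prism, a direct sum of a `(p-1)`- and a `(q-1)`-simplex, and a simplex,
obtained by projecting an iterated pyramid over the prism. -/
theorem exists_polytope {d p q : ℕ} (hp : 3 ≤ p) (hq : 3 ≤ q) (hd : p + q + 2 ≤ d) :
    ∃ P : Polytope, P.dim = d ∧ P.vertices.ncard = d + 4 ∧ P.xc = d + 3 ∧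
      missCounts P.Face ∩ {k | 3 ≤ k} = {p, q} := by
  classical
  obtain ⟨r, rfl⟩ := Nat.exists_eq_add_of_le hd
  set d := p + q + 2 + r with hd'
  set N := d + 3 with hN
  obtain ⟨α, v, hα1, hdisj, hvsum, hαp, hαn, hα0, hvp, hvn, hv0⟩ :=
    exists_sign_vectors (N := N) (p := p) (q := q) (r := r) (by omega) (by omega) (by omega)
  let form : (Fin N → ℝ) → (Fin N → ℝ) →ₗ[ℝ] ℝ := fun w => ∑ i, w i • LinearMap.proj i
  have hform : ∀ w y, form w y = ∑ i, w i * y i := fun w y => by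
    simp [form, LinearMap.sum_apply]
  let W := LinearMap.ker (form α)
  let V := LinearMap.ker (form v)
  have hW : ∀ y, y ∈ W ↔ ∑ i, α i * y i = 0 := fun y => by
    rw [← hform]
    exact LinearMap.mem_ker
  have hV : ∀ y, y ∈ V ↔ ∑ i, v i * y i = 0 := fun y => by
    rw [← hform]
    exact LinearMap.mem_ker
  -- the height is the sum of the coordinates at which `α` is not negative
  let w : Fin N → ℝ := fun i => if α i < 0 then 0 else 1
  let h := form w
  have hwv : ∀ i, w i * v i = v i := by
    intro i
    rcases hdisj i with h0 | h0
    · simp [w, h0]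
    · simp [h0]
  have hhv : h v = 0 := by
    rw [hform, ← hvsum]
    exact Finset.sum_congr rfl fun i _ => hwv i
  have hvW : v ∈ W := by
    rw [hW]
    refine Finset.sum_eq_zero fun i _ => ?_
    rcases hdisj i with h0 | h0 <;> simp [h0]
  -- on `W` both sign classes of `α` have the same coordinate sum
  have hle : ∀ y ∈ W, 0 ≤ y → ∀ i, y i ≤ h y := by
    intro y hy hy0 i
    have hw0 : ∀ j ∈ Finset.univ, 0 ≤ w j * y j := fun j _ =>
      mul_nonneg (by simp only [w]; split_ifs <;> norm_num) (hy0 j)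
    rw [hform]
    rcases lt_or_ge (α i) 0 with hi | hi
    · have h1 : ∑ j, w j * y j = ∑ j, (w j - α j) * y j := by
        rw [hW] at hy
        simp only [sub_mul, Finset.sum_sub_distrib, hy, sub_zero]
      have hw1 : ∀ j ∈ Finset.univ, 0 ≤ (w j - α j) * y j := fun j _ => by
        refine mul_nonneg ?_ (hy0 j)
        rcases hα1 j with h2 | h2 | h2 <;> norm_num [w, h2]
      have h2 : (w i - α i) * y i = y i := by
        rcases hα1 i with h2 | h2 | h2
        · rw [h2] at hi; linarith
        · simp [w, h2]
        · rw [h2] at hi; linarith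
      rw [h1, ← h2]
      exact Finset.single_le_sum hw1 (Finset.mem_univ i)
    · have h2 : w i * y i = y i := by simp [w, not_lt.2 hi]
      rw [← h2]
      exact Finset.single_le_sum hw0 (Finset.mem_univ i)
  have hpos : ∀ y ∈ W, 0 ≤ y → y ≠ 0 → 0 < h y := by
    intro y hy hy0 hne
    obtain ⟨i, hi⟩ := Function.ne_iff.1 hne
    exact (lt_of_le_of_ne (hy0 i) (Ne.symm hi)).trans_le (hle y hy hy0 i)
  have hfull : IsSupport W Finset.univ := by
    rw [isSupport_iff_signBalanced hW]
    obtain ⟨i, hi⟩ := Finset.card_pos.1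
      (by omega : 0 < (Finset.univ.filter fun i => 0 < α i).card)
    obtain ⟨j, hj⟩ := Finset.card_pos.1
      (by omega : 0 < (Finset.univ.filter fun i => α i < 0).card)
    exact Or.inr ⟨⟨i, Finset.mem_univ i, (Finset.mem_filter.1 hi).2⟩,
      j, Finset.mem_univ j, (Finset.mem_filter.1 hj).2⟩
  have hne : (orthantSection W h).Nonempty := by
    obtain ⟨y, hy, hy0, hys⟩ := hfull
    have hyne : y ≠ 0 := by
      rintro rfl
      have h1 : (⟨0, by omega⟩ : Fin N) ∈ coordSupport (0 : Fin N → ℝ) := by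
        rw [hys]; exact Finset.mem_univ _
      simp at h1
    have h1 := hpos y hy hy0 hyne
    exact ⟨(h y)⁻¹ • y, W.smul_mem _ hy, smul_nonneg (inv_nonneg.2 h1.le) hy0,
      by rw [map_smul, smul_eq_mul, inv_mul_cancel₀ h1.ne']⟩
  obtain ⟨s, hsne, hs⟩ := exists_convexHull_eq_orthantSection
    (fun y hy i => (hle y hy.1 hy.2.1 i).trans hy.2.2.le) hne
  let Q : Polytope := ⟨N, orthantSection W h, s, hsne, hs⟩
  -- project along `v`
  obtain ⟨i₀, hi₀⟩ := Finset.card_pos.1 (by omega : 0 < (Finset.univ.filter fun i => 0 < v i).card)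
  have hvi : v i₀ ≠ 0 := (Finset.mem_filter.1 hi₀).2.ne'
  let T : (Fin N → ℝ) →ₗ[ℝ] (Fin N → ℝ) :=
    LinearMap.id - (LinearMap.toSpanSingleton ℝ _ v) ∘ₗ ((v i₀)⁻¹ • LinearMap.proj i₀)
  have hT : ∀ y, T y = y - ((v i₀)⁻¹ * y i₀) • v := fun y => by
    simp [T, LinearMap.toSpanSingleton_apply]
  let P : Polytope := ⟨N, T '' orthantSection W h, s.image T, hsne.image T, by
    rw [Finset.coe_image, ← hs]
    exact (T.image_convexHull _).symm⟩
  have hlift : IsOrthantLift P.carrier W h T := ⟨hpos, rfl⟩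
  have hliftQ : IsOrthantLift Q.carrier W h (LinearMap.id : (Fin Q.n → ℝ) →ₗ[ℝ] (Fin Q.n → ℝ)) :=
    ⟨hpos, by rw [LinearMap.id_coe, Set.image_id]; rfl⟩
  have hcol : collapsed W h T = Submodule.span ℝ {v} := by
    ext y
    rw [mem_collapsed, Submodule.mem_span_singleton]
    constructor
    · rintro ⟨-, -, h0⟩
      rw [hT, sub_eq_zero] at h0
      exact ⟨_, h0.symm⟩
    · rintro ⟨c, rfl⟩
      refine ⟨W.smul_mem c hvW, by rw [map_smul, hhv, smul_zero], ?_⟩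
      rw [hT, Pi.smul_apply, smul_eq_mul, mul_comm c, ← mul_assoc, inv_mul_cancel₀ hvi, one_mul,
        sub_self]
  have hNcard : Fintype.card (Fin N) = N := Fintype.card_fin N
  have hvne : v ≠ 0 := fun h0 => hvi (by rw [h0]; rfl)
  -- the dimension
  have hdim : P.dim = d := by
    have h1 := finrank_eq_finrank_homSpan_add hlift hfull
    rw [hcol, finrank_span_singleton hvne] at h1
    have h2 := LinearMap.finrank_range_add_finrank_ker (form α)
    rw [Module.finrank_fintype_fun_eq_card, hNcard] at h2
    have h3 : LinearMap.range (form α) = ⊤ := by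
      refine LinearMap.range_eq_top.2 (LinearMap.surjective fun h0 => ?_)
      obtain ⟨i, hi⟩ := Finset.card_pos.1
        (by omega : 0 < (Finset.univ.filter fun i => 0 < α i).card)
      have h4 := LinearMap.congr_fun h0 (Pi.single i 1)
      rw [hform] at h4
      simp [Pi.single_apply] at h4
      exact (Finset.mem_filter.1 hi).2.ne' h4
    rw [h3, finrank_top, Module.finrank_self] at h2
    have h4 := finrank_homSpan P.carrier
    have h5 : Module.finrank ℝ W = Module.finrank ℝ (LinearMap.ker (form α)) := rfl
    rw [dim]
    omega
  have hvert : P.vertices.ncard = d + 4 := by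
    rw [ncard_vertices_of_collapsed hlift hcol, minFaceSupports_eq fun C hC =>
      hC.signBalanced_compl hW hdisj (by omega) (by omega), ncard_isCircuit hW, hαp, hαn, hα0]
    omega
  obtain ⟨e⟩ := face_orderIso_of_collapsed hlift hcol
  obtain ⟨hmiss, hco⟩ := missCounts_faceSupports hW hV hdisj (by omega) (by omega)
    (by omega : 3 ≤ _) (by omega : 3 ≤ _)
  rw [hvp, hvn] at hmiss
  rw [hvp, hvn, hv0] at hco
  have hxc1 : d + 3 ≤ P.xc := by
    refine le_xc_of_coatoms hdim hvert ?_
    have h1 : (coatomSet P.Face).ncard = p * q + (5 + r) := by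
      rw [← hco, ← e.image_coatomSet, Set.ncard_image_of_injective _ e.injective]
    rw [h1]
    have : p + q ≤ p * q := by nlinarith
    omega
  have hxc2 : P.xc ≤ d + 3 := by
    have hPnt : P.carrier.Nontrivial := nontrivial_of_ncard_vertices (by omega)
    have hQnt : Q.carrier.Nontrivial := by
      obtain ⟨_, ⟨x, hx, rfl⟩, _, ⟨y, hy, rfl⟩, hxy⟩ := hPnt
      exact ⟨x, hx, y, hy, fun h => hxy (by rw [h])⟩
    have h1 : P.xc ≤ Q.facets.ncard := Nat.sInf_le ⟨Q, T, rfl, rfl⟩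
    exact h1.trans (ncard_facets_le hliftQ hfull hQnt)
  exact ⟨P, hdim, hvert, le_antisymm hxc2 hxc1, by rw [e.missCounts_eq, hmiss]⟩

/-- The pairs `(p, q)` with `3 ≤ p < 3 + m ≤ q < 3 + 2 * m` all give different combinatorial
types. -/
theorem sq_le_ncard_typesWithXc {d m : ℕ} (hd : 3 * m + 8 ≤ d)
    (hfin : (typesWithXc d).Finite) : m ^ 2 ≤ (typesWithXc d).ncard := by
  have hex : ∀ x : Fin m × Fin m, ∃ P : Polytope, P.dim = d ∧ P.vertices.ncard = d + 4 ∧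
      P.xc = d + 3 ∧
      missCounts P.Face ∩ {k | 3 ≤ k} = {3 + x.1.1, 3 + m + x.2.1} := fun x =>
    exists_polytope (by omega) (by omega) (by omega)
  choose P hdim hvert hxc hmiss using hex
  have hinj : Function.Injective fun x => (P x).combType := by
    intro x y hxy
    obtain ⟨e⟩ : Nonempty ((P x).Face ≃o (P y).Face) := Quotient.exact hxy
    have h1 := hmiss x
    rw [e.missCounts_eq, hmiss y, Set.pair_eq_pair_iff] at h1
    have h2 : y.1.1 = x.1.1 ∧ y.2.1 = x.2.1 := by omega
    exact (Prod.ext (Fin.ext h2.1) (Fin.ext h2.2)).symm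
  calc m ^ 2 = (Set.univ : Set (Fin m × Fin m)).ncard := by
        rw [Set.ncard_univ, Nat.card_prod, Nat.card_fin, sq]
    _ ≤ (typesWithXc d).ncard := by
        refine Set.ncard_le_ncard_of_injOn (fun x => (P x).combType) ?_ hinj.injOn hfin
        exact fun x _ => ⟨P x, rfl, hdim x, hvert x, hxc x⟩

end Polytope

end Construction

theorem mainTheorem8 :
    (∀ d : ℕ, (Polytope.typesWithXc d).Finite) ∧
      (fun d : ℕ => ((Polytope.typesWithXc d).ncard : ℝ)) =Θ[atTop] (fun d : ℕ => (d : ℝ) ^ 2) := by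
  obtain ⟨K, hK⟩ := Polytope.exists_bound_ncard_typesWithXc
  refine ⟨fun d => (hK d).1, ?_, ?_⟩
  · refine IsBigO.of_bound (25 * K) ?_
    filter_upwards [eventually_ge_atTop 1] with d hd
    rw [Real.norm_of_nonneg (by positivity), Real.norm_of_nonneg (by positivity)]
    have h1 : ((Polytope.typesWithXc d).ncard : ℝ) ≤ K * ((d : ℝ) + 3 + 1) ^ 2 := by
      exact_mod_cast (hK d).2
    have h2 : (1 : ℝ) ≤ d := by exact_mod_cast hd
    have h3 : ((d : ℝ) + 3 + 1) ^ 2 ≤ (5 * d) ^ 2 := by gcongr; linarith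
    have h4 : (0 : ℝ) ≤ K := by positivity
    calc _ ≤ K * ((d : ℝ) + 3 + 1) ^ 2 := h1
      _ ≤ K * (5 * d) ^ 2 := by gcongr
      _ = _ := by ring
  · -- `m = d / 8` satisfies `3 * m + 8 ≤ d` and `d ≤ 16 * m` once `16 ≤ d`
    refine IsBigO.of_bound 256 ?_
    filter_upwards [eventually_ge_atTop 16] with d hd
    rw [Real.norm_of_nonneg (by positivity), Real.norm_of_nonneg (by positivity)]
    have h1 := Polytope.sq_le_ncard_typesWithXc (d := d) (m := d / 8) (by omega) (hK d).1
    have h2 : ((d / 8 : ℕ) : ℝ) ^ 2 ≤ ((Polytope.typesWithXc d).ncard : ℝ) := by exact_mod_cast h1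
    have h3 : (d : ℝ) ≤ 16 * ((d / 8 : ℕ) : ℝ) := by
      have : d ≤ 16 * (d / 8) := by omega
      exact_mod_cast this
    calc (d : ℝ) ^ 2 ≤ (16 * ((d / 8 : ℕ) : ℝ)) ^ 2 := by gcongr
      _ = 256 * ((d / 8 : ℕ) : ℝ) ^ 2 := by ring
      _ ≤ _ := by gcongr
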